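/- Let $\Omega\subset\mathbb R^3$ be a bounded domain with smooth boundary, let $A=-\Delta$ be the Dirichlet Laplacian on $L^2(\Omega)$ with domain $H^1_0(\Omega)\cap H^2(\Omega)$, and for $\sigma\in\mathbb R$ let $\mathrm H^\sigma=\mathcal D(A^{\sigma/2})$ with norm $\|u\|_\sigma=\|A^{\sigma/2}u\|_{L^2(\Omega)}$ (the completion of $L^2(\Omega)$ in this norm if $\sigma<0$). Let $\mu$ be a nonnegative, locally absolutely continuous, summable function on $(0,\infty)$ (possibly singular at $0$) with $\int_0^\infty\mu(s)\,ds\in(0,1)$ and $\mu'(s)+\delta\mu(s)\le 0$ for almost every $s>0$, for some $\delta>0$. Put $\mathcal M^\sigma=L^2_\mu((0,\infty);\mathrm H^{\sigma+1})$ and $\mathcal H^\sigma=\mathrm H^{\sigma+1}\times\mathrm H^\sigma\times\mathcal M^\sigma$ with $$\|(u,v,\eta)\|_{\mathcal H^\sigma}^2=\|u\|_{\sigma+1}^2+\|v\|_\sigma^2+\int_0^\infty\mu(s)\|\eta(s)\|_{\sigma+1}^2\,ds,$$ and let $T\eta=-\partial_s\eta$ with domain $\{\eta\in\mathcal M^\sigma:\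 \partial_s\eta\in\mathcal M^\sigma,\ \eta(0)=0\}$. Proposition 7.1. Let $\sigma\in\mathbb R$ and $\varepsilon_0>0$. There is a constant $c>0$, depending only on $\Omega,\mu,\sigma,\varepsilon_0$, with the following property. Let $k\in L^2_{\rm loc}(\mathbb R;\mathrm H^\sigma)$, put $K(t,\tau)=\int_\tau^t k(y)\,dy$, and assume that for some $\ell\ge 0$ $$\sup_{\tau\in\mathbb R,\ t\ge\tau}\Big\{\|K(t,\tau)\|_{\sigma-1}^2+\int_t^{t+1}\|K(y,\tau)\|_\sigma^2\,dy\Big\}\le\ell^2 .$$ Then for every $\varepsilon\in(0,\varepsilon_0]$ and every $\tau\in\mathbb R$ the problem $$\begin{cases}\partial_{tt}v+Av+\displaystyle\int_0^\infty\mu(s)A\zeta(s)\,ds=k(t/\varepsilon),\\ \partial_t\zeta=T\zeta+\partial_t v,\\ (v(\tau),\partial_tv(\tau),\zeta^\tau)=(0,0,0)\end{cases}$$ has a unique (mild) solution $V=(v,\partial_tv,\zeta)\in C([\tau,\infty);\mathcal H^\sigma)$, and $$\|V(t)\|_{\mathcal H^{\sigma-1}}\le c\,\ell\,\varepsilon\qquad\text{for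 all } t\ge\tau .$$ -/

import Mathlib

open MeasureTheory Set Filter Topology
open scoped ENNReal ContDiff

namespace Viscoelastic

noncomputable section

/-- Three-dimensional Euclidean space. -/
abbrev E3 : Type := EuclideanSpace ℝ (Fin 3)

/-- A bounded domain (nonempty, open, connected, bounded) with smooth boundary: near each boundary
point `x` the set is `{ρ < 0}` for a smooth function `ρ` with `dρ(x) ≠ 0`. -/
structure IsSmoothBoundedDomain (Ω : Set E3) : Prop where
  isOpen : IsOpen Ω
  isConnected : IsConnected Ω
  isBounded : Bornology.IsBounded Ω
  smooth_boundary : ∀ x ∈ frontier Ω, ∃ (N : Set E3) (ρ : E3 → ℝ), IsOpen N ∧ x ∈ N ∧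
    ContDiff ℝ ∞ ρ ∧ fderiv ℝ ρ x ≠ 0 ∧ ∀ y ∈ N, y ∈ Ω ↔ ρ y < 0

/-! ### The Dirichlet Laplacian -/

/-- The real Hilbert space `L²(Ω)`. -/
abbrev L2 (Ω : Set E3) : Type := Lp ℝ 2 (volume.restrict Ω)

/-- Test functions `φ ∈ C_c^∞(Ω)`. -/
def IsTest (Ω : Set E3) (φ : E3 → ℝ) : Prop :=
  ContDiff ℝ ∞ φ ∧ HasCompactSupport φ ∧ tsupport φ ⊆ Ω

/-- The classical partial derivative `∂ᵢφ`. -/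
def partialDeriv (i : Fin 3) (φ : E3 → ℝ) (x : E3) : ℝ :=
  fderiv ℝ φ x (EuclideanSpace.single i 1)

/-- `g` is the weak derivative `∂ᵢu` in `Ω`. -/
def HasWeakPartial (Ω : Set E3) (i : Fin 3) (u g : L2 Ω) : Prop :=
  ∀ φ : E3 → ℝ, IsTest Ω φ →
    ∫ x in Ω, u x * partialDeriv i φ x = -∫ x in Ω, g x * φ x

/-- The pairs `(u, ∇u)` with `u ∈ H¹₀(Ω)`: the closure in `L²(Ω) × L²(Ω)³` of the
pairs `(φ, ∇φ)` with `φ ∈ C_c^∞(Ω)`. -/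
def H10 (Ω : Set E3) : Submodule ℝ (L2 Ω × (Fin 3 → L2 Ω)) :=
  (Submodule.span ℝ {p | ∃ φ : E3 → ℝ, IsTest Ω φ ∧ p.1 =ᵐ[volume.restrict Ω] φ ∧
    ∀ i, p.2 i =ᵐ[volume.restrict Ω] partialDeriv i φ}).topologicalClosure

/-- `u ∈ 𝒟(A) = H¹₀(Ω) ∩ H²(Ω)` and `Au = -Δu = f`. Here `G` is the weak gradient of `u`, and
`H i j` is the weak second derivative `∂ⱼ∂ᵢu`. -/
def IsDirichletLaplacian (Ω : Set E3) (u f : L2 Ω) : Prop :=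
  ∃ (G : Fin 3 → L2 Ω) (H : Fin 3 → Fin 3 → L2 Ω), (u, G) ∈ H10 Ω ∧
    (∀ i j, HasWeakPartial Ω j (G i) (H i j)) ∧ f = -∑ i, H i i

lemma IsTest.memLp {Ω : Set E3} {φ : E3 → ℝ} (h : IsTest Ω φ) :
    MemLp φ 2 (volume.restrict Ω) :=
  (h.1.continuous.memLp_of_hasCompactSupport h.2.1).restrict Ω

lemma IsTest.memLp_partialDeriv {Ω : Set E3} {φ : E3 → ℝ} (h : IsTest Ω φ) (i : Fin 3) :
    MemLp (partialDeriv i φ) 2 (volume.restrict Ω) := by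
  refine (Continuous.memLp_of_hasCompactSupport (μ := volume) ?_ ?_).restrict Ω
  · exact (h.1.continuous_fderiv (by simp)).clm_apply continuous_const
  · exact h.2.1.fderiv_apply (𝕜 := ℝ) _

lemma HasWeakPartial.add {Ω : Set E3} {i : Fin 3} {u g u' g' : L2 Ω}
    (h : HasWeakPartial Ω i u g) (h' : HasWeakPartial Ω i u' g') :
    HasWeakPartial Ω i (u + u') (g + g') := by
  intro φ hφ
  have key : ∀ (a b : L2 Ω) (ψ : E3 → ℝ), MemLp ψ 2 (volume.restrict Ω) →
      ∫ x in Ω, (a + b : L2 Ω) x * ψ x = (∫ x in Ω, a x * ψ x) + ∫ x in Ω, b x * ψ x := by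
    intro a b ψ hψ
    have ha : Integrable (fun x => a x * ψ x) (volume.restrict Ω) :=
      (Lp.memLp a).integrable_mul hψ
    have hb : Integrable (fun x => b x * ψ x) (volume.restrict Ω) :=
      (Lp.memLp b).integrable_mul hψ
    rw [← integral_add ha hb]
    refine integral_congr_ae ?_
    filter_upwards [Lp.coeFn_add a b] with x hx
    rw [hx, Pi.add_apply, add_mul]
  rw [key _ _ _ (hφ.memLp_partialDeriv i), key _ _ _ hφ.memLp, h φ hφ, h' φ hφ]
  ring

lemma HasWeakPartial.smul {Ω : Set E3} {i : Fin 3} {u g : L2 Ω} (c : ℝ)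
    (h : HasWeakPartial Ω i u g) : HasWeakPartial Ω i (c • u) (c • g) := by
  intro φ hφ
  have key : ∀ (a : L2 Ω) (ψ : E3 → ℝ),
      ∫ x in Ω, (c • a : L2 Ω) x * ψ x = c * ∫ x in Ω, a x * ψ x := by
    intro a ψ
    rw [← integral_const_mul]
    refine integral_congr_ae ?_
    filter_upwards [Lp.coeFn_smul c a] with x hx
    simp [hx, mul_assoc]
  rw [key, key, h φ hφ]
  ring

lemma IsDirichletLaplacian.add {Ω : Set E3} {u f u' f' : L2 Ω}
    (h : IsDirichletLaplacian Ω u f) (h' : IsDirichletLaplacian Ω u' f') :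
    IsDirichletLaplacian Ω (u + u') (f + f') := by
  obtain ⟨G, H, h1, h2, h3⟩ := h
  obtain ⟨G', H', h1', h2', h3'⟩ := h'
  refine ⟨G + G', H + H', (H10 Ω).add_mem h1 h1', fun i j => (h2 i j).add (h2' i j), ?_⟩
  simp [h3, h3', Finset.sum_add_distrib, add_comm]

lemma IsDirichletLaplacian.smul {Ω : Set E3} {u f : L2 Ω} (c : ℝ)
    (h : IsDirichletLaplacian Ω u f) : IsDirichletLaplacian Ω (c • u) (c • f) := by
  obtain ⟨G, H, h1, h2, h3⟩ := h
  refine ⟨c • G, c • H, (H10 Ω).smul_mem c h1, fun i j => (h2 i j).smul c, ?_⟩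
  simp [h3, Finset.smul_sum]

lemma isDirichletLaplacian_zero (Ω : Set E3) : IsDirichletLaplacian Ω 0 0 := by
  refine ⟨0, 0, (H10 Ω).zero_mem, fun i j => ?_, by simp⟩
  have key : ∀ ψ : E3 → ℝ, ∫ x in Ω, (0 : L2 Ω) x * ψ x = 0 := by
    intro ψ
    refine integral_eq_zero_of_ae ?_
    filter_upwards [Lp.coeFn_zero ℝ 2 (volume.restrict Ω)] with x hx
    rw [hx]
    simp
  intro φ hφ
  simp only [Pi.zero_apply]
  rw [key, key, neg_zero]

/-- The eigenspace `{u ∈ 𝒟(A) : Au = λu}`. -/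
def preEigenspace (Ω : Set E3) (lam : ℝ) : Submodule ℝ (L2 Ω) where
  carrier := {u | IsDirichletLaplacian Ω u (lam • u)}
  zero_mem' := by simpa using isDirichletLaplacian_zero Ω
  add_mem' h h' := by
    simp only [mem_ofPred_eq, smul_add] at *
    exact h.add h'
  smul_mem' c u h := by
    simp only [mem_ofPred_eq] at *
    rw [smul_comm]
    exact h.smul c

/-- The eigenspace of `A` for `λ`, as a closed subspace of `L²(Ω)`. (The eigenspace is
closed, in fact finite dimensional; the closure is taken only to have completeness at once.) -/
def eigenspace (Ω : Set E3) (lam : ℝ) : Submodule ℝ (L2 Ω) :=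
  (preEigenspace Ω lam).topologicalClosure

instance (Ω : Set E3) (lam : ℝ) : CompleteSpace (eigenspace Ω lam) :=
  (Submodule.isClosed_topologicalClosure _).completeSpace_coe

/-! ### The scale `HH^σ = 𝒟(A^{σ/2})`

`A` is a positive self-adjoint operator with compact resolvent, so that `L²(Ω)` is the Hilbert sum
of its eigenspaces, `A^{σ/2}` multiplies the component in the eigenspace of `λ` by `λ^{σ/2}`,
and `𝒟(A^{σ/2})` (completed for the norm `‖A^{σ/2}·‖` if `σ < 0`) is the space of all
eigenfunction expansions `u = ∑ u_λ` with `∑ λ^σ ‖u_λ‖² < ∞`. -/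

section Scale

variable (E : Ioi (0 : ℝ) → Type) [∀ lam, NormedAddCommGroup (E lam)]
  [∀ lam, InnerProductSpace ℝ (E lam)]

/-- The map `A^{σ/2}` on formal sums `(u_λ)_{λ > 0}`, if `A = λ` on `E_λ`. -/
def powA (σ : ℝ) : (∀ lam, E lam) →ₗ[ℝ] (∀ lam, E lam) where
  toFun u lam := ((lam : ℝ) ^ (σ / 2)) • u lam
  map_add' u v := by ext1 lam; simp
  map_smul' c u := by
    ext1 lam
    simp only [Pi.smul_apply, RingHom.id_apply]
    rw [smul_comm]

/-- The norm `‖u‖_σ = ‖A^{σ/2}u‖ = (∑ λ^σ ‖u_λ‖²)^{1/2}` of a formal sum, with value `∞` exactly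
when `u` is not in the space `Scale E σ` below. -/
def scaleENorm (σ : ℝ) (u : ∀ lam, E lam) : ℝ≥0∞ :=
  (∑' lam : Ioi (0 : ℝ), ENNReal.ofReal ((lam : ℝ) ^ σ) * ‖u lam‖ₑ ^ 2) ^ (1 / 2 : ℝ)

/-- The formal sums `u` for which `A^{σ/2}u` is square summable. -/
def scaleSubmodule (σ : ℝ) : Submodule ℝ (∀ lam, E lam) where
  carrier := {u | Memℓp (powA E σ u) 2}
  zero_mem' := by
    simp only [mem_ofPred_eq, map_zero]
    exact zero_memℓp
  add_mem' h h' := by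
    simp only [mem_ofPred_eq, map_add] at *
    exact h.add h'
  smul_mem' c u h := by
    simp only [mem_ofPred_eq, map_smul] at *
    exact h.const_smul c

/-- The space of formal sums `u` for which `A^{σ/2}u` is square summable. -/
def Scale (σ : ℝ) : Type := scaleSubmodule E σ

instance (σ : ℝ) : AddCommGroup (Scale E σ) :=
  inferInstanceAs (AddCommGroup (scaleSubmodule E σ))

instance (σ : ℝ) : Module ℝ (Scale E σ) :=
  inferInstanceAs (Module ℝ (scaleSubmodule E σ))

/-- The underlying formal sum. -/
def Scale.toExp {E : Ioi (0 : ℝ) → Type} [∀ lam, NormedAddCommGroup (E lam)]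
    [∀ lam, InnerProductSpace ℝ (E lam)] {σ : ℝ} (u : Scale E σ) : ∀ lam, E lam := u.1

/-- The square summable family `A^{σ/2}u`. -/
def Scale.toLp (σ : ℝ) : Scale E σ →ₗ[ℝ] lp E 2 where
  toFun u := ⟨powA E σ u.toExp, u.2⟩
  map_add' u v := by
    apply lp.ext
    exact (powA E σ).map_add u.toExp v.toExp
  map_smul' c u := by
    apply lp.ext
    exact (powA E σ).map_smul c u.toExp

lemma Scale.toLp_bijective (σ : ℝ) : Function.Bijective (Scale.toLp E σ) := by
  have hpos : ∀ lam : Ioi (0 : ℝ), ((lam : ℝ) ^ (σ / 2)) ≠ 0 := fun lam =>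
    (Real.rpow_pos_of_pos lam.2 _).ne'
  constructor
  · intro u v h
    apply Subtype.ext
    funext lam
    have := congrFun (congrArg Subtype.val h) lam
    exact smul_right_injective _ (hpos lam) this
  · intro w
    have hw : powA E σ (fun lam => ((lam : ℝ) ^ (σ / 2))⁻¹ • w.1 lam) = w.1 := by
      funext lam
      exact smul_inv_smul₀ (hpos lam) _
    refine ⟨⟨fun lam => ((lam : ℝ) ^ (σ / 2))⁻¹ • w.1 lam, ?_⟩, ?_⟩
    · change Memℓp (powA E σ _) 2
      rw [hw]
      exact w.2
    · exact lp.ext hw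

/-- The norm `‖u‖_σ = ‖A^{σ/2}u‖`. -/
instance (σ : ℝ) : NormedAddCommGroup (Scale E σ) :=
  NormedAddCommGroup.induced (Scale E σ) (lp E 2) (Scale.toLp E σ) (Scale.toLp_bijective E σ).1

instance (σ : ℝ) : NormedSpace ℝ (Scale E σ) :=
  NormedSpace.induced ℝ (Scale E σ) (lp E 2) (Scale.toLp E σ)

instance (σ : ℝ) [∀ lam, CompleteSpace (E lam)] : CompleteSpace (Scale E σ) := by
  have hi : Isometry (Scale.toLp E σ) := AddMonoidHomClass.isometry_of_norm _ fun _ => rfl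
  have e : Scale E σ ≃ᵢ lp E 2 := ⟨Equiv.ofBijective _ (Scale.toLp_bijective E σ), hi⟩
  exact e.completeSpace

/-- On the space `Scale E σ`, the extended norm is the norm. -/
lemma scaleENorm_toExp {σ : ℝ} (u : Scale E σ) : scaleENorm E σ u.toExp = ‖u‖ₑ := by
  have hn : ‖u‖ = ‖Scale.toLp E σ u‖ := rfl
  have hs := lp.hasSum_norm (p := 2) (by simp) (Scale.toLp E σ u)
  have ht : ∀ lam : Ioi (0 : ℝ), ENNReal.ofReal ((lam : ℝ) ^ σ) * ‖u.toExp lam‖ₑ ^ 2 =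
      ENNReal.ofReal (‖Scale.toLp E σ u lam‖ ^ (2 : ℝ≥0∞).toReal) := by
    intro lam
    have h0 : (0 : ℝ) < lam := lam.2
    have : Scale.toLp E σ u lam = ((lam : ℝ) ^ (σ / 2)) • u.toExp lam := rfl
    rw [this, norm_smul, Real.norm_of_nonneg (Real.rpow_nonneg h0.le _), ← ofReal_norm,
      ← ENNReal.ofReal_pow (norm_nonneg _), ← ENNReal.ofReal_mul (Real.rpow_nonneg h0.le _)]
    congr 1
    simp only [ENNReal.toReal_ofNat, Real.rpow_ofNat, mul_pow]
    rw [← Real.rpow_natCast ((lam : ℝ) ^ (σ / 2)), ← Real.rpow_mul h0.le]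
    norm_num
  unfold scaleENorm
  rw [tsum_congr ht, ← ENNReal.ofReal_tsum_of_nonneg (fun _ => by positivity) hs.summable,
    hs.tsum_eq, ← hn, ← ofReal_norm, ENNReal.ofReal_rpow_of_nonneg (by positivity) (by norm_num),
    ← Real.rpow_mul (norm_nonneg _)]
  norm_num

/-- The extended norm is finite exactly on the space `Scale E σ`. -/
lemma mem_scaleSubmodule_iff {σ : ℝ} (u : ∀ lam, E lam) :
    u ∈ scaleSubmodule E σ ↔ scaleENorm E σ u ≠ ⊤ := by
  constructor
  · intro h
    exact (scaleENorm_toExp E (σ := σ) ⟨u, h⟩).trans_ne enorm_ne_top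
  · intro h
    have h1 : (∑' lam : Ioi (0 : ℝ), ENNReal.ofReal ((lam : ℝ) ^ σ) * ‖u lam‖ₑ ^ 2) ≠ ⊤ := by
      intro h'
      exact h (by unfold scaleENorm; rw [h']; simp)
    have h2 := ENNReal.summable_toReal h1
    change Memℓp (powA E σ u) 2
    refine memℓp_gen (h2.congr fun lam => ?_)
    have h0 : (0 : ℝ) < lam := lam.2
    have : powA E σ u lam = ((lam : ℝ) ^ (σ / 2)) • u lam := rfl
    rw [this, norm_smul, Real.norm_of_nonneg (Real.rpow_nonneg h0.le _)]
    simp only [ENNReal.toReal_mul, ENNReal.toReal_pow, toReal_enorm, ENNReal.toReal_ofNat,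
      Real.rpow_ofNat, mul_pow]
    rw [ENNReal.toReal_ofReal (Real.rpow_nonneg h0.le _),
      ← Real.rpow_natCast ((lam : ℝ) ^ (σ / 2)), ← Real.rpow_mul h0.le]
    norm_num

end Scale

/-- The eigenspace of `A` for `λ > 0` (trivial unless `λ` is an eigenvalue), as a type. -/
abbrev Eig (Ω : Set E3) (lam : Ioi (0 : ℝ)) : Type := eigenspace Ω (lam : ℝ)

/-- Formal eigenfunction expansions `(u_λ)_{λ > 0}`, with `u_λ` in the eigenspace of `λ`. All the
spaces `HH^σ` are subspaces of this one. -/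
abbrev Expansion (Ω : Set E3) : Type := (lam : Ioi (0 : ℝ)) → Eig Ω lam

/-- `A` acting on expansions. -/
def opA (Ω : Set E3) (u : Expansion Ω) : Expansion Ω := fun lam => (lam : ℝ) • u lam

/-- The space `HH^σ = 𝒟(A^{σ/2})`, with norm `‖u‖_σ = ‖A^{σ/2}u‖`. -/
abbrev HH (Ω : Set E3) (σ : ℝ) : Type := Scale (Eig Ω) σ

/-- The norm `‖u‖_σ` of an expansion, equal to `∞` if `u ∉ HH^σ`. -/
abbrev eNormHH (Ω : Set E3) (σ : ℝ) (u : Expansion Ω) : ℝ≥0∞ := scaleENorm (Eig Ω) σ u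

/-! ### Memory kernel, memory spaces and phase spaces -/

/-- The assumptions on the memory kernel `μ` on `(0,∞)`: it is nonnegative, (locally) absolutely
continuous (it may be singular at `0`), summable with total mass in `(0,1)`, and
`μ' + δμ ≤ 0` almost everywhere for some `δ > 0`. -/
structure IsMemoryKernel (μ : ℝ → ℝ) : Prop where
  nonneg : ∀ s, 0 < s → 0 ≤ μ s
  absCont : ∀ a b, 0 < a → a < b → AbsolutelyContinuousOnInterval μ a b
  summable : IntegrableOn μ (Ioi 0)
  mass_pos : 0 < ∫ s in Ioi 0, μ s
  mass_lt_one : ∫ s in Ioi 0, μ s < 1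
  decay : ∃ δ > 0, ∀ᵐ s ∂(volume.restrict (Ioi 0)), deriv μ s + δ * μ s ≤ 0

/-- The measure `μ(s) ds` on `(0,∞)`. -/
def memMeasure (μ : ℝ → ℝ) : Measure ℝ :=
  (volume.restrict (Ioi 0)).withDensity fun s => ENNReal.ofReal (μ s)

/-- The memory space `𝓜^σ = L²_μ(ℝ⁺; HH^{σ+1})`. -/
abbrev MemSpace (Ω : Set E3) (μ : ℝ → ℝ) (σ : ℝ) : Type := Lp (HH Ω (σ + 1)) 2 (memMeasure μ)

/-- The extended memory space `𝓗^σ = HH^{σ+1} × HH^σ × 𝓜^σ`, as a topological vector space (the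
Euclidean product norm is equivalent to the norm of the product; it is `phaseENorm` below). -/
abbrev PhaseSpace (Ω : Set E3) (μ : ℝ → ℝ) (σ : ℝ) : Type :=
  HH Ω (σ + 1) × HH Ω σ × MemSpace Ω μ σ

/-- The norm of `𝓗^θ`,
`‖(u,v,η)‖_{𝓗^θ} = (‖u‖²_{θ+1} + ‖v‖²_θ + ∫₀^∞ μ(s) ‖η(s)‖²_{θ+1} ds)^{1/2}`,
evaluated on an element of `𝓗^σ` (with value `∞` if the element is not in `𝓗^θ`). -/
def phaseENorm {Ω : Set E3} {μ : ℝ → ℝ} {σ : ℝ} (θ : ℝ) (U : PhaseSpace Ω μ σ) : ℝ≥0∞ :=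
  (eNormHH Ω (θ + 1) U.1.toExp ^ 2 + eNormHH Ω θ U.2.1.toExp ^ 2 +
    ∫⁻ s, eNormHH Ω (θ + 1) (U.2.2 s).toExp ^ 2 ∂(memMeasure μ)) ^ (1 / 2 : ℝ)

/-- `η ∈ 𝒟(T)` and `Tη = -∂ₛη = ξ`: `-ξ` is the distributional derivative of `η` in the interval
`{s > 0 : μ(s) > 0}` on which elements of `L²_μ` are defined, and `η(0) = lim_{s → 0} η(s) = 0`
(for a representative of `η`). -/
def IsTransport {Ω : Set E3} {μ : ℝ → ℝ} {σ : ℝ} (η ξ : MemSpace Ω μ σ) : Prop :=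
  (∀ φ : ℝ → ℝ, ContDiff ℝ ∞ φ → HasCompactSupport φ → tsupport φ ⊆ {s | 0 < s ∧ 0 < μ s} →
    ∫ s in Ioi 0, deriv φ s • η s = ∫ s in Ioi 0, φ s • ξ s) ∧
  ∃ η₀ : ℝ → HH Ω (σ + 1), η =ᵐ[memMeasure μ] η₀ ∧ Tendsto η₀ (𝓝[>] 0) (𝓝 0)

/-- `U = (u,v,η) ∈ 𝒟(𝔸)` and `𝔸U = W`, for the operator of `𝓗^σ`
`𝔸(u,v,η) = (v, -A[u + ∫₀^∞ μ(s)η(s) ds], Tη + v)`,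
whose domain consists of the `U ∈ 𝓗^σ` with `v ∈ HH^{σ+1}`, `u + ∫₀^∞ μ(s)η(s) ds ∈ HH^{σ+2}` and
`η ∈ 𝒟(T)`. The first two conditions hold because `W ∈ 𝓗^σ`. -/
def IsGenerator {Ω : Set E3} {μ : ℝ → ℝ} {σ : ℝ} (U W : PhaseSpace Ω μ σ) : Prop :=
  W.1.toExp = U.2.1.toExp ∧
  W.2.1.toExp = -opA Ω (U.1 + ∫ s in Ioi 0, μ s • U.2.2 s).toExp ∧
  ∃ ξ : MemSpace Ω μ σ, IsTransport U.2.2 ξ ∧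
    W.2.2 =ᵐ[memMeasure μ] fun s => ξ s + W.1

/-- `V = (v, ∂ₜv, ζ) ∈ C([τ,∞), 𝓗^σ)` is the (mild) solution of the linear problem
`∂ₜₜv + Av + ∫₀^∞ μ(s) Aζ(s) ds = h(t)`, `∂ₜζ = Tζ + ∂ₜv` on `[τ,∞)` with zero data at time `τ`,
that is of `V' = 𝔸V + (0,h,0)`, `V(τ) = 0`, in the sense usual for evolution equations
with unbounded operators: `∫_τ^t V ∈ 𝒟(𝔸)` and `V(t) = 𝔸 ∫_τ^t V + ∫_τ^t (0,h,0)`. -/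
structure IsSolution {Ω : Set E3} {μ : ℝ → ℝ} {σ : ℝ} (τ : ℝ) (h : ℝ → HH Ω σ)
    (V : ℝ → PhaseSpace Ω μ σ) : Prop where
  continuousOn : ContinuousOn V (Ici τ)
  initial : V τ = 0
  equation : ∀ t, τ ≤ t →
    IsGenerator (∫ y in τ..t, V y) (V t - (0, ∫ y in τ..t, h y, 0))

/-- `k ∈ L²_loc(ℝ; HH^σ)`. -/
def IsL2loc {Ω : Set E3} {σ : ℝ} (k : ℝ → HH Ω σ) : Prop :=
  ∀ a b : ℝ, MemLp k 2 (volume.restrict (Icc a b))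

/-- `K(t,τ) = ∫_τ^t k(y) dy`. -/
def primitive {Ω : Set E3} {σ : ℝ} (k : ℝ → HH Ω σ) (t τ : ℝ) : HH Ω σ := ∫ y in τ..t, k y

end

end Viscoelastic

open Viscoelastic

namespace Viscoelastic

/-! ### Memory kernels -/

/-! On the eigenspace of `A` for `lam` the problem becomes a scalar Volterra equation. Since the
past vanishes, the memory variable is `ζ(s) = v(t) - v(t-s)`, and with `κ` the mass of `μ` the
equation reads `v'' + lam (1+κ) v - lam ∫ μ(s) v(t-s) ds = h`. Let `w` be the response to a unit
impulse, `p = w'` and `q = p'`. Duhamel's formula gives `v = w * h` and `∂ₜv = p * h`. If `H` is the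
primitive of `h` that vanishes at `τ`, an integration by parts gives `v = p * H` and `∂ₜv = H + q *
H`, so that the forcing acts only through its primitive. For `h = k(·/ε)` one has `H(t) = ε K(t/ε,
τ/ε)`, which is the source of the factor `ε`.

It remains to know that `p` and `q` decay uniformly in `lam`. The function `p` solves the
homogeneous equation with `p(0) = 1`, `q(0) = 0`, hence with initial energy `lam (1+κ)`. Exponential
decay of the energy at a rate independent of `lam` therefore gives `p² ≲ exp(-γr)` and `q² ≲ lam
exp(-γr)`; the factor `lam` lost in `q` is why the final norm is one step weaker. The decay is
`IsMemoryKernel.exists_decay`. The energy itself dissipates only the memory part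
(`IsModeSol.hasDerivAt_energy`); the other two parts are recovered by a Lyapunov functional built on
the multiplier `∫₀^b (b-s) ζ(s) ds`, whose weight is bounded, so that a singularity of `μ` at `0`
does no harm. The eigenvalue enters the constants only through the spectral gap
`IsSmoothBoundedDomain.exists_gap`, a consequence of the Poincaré inequality.

A weighted Cauchy–Schwarz inequality (`IsFundamental.estimate`) bounds the solution by the norm of
`H(t)` and by `∫ exp(-c(t-y)) ‖H(y)‖² dy`. Cut into windows of length `ε` (`lintegral_exp_mul_le`),
the latter is at most `(1 + 1/(cε))` times `ε² · ε ℓ²`, which is of order `ε² ℓ²` for `ε ≤ ε₀`.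

Existence (`exists_isSolution`) reassembles the modes by diagonal operators. For uniqueness
(`IsSolution.eqOn`), the time integral of the difference of two mild solutions is a classical
solution without forcing; tested with functionals on the eigenspaces, it vanishes by a scalar energy
inequality that rests on the dissipativity of transport in `L²_μ`
(`IsMemoryKernel.integral_mul_nonpos`). -/

lemma IsMemoryKernel.continuousOn {μ : ℝ → ℝ} (hμ : IsMemoryKernel μ) :
    ContinuousOn μ (Ioi 0) := by
  intro s hs
  have hs' : (0 : ℝ) < s := hs
  have h := (hμ.absCont (s / 2) (2 * s) (by linarith) (by linarith)).continuousOn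
  rw [uIcc_of_le (by linarith)] at h
  exact (h.continuousAt (Icc_mem_nhds (by linarith) (by linarith))).continuousWithinAt

/-- A decay rate `δ` of the memory kernel `μ`. -/
def IsDecayRate (μ : ℝ → ℝ) (δ : ℝ) : Prop :=
  ∀ᵐ s ∂(volume.restrict (Ioi 0)), deriv μ s + δ * μ s ≤ 0

lemma IsMemoryKernel.integrableOn_interval {μ : ℝ → ℝ} (hμ : IsMemoryKernel μ) {a b : ℝ}
    (ha : 0 ≤ a) (hb : 0 ≤ b) : IntervalIntegrable μ volume a b := by
  rw [intervalIntegrable_iff]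
  exact hμ.summable.mono_set fun s hs => lt_of_le_of_lt (le_min ha hb) hs.1

/-- This is the decay inequality integrated over `[a,b]`. The restriction `0 < a` is essential: `μ`
need not be absolutely continuous, nor bounded, near `0`. -/
lemma IsMemoryKernel.sub_le {μ : ℝ → ℝ} (hμ : IsMemoryKernel μ) {δ : ℝ}
    (hd : IsDecayRate μ δ) {a b : ℝ} (ha : 0 < a) (hab : a ≤ b) :
    μ b + δ * ∫ s in a..b, μ s ≤ μ a := by
  rcases hab.eq_or_lt with rfl | hab
  · simp
  have hac := hμ.absCont a b ha hab
  have h1 := hac.integral_deriv_eq_sub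
  have h2 : ∫ s in a..b, (deriv μ s + δ * μ s) ≤ ∫ _ in a..b, (0 : ℝ) := by
    refine intervalIntegral.integral_mono_ae_restrict hab.le
      (hac.intervalIntegrable_deriv.add
        ((hμ.integrableOn_interval ha.le (ha.le.trans hab.le)).const_mul δ)) (by simp) ?_
    exact ae_restrict_of_ae_restrict_of_subset (fun s hs => ha.trans_le hs.1) hd
  rw [intervalIntegral.integral_add hac.intervalIntegrable_deriv
    ((hμ.integrableOn_interval ha.le (ha.le.trans hab.le)).const_mul δ), h1,
    intervalIntegral.integral_const_mul] at h2
  simp only [intervalIntegral.integral_zero] at h2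
  linarith

lemma IsMemoryKernel.antitoneOn {μ : ℝ → ℝ} (hμ : IsMemoryKernel μ) :
    AntitoneOn μ (Ioi 0) := by
  intro a ha b _ hab
  obtain ⟨δ, hδ, hd⟩ := hμ.decay
  have h := hμ.sub_le hd ha hab
  have h2 : 0 ≤ ∫ s in a..b, μ s :=
    intervalIntegral.integral_nonneg hab fun s hs => hμ.nonneg s (lt_of_lt_of_le ha hs.1)
  nlinarith [mul_nonneg hδ.le h2]

/-- Let `b → ∞` in `sub_le` and drop `μ b ≥ 0`. It serves for the part `s > t` of the memory, where
`x(t-s)` lies before the initial time and vanishes. -/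
lemma IsMemoryKernel.tail_le {μ : ℝ → ℝ} (hμ : IsMemoryKernel μ) {δ : ℝ}
    (hd : IsDecayRate μ δ) {t : ℝ} (ht : 0 < t) : δ * ∫ s in Ioi t, μ s ≤ μ t := by
  have h1 := intervalIntegral_tendsto_integral_Ioi t
    (hμ.summable.mono_set (Ioi_subset_Ioi ht.le)) tendsto_id
  refine le_of_tendsto (h1.const_mul δ) ?_
  filter_upwards [eventually_ge_atTop t] with b hb
  have := hμ.sub_le hd ht hb
  have := hμ.nonneg b (ht.trans_le hb)
  simp only [id]
  linarith

/-- By monotonicity `μ ≥ μ b` on `(0,b]`; this window, on which the kernel is bounded below, carries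
the multiplier of the decay proof. -/
lemma IsMemoryKernel.exists_pos {μ : ℝ → ℝ} (hμ : IsMemoryKernel μ) :
    ∃ b, 0 < b ∧ 0 < μ b := by
  by_contra! h
  have : ∫ s in Ioi 0, μ s = 0 := by
    rw [setIntegral_congr_fun (g := fun _ => (0 : ℝ)) measurableSet_Ioi
      fun s hs => le_antisymm (h s hs) (hμ.nonneg s hs)]
    simp
  exact hμ.mass_pos.ne' this

/-! ### Primitives in the weighted space and the boundary term at the origin -/

/-- The Cauchy–Schwarz inequality for integrals. -/
lemma sq_integral_mul_le {α : Type*} [MeasurableSpace α] {ν : Measure α} {f g : α → ℝ}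
    (hf : MemLp f 2 ν) (hg : MemLp g 2 ν) :
    (∫ x, f x * g x ∂ν) ^ 2 ≤ (∫ x, f x ^ 2 ∂ν) * ∫ x, g x ^ 2 ∂ν := by
  have h := integral_mul_norm_le_Lp_mul_Lq (μ := ν) (f := f) (g := g)
    (Real.HolderConjugate.two_two) (by simpa using hf) (by simpa using hg)
  simp only [Real.norm_eq_abs, Real.rpow_ofNat, sq_abs] at h
  have h1 : |∫ x, f x * g x ∂ν| ≤ ∫ x, |f x| * |g x| ∂ν := by
    refine (abs_integral_le_integral_abs).trans_eq ?_
    simp [abs_mul]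
  have hf0 : 0 ≤ ∫ x, f x ^ 2 ∂ν := integral_nonneg fun _ => sq_nonneg _
  have hg0 : 0 ≤ ∫ x, g x ^ 2 ∂ν := integral_nonneg fun _ => sq_nonneg _
  rw [← sq_abs]
  calc _ ≤ ((∫ x, f x ^ 2 ∂ν) ^ (1 / 2 : ℝ) * (∫ x, g x ^ 2 ∂ν) ^ (1 / 2 : ℝ)) ^ 2 :=
        pow_le_pow_left₀ (abs_nonneg _) (h1.trans h) 2
    _ = _ := by
        rw [mul_pow, ← Real.sqrt_eq_rpow, ← Real.sqrt_eq_rpow, Real.sq_sqrt hf0,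
          Real.sq_sqrt hg0]

/-- Since `μ` decreases, `√(μ s)` may be moved under the integral and replaced by `√(μ r)`;
Cauchy–Schwarz on an interval of length `s` does the rest. The factor `s` makes the boundary term at
`0` vanish in integrations by parts, even for a singular kernel. -/
lemma IsMemoryKernel.mul_sq_primitive_le {μ : ℝ → ℝ} (hμ : IsMemoryKernel μ) {b : ℝ} {g : ℝ → ℝ}
    (hg : IntervalIntegrable g volume 0 b)
    (hg2 : IntegrableOn (fun s => μ s * g s ^ 2) (Ioc 0 b)) {s : ℝ} (hs : 0 < s) (hsb : s ≤ b) :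
    μ s * (∫ r in 0..s, g r) ^ 2 ≤ s * ∫ r in Ioc 0 b, μ r * g r ^ 2 := by
  have hsub : Ioc 0 s ⊆ Ioc 0 b := Ioc_subset_Ioc_right hsb
  have hgm : AEStronglyMeasurable g (volume.restrict (Ioc 0 s)) :=
    ((intervalIntegrable_iff_integrableOn_Ioc_of_le (hs.le.trans hsb)).1 hg).mono_set hsub |>.1
  have hμm : AEStronglyMeasurable μ (volume.restrict (Ioc 0 s)) :=
    (hμ.summable.mono_set fun r hr => hr.1).1
  have hL : MemLp (fun r => √(μ r) * |g r|) 2 (volume.restrict (Ioc 0 s)) := by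
    rw [memLp_two_iff_integrable_sq]
    · refine (hg2.mono_set hsub).congr ?_
      filter_upwards [ae_restrict_mem measurableSet_Ioc] with r hr
      rw [mul_pow, sq_abs, Real.sq_sqrt (hμ.nonneg r hr.1)]
    · exact (Real.continuous_sqrt.comp_aestronglyMeasurable hμm).mul hgm.norm
  have h1 := sq_integral_mul_le (memLp_const (μ := volume.restrict (Ioc 0 s)) (p := 2) (1 : ℝ)) hL
  have h2 : √(μ s) * |∫ r in 0..s, g r| ≤ ∫ r in Ioc 0 s, √(μ r) * |g r| := by
    rw [intervalIntegral.integral_of_le hs.le]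
    calc _ ≤ √(μ s) * ∫ r in Ioc 0 s, |g r| :=
          mul_le_mul_of_nonneg_left abs_integral_le_integral_abs (Real.sqrt_nonneg _)
      _ = ∫ r in Ioc 0 s, √(μ s) * |g r| := (integral_const_mul _ _).symm
      _ ≤ _ := by
          refine setIntegral_mono_on ?_ (hL.integrable (by norm_num)) measurableSet_Ioc ?_
          · exact ((((intervalIntegrable_iff_integrableOn_Ioc_of_le (hs.le.trans hsb)).1
              hg).mono_set hsub).norm).const_mul _
          · intro r hr
            exact mul_le_mul_of_nonneg_right
              (Real.sqrt_le_sqrt (hμ.antitoneOn hr.1 hs hr.2)) (abs_nonneg _)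
  have h3 : μ s * (∫ r in 0..s, g r) ^ 2 = (√(μ s) * |∫ r in 0..s, g r|) ^ 2 := by
    rw [mul_pow, sq_abs, Real.sq_sqrt (hμ.nonneg s hs)]
  rw [h3]
  refine (pow_le_pow_left₀ (by positivity) h2 2).trans ?_
  simp only [one_mul, one_pow, integral_const, MeasurableSet.univ, measureReal_restrict_apply,
    univ_inter, Real.volume_real_Ioc, sub_zero, smul_eq_mul, mul_one] at h1
  rw [max_eq_left hs.le] at h1
  refine h1.trans (mul_le_mul_of_nonneg_left ?_ hs.le)
  calc _ = ∫ r in Ioc 0 s, μ r * g r ^ 2 := by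
        refine setIntegral_congr_fun measurableSet_Ioc fun r hr => ?_
        rw [mul_pow, sq_abs, Real.sq_sqrt (hμ.nonneg r hr.1)]
    _ ≤ _ := by
        refine setIntegral_mono_set hg2 ?_ hsub.eventuallyLE
        filter_upwards [ae_restrict_mem measurableSet_Ioc] with r hr
        exact mul_nonneg (hμ.nonneg r hr.1) (sq_nonneg _)

lemma IsMemoryKernel.integrableOn_mul_sq_primitive {μ : ℝ → ℝ} (hμ : IsMemoryKernel μ) {b : ℝ}
    (hb : 0 < b) {g : ℝ → ℝ} (hg : IntervalIntegrable g volume 0 b)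
    (hg2 : IntegrableOn (fun s => μ s * g s ^ 2) (Ioc 0 b)) :
    IntegrableOn (fun s => μ s * (∫ r in 0..s, g r) ^ 2) (Ioc 0 b) := by
  have hc : ContinuousOn (fun s => ∫ r in 0..s, g r) (Icc 0 b) := by
    have := intervalIntegral.continuousOn_primitive_interval
      (μ := volume) (f := g) (a := 0) (b := b)
      ((intervalIntegrable_iff_integrableOn_Icc_of_le hb.le).1 hg |>.mono_set
        (by rw [uIcc_of_le hb.le]))
    rwa [uIcc_of_le hb.le] at this
  refine Integrable.mono' (integrable_const (b * ∫ r in Ioc 0 b, μ r * g r ^ 2)) ?_ ?_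
  · exact (hμ.summable.mono_set fun r hr => hr.1).1.mul
      ((hc.mono Ioc_subset_Icc_self).pow 2 |>.aestronglyMeasurable measurableSet_Ioc)
  · filter_upwards [ae_restrict_mem measurableSet_Ioc] with s hs
    rw [Real.norm_of_nonneg (mul_nonneg (hμ.nonneg s hs.1) (sq_nonneg _))]
    refine (hμ.mul_sq_primitive_le hg hg2 hs.1 hs.2).trans
      (mul_le_mul_of_nonneg_right hs.2 ?_)
    exact setIntegral_nonneg measurableSet_Ioc
      fun r hr => mul_nonneg (hμ.nonneg r hr.1) (sq_nonneg _)

lemma IsMemoryKernel.integrableOn_mul_primitive {μ : ℝ → ℝ} (hμ : IsMemoryKernel μ) {b : ℝ}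
    (hb : 0 < b) {g : ℝ → ℝ} (hg : IntervalIntegrable g volume 0 b)
    (hg2 : IntegrableOn (fun s => μ s * g s ^ 2) (Ioc 0 b)) :
    IntegrableOn (fun s => μ s * ((∫ r in 0..s, g r) * g s)) (Ioc 0 b) := by
  have hG := hμ.integrableOn_mul_sq_primitive hb hg hg2
  have hc : ContinuousOn (fun s => ∫ r in 0..s, g r) (Icc 0 b) := by
    have := intervalIntegral.continuousOn_primitive_interval
      (μ := volume) (f := g) (a := 0) (b := b)
      ((intervalIntegrable_iff_integrableOn_Icc_of_le hb.le).1 hg |>.mono_set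
        (by rw [uIcc_of_le hb.le]))
    rwa [uIcc_of_le hb.le] at this
  refine (hG.add hg2).mono' ?_ ?_
  · exact (hμ.summable.mono_set fun r hr => hr.1).1.mul
      (((hc.mono Ioc_subset_Icc_self).aestronglyMeasurable measurableSet_Ioc).mul
        ((intervalIntegrable_iff_integrableOn_Ioc_of_le hb.le).1 hg).1)
  · filter_upwards [ae_restrict_mem measurableSet_Ioc] with s hs
    rw [norm_mul, Real.norm_of_nonneg (hμ.nonneg s hs.1), Pi.add_apply, ← mul_add]
    refine mul_le_mul_of_nonneg_left ?_ (hμ.nonneg s hs.1)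
    rw [Real.norm_eq_abs, abs_le]
    constructor <;> nlinarith [sq_nonneg ((∫ r in 0..s, g r) + g s),
      sq_nonneg ((∫ r in 0..s, g r) - g s), sq_nonneg (g s), sq_nonneg (∫ r in 0..s, g r)]

/-- Dissipativity of the transport operator in the weighted space. -/
lemma IsMemoryKernel.two_mul_integral_ge {μ : ℝ → ℝ} (hμ : IsMemoryKernel μ) {δ : ℝ}
    (hd : IsDecayRate μ δ) {b : ℝ} (hb : 0 < b) {g : ℝ → ℝ}
    (hg : IntervalIntegrable g volume 0 b)
    (hg2 : IntegrableOn (fun s => μ s * g s ^ 2) (Ioc 0 b)) :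
    μ b * (∫ r in 0..b, g r) ^ 2 + δ * ∫ s in 0..b, μ s * (∫ r in 0..s, g r) ^ 2 ≤
      2 * ∫ s in 0..b, μ s * ((∫ r in 0..s, g r) * g s) := by
  set G : ℝ → ℝ := fun s => ∫ r in 0..s, g r with hG
  have i1 := (intervalIntegrable_iff_integrableOn_Ioc_of_le hb.le).2
    (hμ.integrableOn_mul_sq_primitive hb hg hg2)
  have i2 := (intervalIntegrable_iff_integrableOn_Ioc_of_le hb.le).2
    (hμ.integrableOn_mul_primitive hb hg hg2)
  have hGac : AbsolutelyContinuousOnInterval G 0 b :=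
    hg.absolutelyContinuousOnInterval_intervalIntegral (by simp)
  have hGd : ∀ᵐ x, x ∈ uIcc 0 b → HasDerivAt G (g x) x := by
    filter_upwards [hg.ae_hasDerivAt_integral] with x hx hx'
    exact hx hx' 0 (by simp)
  -- The integration by parts is done on `[a,b]` with `a > 0`, where `μ` is absolutely continuous;
  -- the limit `a → 0` is taken at the end.
  have key : ∀ a ∈ Ioo 0 b, μ b * G b ^ 2 - μ a * G a ^ 2 + δ * ∫ s in a..b, μ s * G s ^ 2 ≤
      2 * ∫ s in a..b, μ s * (G s * g s) := by
    intro a ha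
    have hsub : uIcc a b ⊆ uIcc 0 b := by
      rw [uIcc_of_le ha.2.le, uIcc_of_le hb.le]
      exact Icc_subset_Icc_left ha.1.le
    have hμac := hμ.absCont a b ha.1 ha.2
    have hG2 : AbsolutelyContinuousOnInterval (fun s => G s * G s) a b :=
      (hGac.mono hsub).fun_mul (hGac.mono hsub)
    have h1 := hμac.integral_mul_deriv_eq_deriv_mul hG2
    have h2 : ∫ s in a..b, μ s * deriv (fun s => G s * G s) s =
        2 * ∫ s in a..b, μ s * (G s * g s) := by
      rw [← intervalIntegral.integral_const_mul]
      refine intervalIntegral.integral_congr_ae ?_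
      filter_upwards [hGd] with x hx hx'
      have := hx (hsub (uIoc_subset_uIcc hx'))
      rw [(this.fun_mul this).deriv]
      ring
    have h3 : δ * ∫ s in a..b, μ s * G s ^ 2 ≤ - ∫ s in a..b, deriv μ s * (G s * G s) := by
      rw [← intervalIntegral.integral_const_mul, ← intervalIntegral.integral_neg]
      refine intervalIntegral.integral_mono_ae_restrict ha.2.le ?_ ?_ ?_
      · exact (i1.mono_set hsub).const_mul δ
      · exact (hμac.intervalIntegrable_deriv.mul_continuousOn hG2.continuousOn).neg
      · have : ∀ᵐ s ∂(volume.restrict (Icc a b)), deriv μ s + δ * μ s ≤ 0 :=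
          ae_restrict_of_ae_restrict_of_subset (fun s hs => ha.1.trans_le hs.1) hd
        filter_upwards [this] with s hs
        nlinarith [mul_nonneg (sq_nonneg (G s)) (sub_nonneg.2 hs)]
    rw [h2] at h1
    rw [h1]
    nlinarith [h3]
  -- The boundary term at `a` is at most `a` times a constant, although `μ a` may blow up.
  have l0 : Tendsto (fun a => μ a * G a ^ 2) (𝓝[>] 0) (𝓝 0) := by
    have hz : Tendsto (fun a : ℝ => a * ∫ r in Ioc 0 b, μ r * g r ^ 2) (𝓝[>] 0) (𝓝 0) := by
      have : Tendsto (fun a : ℝ => a * ∫ r in Ioc 0 b, μ r * g r ^ 2) (𝓝 0)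
          (𝓝 (0 * ∫ r in Ioc 0 b, μ r * g r ^ 2)) := tendsto_id.mul_const _
      rw [zero_mul] at this
      exact this.mono_left nhdsWithin_le_nhds
    refine squeeze_zero' ?_ ?_ hz
    · filter_upwards [self_mem_nhdsWithin] with a ha
      exact mul_nonneg (hμ.nonneg a ha) (sq_nonneg _)
    · filter_upwards [Ioo_mem_nhdsGT hb] with a ha
      exact hμ.mul_sq_primitive_le hg hg2 ha.1 ha.2.le
  have lim : ∀ f : ℝ → ℝ, IntervalIntegrable f volume 0 b →
      Tendsto (fun a => ∫ s in a..b, f s) (𝓝[>] 0) (𝓝 (∫ s in 0..b, f s)) := by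
    intro f hf
    have h := intervalIntegral.continuousOn_primitive_interval_left (μ := volume) (f := f)
      (a := 0) (b := b) ((intervalIntegrable_iff_integrableOn_Icc_of_le hb.le).1 hf |>.mono_set
        (by rw [uIcc_of_le hb.le]))
    rw [uIcc_of_le hb.le] at h
    have h0 := h 0 (left_mem_Icc.2 hb.le)
    refine h0.tendsto.mono_left ?_
    rw [← nhdsWithin_Ioo_eq_nhdsGT hb]
    exact nhdsWithin_mono _ Ioo_subset_Icc_self
  have hl := ((tendsto_const_nhds (x := μ b * G b ^ 2)).sub l0).add ((lim _ i1).const_mul δ)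
  have hr := (lim _ i2).const_mul 2
  have := le_of_tendsto_of_tendsto hl hr (by
    filter_upwards [Ioo_mem_nhdsGT hb] with a ha using key a ha)
  simpa using this

/-! ### Causal functions and convolution with the memory kernel -/

/-- A causal function: continuous on `[0,∞)` and zero on `(-∞,0)`. -/
structure IsCausal (x : ℝ → ℝ) : Prop where
  zero : ∀ t, t < 0 → x t = 0
  cont : ContinuousOn x (Ici 0)

lemma IsCausal.mul {x y : ℝ → ℝ} (hx : IsCausal x) (hy : IsCausal y) :
    IsCausal fun t => x t * y t :=
  ⟨fun t ht => by simp [hx.zero t ht], hx.cont.mul hy.cont⟩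

lemma IsCausal.const_mul {x : ℝ → ℝ} (c : ℝ) (hx : IsCausal x) : IsCausal fun t => c * x t :=
  ⟨fun t ht => by simp [hx.zero t ht], hx.cont.const_mul c⟩

lemma IsCausal.exists_bound {x : ℝ → ℝ} (hx : IsCausal x) (T : ℝ) :
    ∃ C, 0 ≤ C ∧ ∀ r ≤ T, |x r| ≤ C := by
  obtain ⟨C, hC⟩ := (isCompact_Icc (a := (0 : ℝ)) (b := T)).exists_bound_of_continuousOn
    (hx.cont.mono fun r hr => hr.1)
  refine ⟨max C 0, le_max_right _ _, fun r hr => ?_⟩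
  rcases lt_or_ge r 0 with h | h
  · simp [hx.zero r h]
  · exact (hC r ⟨h, hr⟩).trans (le_max_left _ _)

lemma IsCausal.continuousAt {x : ℝ → ℝ} (hx : IsCausal x) {t : ℝ} (ht : t ≠ 0) :
    ContinuousAt x t := by
  rcases lt_or_gt_of_ne ht with h | h
  · have : x =ᶠ[𝓝 t] fun _ => 0 := by
      filter_upwards [Iio_mem_nhds h] with r hr using hx.zero r hr
    exact continuousAt_const.congr this.symm
  · exact hx.cont.continuousAt (Ici_mem_nhds h)

lemma IsCausal.measurable {x : ℝ → ℝ} (hx : IsCausal x) : Measurable x := by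
  have : x = (Ici (0 : ℝ)).indicator fun t => x (max t 0) := by
    funext t
    by_cases ht : 0 ≤ t
    · simp [ht]
    · simp [ht, hx.zero t (not_le.1 ht)]
  rw [this]
  refine Measurable.indicator (Continuous.measurable ?_) measurableSet_Ici
  exact hx.cont.comp_continuous (by fun_prop) fun t => mem_Ici.2 (le_max_right _ _)

lemma IsCausal.intervalIntegrable {x : ℝ → ℝ} (hx : IsCausal x) (a b : ℝ) :
    IntervalIntegrable x volume a b := by
  obtain ⟨C, -, hC⟩ := hx.exists_bound (max a b)
  rw [intervalIntegrable_iff]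
  have : IsFiniteMeasure (volume.restrict (uIoc a b)) := ⟨by simp [uIoc]⟩
  refine Integrable.mono' (integrable_const C) hx.measurable.aestronglyMeasurable ?_
  filter_upwards [ae_restrict_mem measurableSet_uIoc] with r hr
  exact hC r hr.2

/-- The convolution `∫₀^∞ μ(s) x(t-s) ds`. -/
noncomputable def memConv (μ x : ℝ → ℝ) (t : ℝ) : ℝ := ∫ s in Ioi 0, μ s * x (t - s)

lemma IsCausal.integrableOn_memConv {μ x : ℝ → ℝ} (hμ : IntegrableOn μ (Ioi 0))
    (hx : IsCausal x) (t : ℝ) : IntegrableOn (fun s => μ s * x (t - s)) (Ioi 0) := by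
  obtain ⟨C, -, hC⟩ := hx.exists_bound t
  refine hμ.mul_bdd (c := C)
    (hx.measurable.comp (measurable_const.sub measurable_id)).aestronglyMeasurable ?_
  filter_upwards [ae_restrict_mem measurableSet_Ioi] with s hs
  exact hC _ (by linarith [mem_Ioi.1 hs])

lemma IsCausal.continuous_memConv {μ x : ℝ → ℝ} (hμ : IntegrableOn μ (Ioi 0))
    (hx : IsCausal x) : Continuous (memConv μ x) := by
  rw [continuous_iff_continuousAt]
  intro t
  obtain ⟨C, -, hC⟩ := hx.exists_bound (t + 1)
  refine continuousAt_of_dominated (bound := fun s => ‖μ s‖ * C) ?_ ?_ (hμ.norm.mul_const C) ?_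
  · exact Eventually.of_forall fun r => (hx.integrableOn_memConv hμ r).1
  · filter_upwards [Iio_mem_nhds (lt_add_one t)] with r hr
    filter_upwards [ae_restrict_mem measurableSet_Ioi] with s hs
    rw [norm_mul]
    exact mul_le_mul_of_nonneg_left (hC _ (by linarith [mem_Ioi.1 hs, mem_Iio.1 hr]))
      (norm_nonneg _)
  · have : ∀ᵐ s ∂(volume.restrict (Ioi (0 : ℝ))), s ≠ t :=
      ae_restrict_of_ae (by simp [ae_iff, measure_singleton])
    filter_upwards [this] with s hs
    have h := hx.continuousAt (sub_ne_zero.2 hs.symm)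
    exact continuousAt_const.mul (ContinuousAt.comp (f := fun r => r - s) h (by fun_prop))

lemma IsCausal.memConv_of_neg {μ x : ℝ → ℝ} (hx : IsCausal x) {t : ℝ} (ht : t ≤ 0) :
    memConv μ x t = 0 := by
  unfold memConv
  rw [setIntegral_congr_fun (g := fun _ => (0 : ℝ)) measurableSet_Ioi fun s hs => by
    simp [hx.zero (t - s) (by linarith [mem_Ioi.1 hs])]]
  simp

lemma IsCausal.isCausal_memConv {μ x : ℝ → ℝ} (hμ : IntegrableOn μ (Ioi 0))
    (hx : IsCausal x) : IsCausal (memConv μ x) :=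
  ⟨fun _ ht => hx.memConv_of_neg ht.le, (hx.continuous_memConv hμ).continuousOn⟩

lemma IsCausal.sub_eq_integral {x y : ℝ → ℝ} (hx : IsCausal x) (hy : IsCausal y)
    (hd : ∀ t, 0 < t → HasDerivAt x (y t) t) {a b : ℝ} (ha : 0 ≤ a) (hab : a ≤ b) :
    ∫ r in a..b, y r = x b - x a :=
  intervalIntegral.integral_eq_sub_of_hasDerivAt_of_le hab
    (hx.cont.mono fun _ hr => ha.trans hr.1) (fun _ hr => hd _ (ha.trans_lt hr.1))
    (hy.intervalIntegrable a b)

lemma IsCausal.sub_eq_integral_max {x y : ℝ → ℝ} (hx : IsCausal x) (hy : IsCausal y)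
    (hd : ∀ t, 0 < t → HasDerivAt x (y t) t) (a : ℝ) :
    x a = (Ici 0).indicator (fun _ => x 0) a + ∫ r in 0..max a 0, y r := by
  rw [hx.sub_eq_integral hy hd le_rfl (le_max_right a 0)]
  rcases lt_or_ge a 0 with h | h
  · simp [hx.zero a h, h.le, h]
  · simp [h]

/-- Differentiation of a convolution with a function that jumps at `0`. -/
lemma IsMemoryKernel.hasDerivAt_memConv {μ x y : ℝ → ℝ} (hμ : IsMemoryKernel μ)
    (hx : IsCausal x) (hy : IsCausal y) (hd : ∀ t, 0 < t → HasDerivAt x (y t) t)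
    {t : ℝ} (ht : 0 < t) :
    HasDerivAt (memConv μ x) (μ t * x 0 + memConv μ y t) t := by
  -- `X` is `x` without its jump: on the line `x = x(0) 1_{[0,∞)} + X` with `X` locally Lipschitz.
  -- The jump part has convolution `x(0) ∫₀^r μ`, whose derivative is the term `μ t * x 0`.
  set X : ℝ → ℝ := fun a => ∫ r in 0..max a 0, y r with hX
  have hXc : IsCausal X := by
    refine ⟨fun a ha => by simp [hX, max_eq_right ha.le], ?_⟩
    refine Continuous.continuousOn ?_
    exact (intervalIntegral.continuous_primitive (fun a b => hy.intervalIntegrable a b) 0).comp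
      (by fun_prop : Continuous fun a : ℝ => max a 0)
  have hsplit : ∀ r, 0 < r → memConv μ x r = x 0 * (∫ s in 0..r, μ s) + memConv μ X r := by
    intro r hr
    have h1 : ∀ s ∈ Ioi (0 : ℝ), μ s * x (r - s) =
        (Iic r).indicator (fun s => x 0 * μ s) s + μ s * X (r - s) := by
      intro s _
      rw [hx.sub_eq_integral_max hy hd]
      by_cases h : s ≤ r
      · simp [h, hX]; ring
      · simp [h, hX]
    unfold memConv
    rw [setIntegral_congr_fun measurableSet_Ioi h1, integral_add
      ((hμ.summable.const_mul (x 0)).indicator measurableSet_Iic)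
      (hXc.integrableOn_memConv hμ.summable r), integral_indicator measurableSet_Iic,
      Measure.restrict_restrict measurableSet_Iic, intervalIntegral.integral_of_le hr.le,
      integral_const_mul, inter_comm, Ioi_inter_Iic]
  have hd1 : HasDerivAt (fun r => x 0 * ∫ s in 0..r, μ s) (x 0 * μ t) t := by
    refine HasDerivAt.const_mul _ (intervalIntegral.integral_hasDerivAt_right
      (hμ.integrableOn_interval le_rfl ht.le) ?_ (hμ.continuousOn.continuousAt (Ioi_mem_nhds ht)))
    exact hμ.continuousOn.stronglyMeasurableAtFilter isOpen_Ioi t ht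
  -- The kink of `X` at `0` is met only for `s = t`, a null set, so a Lipschitz bound suffices to
  -- differentiate under the integral.
  have hd2 : HasDerivAt (memConv μ X) (memConv μ y t) t := by
    obtain ⟨C, hC0, hC⟩ := hy.exists_bound (t + 1)
    refine (hasDerivAt_integral_of_dominated_loc_of_lip (bound := fun s => |μ s| * C)
      (F := fun r s => μ s * X (r - s)) (F' := fun s => μ s * y (t - s))
      (Iio_mem_nhds (lt_add_one t)) ?_ ?_ ?_ ?_ ?_ ?_).2
    · exact Eventually.of_forall fun r => (hXc.integrableOn_memConv hμ.summable r).1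
    · exact hXc.integrableOn_memConv hμ.summable t
    · exact (hy.integrableOn_memConv hμ.summable t).1
    · filter_upwards [ae_restrict_mem measurableSet_Ioi] with s hs
      have hs' : (0 : ℝ) < s := hs
      refine LipschitzOnWith.of_dist_le_mul fun a ha b hb => ?_
      have ha' : a < t + 1 := ha
      have hb' : b < t + 1 := hb
      rw [Real.dist_eq, Real.dist_eq, ← mul_sub, abs_mul,
        Real.coe_nnabs, abs_of_nonneg (mul_nonneg (abs_nonneg (μ s)) hC0), mul_assoc]
      refine mul_le_mul_of_nonneg_left ?_ (abs_nonneg _)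
      simp only [hX]
      rw [intervalIntegral.integral_interval_sub_left (hy.intervalIntegrable _ _)
        (hy.intervalIntegrable _ _)]
      have := intervalIntegral.norm_integral_le_of_norm_le_const (f := y)
        (a := max (b - s) 0) (b := max (a - s) 0) (C := C) fun r hr => hC r <| by
          refine hr.2.trans (max_le (max_le ?_ ?_) (max_le ?_ ?_)) <;> linarith
      refine this.trans (mul_le_mul_of_nonneg_left ?_ hC0)
      refine (abs_max_sub_max_le_abs _ _ _).trans_eq ?_
      ring_nf
    · exact hμ.summable.norm.mul_const C
    · have : ∀ᵐ s ∂(volume.restrict (Ioi (0 : ℝ))), s ≠ t :=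
        ae_restrict_of_ae (by simp [ae_iff, measure_singleton])
      filter_upwards [this] with s hs
      refine HasDerivAt.const_mul _ ?_
      have h0 : HasDerivAt X (y (t - s)) (t - s) := by
        rcases lt_or_gt_of_ne (sub_ne_zero.2 hs.symm) with h | h
        · rw [hy.zero _ h]
          refine (hasDerivAt_const (t - s) (0 : ℝ)).congr_of_eventuallyEq ?_
          filter_upwards [Iio_mem_nhds h] with r hr using hXc.zero r hr
        · have : HasDerivAt (fun a => ∫ r in 0..a, y r) (y (t - s)) (t - s) :=
            intervalIntegral.integral_hasDerivAt_right (hy.intervalIntegrable _ _)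
              hy.measurable.stronglyMeasurable.stronglyMeasurableAtFilter (hy.continuousAt h.ne')
          refine this.congr_of_eventuallyEq ?_
          filter_upwards [Ioi_mem_nhds h] with r hr
          simp only [hX]
          rw [max_eq_left (mem_Ioi.1 hr).le]
      simpa using h0.comp_sub_const t s
  refine ((hd1.add hd2).congr_of_eventuallyEq ?_).congr_deriv (by ring)
  filter_upwards [Ioi_mem_nhds ht] with r hr using hsplit r hr

/-! ### The equation of a single mode -/

/-- The total mass of the kernel. -/
noncomputable def mass (μ : ℝ → ℝ) : ℝ := ∫ s in Ioi 0, μ s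

/-- `x` is a causal solution with derivative `y` of
`x'' + λ(1+κ)x - λ ∫₀^∞ μ(s) x(t-s) ds = 0`, where `κ` is the mass of `μ`. -/
structure IsModeSol (μ : ℝ → ℝ) (lam : ℝ) (x y : ℝ → ℝ) : Prop where
  causal_x : IsCausal x
  causal_y : IsCausal y
  deriv_x : ∀ t, 0 < t → HasDerivAt x (y t) t
  deriv_y : ∀ t, 0 < t → HasDerivAt y (-(lam * (1 + mass μ)) * x t + lam * memConv μ x t) t

/-- The squared norm of the memory variable `x(t) - x(t-s)`. -/
noncomputable def memSq (μ x : ℝ → ℝ) (t : ℝ) : ℝ :=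
  ∫ s in Ioi 0, μ s * (x t - x (t - s)) ^ 2

/-- The energy of a solution of the equation of a mode. -/
noncomputable def modeEnergy (μ : ℝ → ℝ) (lam : ℝ) (x y : ℝ → ℝ) (t : ℝ) : ℝ :=
  lam * x t ^ 2 + y t ^ 2 + lam * memSq μ x t

lemma IsCausal.integrableOn_memSq {μ x : ℝ → ℝ} (hμ : IntegrableOn μ (Ioi 0))
    (hx : IsCausal x) (t : ℝ) :
    IntegrableOn (fun s => μ s * (x t - x (t - s)) ^ 2) (Ioi 0) := by
  have h1 := hx.integrableOn_memConv hμ t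
  have h2 := (hx.mul hx).integrableOn_memConv hμ t
  refine (((hμ.mul_const (x t ^ 2)).sub (h1.const_mul (2 * x t))).add h2).congr ?_
  refine Eventually.of_forall fun s => ?_
  simp only [Pi.add_apply, Pi.sub_apply]
  ring

/-- Expanding the square leaves only convolutions with `μ`, which are continuous by
`continuous_memConv` and differentiable by `hasDerivAt_memConv`. -/
lemma IsCausal.memSq_eq {μ x : ℝ → ℝ} (hμ : IntegrableOn μ (Ioi 0)) (hx : IsCausal x) (t : ℝ) :
    memSq μ x t = mass μ * x t ^ 2 - 2 * x t * memConv μ x t +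
      memConv μ (fun r => x r * x r) t := by
  have h1 := hx.integrableOn_memConv hμ t
  have h2 := (hx.mul hx).integrableOn_memConv hμ t
  have e := integral_add ((hμ.mul_const (x t ^ 2)).sub (h1.const_mul (2 * x t))) h2
  have e' := integral_sub (hμ.mul_const (x t ^ 2)) (h1.const_mul (2 * x t))
  rw [integral_mul_const, integral_const_mul] at e'
  unfold memSq memConv mass
  refine (integral_congr_ae (Eventually.of_forall fun s => ?_)).trans (e.trans ?_)
  · simp only [Pi.sub_apply]
    ring
  · congr 1

lemma IsMemoryKernel.memSq_nonneg {μ : ℝ → ℝ} (hμ : IsMemoryKernel μ) (x : ℝ → ℝ) (t : ℝ) :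
    0 ≤ memSq μ x t :=
  setIntegral_nonneg measurableSet_Ioi fun s hs => mul_nonneg (hμ.nonneg s hs) (sq_nonneg _)

lemma IsCausal.continuousOn_memSq {μ x : ℝ → ℝ} (hμ : IntegrableOn μ (Ioi 0))
    (hx : IsCausal x) : ContinuousOn (memSq μ x) (Ici 0) := by
  rw [show memSq μ x = _ from funext fun t => hx.memSq_eq hμ t]
  have h1 := hx.cont
  have h2 := (hx.continuous_memConv hμ).continuousOn (s := Ici 0)
  have h3 := ((hx.mul hx).continuous_memConv hμ).continuousOn (s := Ici 0)
  fun_prop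

/-- The derivative of the energy is at most `-δλ` times the memory part of the energy. -/
lemma IsModeSol.hasDerivAt_energy {μ x y : ℝ → ℝ} {lam δ : ℝ} (hμ : IsMemoryKernel μ)
    (hd : IsDecayRate μ δ) (hlam : 0 < lam) (h : IsModeSol μ lam x y) {t : ℝ} (ht : 0 < t) :
    ∃ e', HasDerivAt (modeEnergy μ lam x y) e' t ∧ e' ≤ -(δ * lam * memSq μ x t) := by
  have hx := h.causal_x
  have hy := h.causal_y
  have d1 := h.deriv_x t ht
  have d2 := h.deriv_y t ht
  have d3 := hμ.hasDerivAt_memConv hx hy h.deriv_x ht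
  have d4 := hμ.hasDerivAt_memConv (x := fun r => x r * x r) (y := fun r => 2 * (x r * y r))
    (hx.mul hx) ((hx.mul hy).const_mul 2)
    (fun r hr => ((h.deriv_x r hr).fun_mul (h.deriv_x r hr)).congr_deriv (by ring)) ht
  have hm2 : memConv μ (fun r => 2 * (x r * y r)) t = 2 * memConv μ (fun r => x r * y r) t := by
    unfold memConv
    rw [← integral_const_mul]
    exact integral_congr_ae (Eventually.of_forall fun s => by ring)
  rw [hm2] at d4
  have hE : modeEnergy μ lam x y = fun t => lam * x t ^ 2 + y t ^ 2 + lam * (mass μ * x t ^ 2 -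
      2 * x t * memConv μ x t + memConv μ (fun r => x r * x r) t) := by
    funext r
    unfold modeEnergy
    rw [hx.memSq_eq hμ.summable]
  -- The contributions of `y * y'` cancel those of the potential and of the mean memory force. What
  -- remains comes from the jump of `x` at `0` and from the transport of the memory.
  refine ⟨lam * (μ t * x 0 ^ 2 - 2 * μ t * x t * x 0 - (2 * x t * memConv μ y t -
    2 * memConv μ (fun r => x r * y r) t)), ?_, ?_⟩
  · rw [hE]
    have := (((d1.fun_pow 2).const_mul lam).fun_add (d2.fun_pow 2)).fun_add
      (((((d1.fun_pow 2).const_mul (mass μ)).fun_sub ((d1.const_mul 2).fun_mul d3)).fun_add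
        d4).const_mul lam)
    refine this.congr_deriv ?_
    simp only [Nat.cast_ofNat, Nat.add_one_sub_one, pow_one]
    ring
  · obtain ⟨C, hC0, hC⟩ := hy.exists_bound t
    have hmeas : Measurable fun s => y (t - s) :=
      hy.measurable.comp (measurable_const.sub measurable_id)
    have hgi : IntervalIntegrable (fun s => y (t - s)) volume 0 t := by
      have := (hy.intervalIntegrable t 0).comp_sub_left t
      simpa using this
    have hμt : IntegrableOn μ (Ioc 0 t) := hμ.summable.mono_set fun r hr => hr.1
    have hg2 : IntegrableOn (fun s => μ s * y (t - s) ^ 2) (Ioc 0 t) := by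
      refine hμt.mul_bdd (c := C ^ 2) (hmeas.pow_const 2).aestronglyMeasurable ?_
      filter_upwards [ae_restrict_mem measurableSet_Ioc] with s hs
      rw [norm_pow]
      exact pow_le_pow_left₀ (norm_nonneg _) (hC _ (by linarith [hs.1])) 2
    have hG : ∀ s ∈ Icc 0 t, ∫ r in 0..s, y (t - r) = x t - x (t - s) := by
      intro s hs
      rw [intervalIntegral.integral_comp_sub_left (fun r => y r) t, sub_zero]
      exact hx.sub_eq_integral hy h.deriv_x (by linarith [hs.2]) (by linarith [hs.1])
    -- For `g(s) = y(t-s)` the primitive is the memory variable `x(t) - x(t-s)`. The boundary term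
    -- `μ(t)(x(t) - x(0))²` completes the square with the jump terms and leaves `-μ(t) x(t)²`, which
    -- `tail_le` turns into dissipation of the memory beyond `s = t`.
    have key := hμ.two_mul_integral_ge hd ht hgi hg2
    have e1 : ∫ s in 0..t, μ s * (∫ r in 0..s, y (t - r)) ^ 2 =
        ∫ s in Ioc 0 t, μ s * (x t - x (t - s)) ^ 2 := by
      rw [intervalIntegral.integral_of_le ht.le]
      refine setIntegral_congr_fun measurableSet_Ioc fun s hs => ?_
      simp only [hG s ⟨hs.1.le, hs.2⟩]
    have hsplit : ∀ f : ℝ → ℝ, IntegrableOn f (Ioi 0) →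
        ∫ s in Ioi 0, f s = (∫ s in Ioc 0 t, f s) + ∫ s in Ioi t, f s := by
      intro f hf
      rw [← setIntegral_union (Ioc_disjoint_Ioi le_rfl) measurableSet_Ioi
        (hf.mono_set fun r hr => hr.1) (hf.mono_set fun r hr => ht.trans hr),
        Ioc_union_Ioi_eq_Ioi ht.le]
    have hzero : ∀ f : ℝ → ℝ, (∀ s, t < s → f s = 0) → ∫ s in Ioi t, f s = 0 := by
      intro f hf
      rw [setIntegral_congr_fun (g := fun _ => (0 : ℝ)) measurableSet_Ioi fun s hs => hf s hs]
      simp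
    have e2 : 2 * ∫ s in 0..t, μ s * ((∫ r in 0..s, y (t - r)) * y (t - s)) =
        2 * x t * memConv μ y t - 2 * memConv μ (fun r => x r * y r) t := by
      have i1 := hy.integrableOn_memConv hμ.summable t
      have i2 := (hx.mul hy).integrableOn_memConv hμ.summable t
      have c1 : memConv μ y t = ∫ s in Ioc 0 t, μ s * y (t - s) := by
        unfold memConv
        rw [hsplit _ i1, hzero _ fun s hs => by rw [hy.zero _ (by linarith), mul_zero], add_zero]
      have c2 : memConv μ (fun r => x r * y r) t =
          ∫ s in Ioc 0 t, μ s * (x (t - s) * y (t - s)) := by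
        unfold memConv
        rw [hsplit _ i2, hzero _ fun s hs => by rw [hy.zero _ (by linarith)]; ring, add_zero]
      rw [c1, c2, mul_assoc, ← mul_sub, ← integral_const_mul, ← integral_sub
        ((i1.mono_set fun r hr => hr.1).const_mul _) (i2.mono_set fun r hr => hr.1),
        intervalIntegral.integral_of_le ht.le]
      congr 1
      refine setIntegral_congr_fun measurableSet_Ioc fun s hs => ?_
      simp only [hG s ⟨hs.1.le, hs.2⟩]
      ring
    have e3 : memSq μ x t = (∫ s in Ioc 0 t, μ s * (x t - x (t - s)) ^ 2) +
        x t ^ 2 * ∫ s in Ioi t, μ s := by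
      unfold memSq
      rw [hsplit _ (hx.integrableOn_memSq hμ.summable t), ← integral_const_mul]
      congr 1
      refine setIntegral_congr_fun measurableSet_Ioi fun s hs => ?_
      rw [hx.zero (t - s) (by linarith [mem_Ioi.1 hs])]
      ring
    rw [e1, e2, hG t (right_mem_Icc.2 ht.le), sub_self] at key
    have htail := hμ.tail_le hd ht
    rw [e3]
    have : δ * lam * ((∫ s in Ioc 0 t, μ s * (x t - x (t - s)) ^ 2) +
        x t ^ 2 * ∫ s in Ioi t, μ s) =
        lam * (δ * (∫ s in Ioc 0 t, μ s * (x t - x (t - s)) ^ 2) +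
        x t ^ 2 * (δ * ∫ s in Ioi t, μ s)) := by ring
    rw [this, ← mul_neg]
    refine mul_le_mul_of_nonneg_left ?_ hlam.le
    have h5 := mul_le_mul_of_nonneg_left htail (sq_nonneg (x t))
    linarith

lemma IsModeSol.continuousOn_energy {μ x y : ℝ → ℝ} {lam : ℝ} (hμ : IsMemoryKernel μ)
    (h : IsModeSol μ lam x y) : ContinuousOn (modeEnergy μ lam x y) (Ici 0) := by
  have h1 := h.causal_x.cont
  have h2 := h.causal_y.cont
  have h3 := h.causal_x.continuousOn_memSq hμ.summable
  unfold modeEnergy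
  fun_prop

lemma IsModeSol.energy_le {μ x y : ℝ → ℝ} {lam : ℝ} (hμ : IsMemoryKernel μ)
    (hlam : 0 < lam) (h : IsModeSol μ lam x y) {t : ℝ} (ht : 0 ≤ t) :
    modeEnergy μ lam x y t ≤ modeEnergy μ lam x y 0 := by
  obtain ⟨δ, hδ, hd⟩ := hμ.decay
  have : AntitoneOn (modeEnergy μ lam x y) (Ici 0) := by
    refine antitoneOn_of_deriv_nonpos (convex_Ici 0) (h.continuousOn_energy hμ) ?_ ?_
    · rw [interior_Ici]
      intro r hr
      obtain ⟨e, he, -⟩ := h.hasDerivAt_energy hμ hd hlam hr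
      exact he.differentiableAt.differentiableWithinAt
    · rw [interior_Ici]
      intro r hr
      obtain ⟨e, he, he'⟩ := h.hasDerivAt_energy hμ hd hlam hr
      rw [he.deriv]
      refine he'.trans ?_
      have := hμ.memSq_nonneg x r
      have : 0 ≤ δ * lam * memSq μ x r := by positivity
      linarith
  exact this self_mem_Ici ht ht

/-- At time `0` the whole past is zero, so the memory variable is the constant `x 0` and adds `mass
μ` to the potential energy. -/
lemma IsModeSol.energy_zero {μ x y : ℝ → ℝ} {lam : ℝ}
    (h : IsModeSol μ lam x y) :
    modeEnergy μ lam x y 0 = lam * (1 + mass μ) * x 0 ^ 2 + y 0 ^ 2 := by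
  have : memSq μ x 0 = mass μ * x 0 ^ 2 := by
    unfold memSq mass
    rw [← integral_mul_const]
    refine setIntegral_congr_fun measurableSet_Ioi fun s hs => ?_
    rw [h.causal_x.zero (0 - s) (by linarith [mem_Ioi.1 hs]), sub_zero]
  unfold modeEnergy
  rw [this]
  ring

/-! ### Exponential decay of the energy of a mode, uniform in the eigenvalue -/

lemma IsMemoryKernel.mass_pos' {μ : ℝ → ℝ} (hμ : IsMemoryKernel μ) : 0 < mass μ := hμ.mass_pos

/-- The mean of the memory variable is controlled by its squared norm. -/
lemma IsCausal.sq_mass_sub_memConv_le {μ x : ℝ → ℝ} (hμ : IsMemoryKernel μ) (hx : IsCausal x)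
    (t : ℝ) : (mass μ * x t - memConv μ x t) ^ 2 ≤ mass μ * memSq μ x t := by
  have hi := (hx.mul hx).integrableOn_memConv hμ.summable t
  have hm : AEStronglyMeasurable (fun s => √(μ s)) (volume.restrict (Ioi 0)) :=
    Real.continuous_sqrt.comp_aestronglyMeasurable hμ.summable.1
  have hxm : AEStronglyMeasurable (fun s => x (t - s)) (volume.restrict (Ioi (0 : ℝ))) :=
    (hx.measurable.comp (measurable_const.sub measurable_id)).aestronglyMeasurable
  have e1 : ∀ s ∈ Ioi (0 : ℝ), √(μ s) ^ 2 = μ s := fun s hs => Real.sq_sqrt (hμ.nonneg s hs)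
  have e2 : ∀ s ∈ Ioi (0 : ℝ), (√(μ s) * x (t - s)) ^ 2 = μ s * (x (t - s) * x (t - s)) := by
    intro s hs
    rw [mul_pow, e1 s hs]
    ring
  have e3 : ∀ s ∈ Ioi (0 : ℝ), √(μ s) * (√(μ s) * x (t - s)) = μ s * x (t - s) := by
    intro s hs
    rw [← mul_assoc, ← sq, e1 s hs]
  have l1 : MemLp (fun s => √(μ s)) 2 (volume.restrict (Ioi 0)) := by
    rw [memLp_two_iff_integrable_sq hm]
    exact (integrableOn_congr_fun e1 measurableSet_Ioi).2 hμ.summable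
  have l2 : MemLp (fun s => √(μ s) * x (t - s)) 2 (volume.restrict (Ioi 0)) := by
    rw [memLp_two_iff_integrable_sq (hm.fun_mul hxm)]
    exact (integrableOn_congr_fun e2 measurableSet_Ioi).2 hi
  have h := sq_integral_mul_le l1 l2
  rw [setIntegral_congr_fun measurableSet_Ioi e1, setIntegral_congr_fun measurableSet_Ioi e2,
    setIntegral_congr_fun measurableSet_Ioi e3] at h
  rw [hx.memSq_eq hμ.summable]
  change memConv μ x t ^ 2 ≤ mass μ * memConv μ (fun r => x r * x r) t at h
  nlinarith [h]

lemma IsCausal.integral_sub_eq {x : ℝ → ℝ} (hx : IsCausal x) (c t : ℝ) :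
    ∫ s in 0..c, (x t - x (t - s)) =
      c * x t - (∫ r in 0..t, x r) + ∫ r in 0..t - c, x r := by
  have hi : IntervalIntegrable (fun s => x (t - s)) volume 0 c := by
    have := (hx.intervalIntegrable t (t - c)).comp_sub_left t
    simpa using this
  rw [intervalIntegral.integral_sub (by simp) hi,
    intervalIntegral.integral_comp_sub_left (fun r => x r) t, sub_zero,
    ← intervalIntegral.integral_interval_sub_left (hx.intervalIntegrable 0 t)
      (hx.intervalIntegrable 0 (t - c))]
  simp only [intervalIntegral.integral_const, sub_zero, smul_eq_mul]
  ring

/-- On `(0,c] ⊆ (0,b]` the kernel is at least `μ b`, so an unweighted integral is controlled by the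
weighted norm; the factor `b` is Cauchy–Schwarz on the interval. -/
lemma IsCausal.sq_integral_sub_le {μ x : ℝ → ℝ} (hμ : IsMemoryKernel μ) (hx : IsCausal x)
    {b c : ℝ} (hb : 0 < b) (hμb : 0 < μ b) (hc : 0 ≤ c) (hcb : c ≤ b) (t : ℝ) :
    (∫ s in 0..c, (x t - x (t - s))) ^ 2 ≤ b / μ b * memSq μ x t := by
  obtain ⟨C, hC0, hC⟩ := hx.exists_bound t
  have hxm : Measurable fun s => x t - x (t - s) :=
    measurable_const.sub (hx.measurable.comp (measurable_const.sub measurable_id))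
  have l2 : MemLp (fun s => x t - x (t - s)) 2 (volume.restrict (Ioc 0 c)) := by
    refine MemLp.of_bound hxm.aestronglyMeasurable (C + C) ?_
    filter_upwards [ae_restrict_mem measurableSet_Ioc] with s hs
    exact (norm_sub_le _ _).trans (add_le_add (hC t le_rfl) (hC _ (by linarith [hs.1])))
  have h := sq_integral_mul_le (memLp_const (μ := volume.restrict (Ioc 0 c)) (p := 2) (1 : ℝ)) l2
  simp only [one_mul, one_pow, integral_const, MeasurableSet.univ, measureReal_restrict_apply,
    univ_inter, Real.volume_real_Ioc, sub_zero, smul_eq_mul, mul_one, max_eq_left hc] at h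
  rw [intervalIntegral.integral_of_le hc]
  refine h.trans ?_
  have hnn : 0 ≤ ∫ s in Ioc 0 c, (x t - x (t - s)) ^ 2 := integral_nonneg fun _ => sq_nonneg _
  have h2 : μ b * ∫ s in Ioc 0 c, (x t - x (t - s)) ^ 2 ≤ memSq μ x t := by
    have hI := hx.integrableOn_memSq hμ.summable t
    rw [← integral_const_mul]
    calc _ ≤ ∫ s in Ioc 0 c, μ s * (x t - x (t - s)) ^ 2 := by
          refine setIntegral_mono_on ?_ (hI.mono_set fun r hr => hr.1) measurableSet_Ioc ?_
          · exact (l2.integrable_sq).const_mul _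
          · intro s hs
            exact mul_le_mul_of_nonneg_right (hμ.antitoneOn hs.1 hb (hs.2.trans hcb))
              (sq_nonneg _)
      _ ≤ _ := by
          refine setIntegral_mono_set hI ?_ (Ioc_subset_Ioi_self : Ioc 0 c ⊆ Ioi 0).eventuallyLE
          filter_upwards [ae_restrict_mem measurableSet_Ioi] with r hr
          exact mul_nonneg (hμ.nonneg r hr) (sq_nonneg _)
  calc _ ≤ b * ∫ s in Ioc 0 c, (x t - x (t - s)) ^ 2 := mul_le_mul_of_nonneg_right hcb hnn
    _ ≤ b * (memSq μ x t / μ b) :=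
        mul_le_mul_of_nonneg_left ((le_div_iff₀ hμb).2 (by linarith)) hb.le
    _ = _ := by ring

/-! ### The multiplier and the Lyapunov functional -/

/-- The multiplier `∫₀^b (b-s) (x(t) - x(t-s)) ds`. -/
noncomputable def memMultiplier (b : ℝ) (x : ℝ → ℝ) (t : ℝ) : ℝ :=
  ∫ c in 0..b, ∫ s in 0..c, (x t - x (t - s))

/-- Written with `x` and its iterated primitives, the multiplier can be differentiated without
meeting `μ` or the jump of `x` at `0`. -/
lemma IsCausal.memMultiplier_eq {x : ℝ → ℝ} (hx : IsCausal x) (b t : ℝ) :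
    memMultiplier b x t = b ^ 2 / 2 * x t - b * (∫ r in 0..t, x r) +
      ((∫ q in 0..t, ∫ r in 0..q, x r) - ∫ q in 0..t - b, ∫ r in 0..q, x r) := by
  have hc : Continuous fun q => ∫ r in 0..q, x r :=
    intervalIntegral.continuous_primitive (fun a b => hx.intervalIntegrable a b) 0
  unfold memMultiplier
  simp only [hx.integral_sub_eq]
  have i1 : Continuous fun c : ℝ => c * x t := continuous_mul_const (x t)
  have i3 : Continuous fun c : ℝ => c * x t - ∫ r in 0..t, x r := i1.sub continuous_const
  have i2 : Continuous fun c : ℝ => ∫ r in 0..t - c, x r := hc.comp (continuous_sub_left t)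
  rw [intervalIntegral.integral_add (i3.intervalIntegrable _ _)
    (i2.intervalIntegrable _ _), intervalIntegral.integral_sub (i1.intervalIntegrable _ _)
    (continuous_const.intervalIntegrable _ _),
    intervalIntegral.integral_comp_sub_left (fun q => ∫ r in 0..q, x r) t, sub_zero,
    intervalIntegral.integral_interval_sub_left (hc.intervalIntegrable _ _)
      (hc.intervalIntegrable _ _)]
  simp [intervalIntegral.integral_mul_const]

/-- Formally the memory variable `η` satisfies `∂ₜη = -∂ₛη + y` with `η(0) = 0`, and the weight `b -
s` vanishes at `b`, so integration by parts leaves only `-∫₀^b η`. The term in `y`, with the total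
weight `b²/2`, is what produces `y²` in the Lyapunov functional. -/
lemma IsCausal.hasDerivAt_memMultiplier {x y : ℝ → ℝ} (hx : IsCausal x) (b : ℝ)
    {t : ℝ} (ht : 0 < t) (hd : HasDerivAt x (y t) t) :
    HasDerivAt (memMultiplier b x)
      (b ^ 2 / 2 * y t - ∫ s in 0..b, (x t - x (t - s))) t := by
  have hc : Continuous fun q => ∫ r in 0..q, x r :=
    intervalIntegral.continuous_primitive (fun a b => hx.intervalIntegrable a b) 0
  rw [show memMultiplier b x = _ from funext fun r => hx.memMultiplier_eq b r]
  have d1 : HasDerivAt (fun q => ∫ r in 0..q, x r) (x t) t :=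
    intervalIntegral.integral_hasDerivAt_right (hx.intervalIntegrable _ _)
      hx.measurable.stronglyMeasurable.stronglyMeasurableAtFilter (hx.continuousAt ht.ne')
  have d2 : ∀ a, HasDerivAt (fun p => ∫ q in 0..p, ∫ r in 0..q, x r) (∫ r in 0..a, x r) a :=
    fun a => intervalIntegral.integral_hasDerivAt_right (hc.intervalIntegrable _ _)
      hc.stronglyMeasurable.stronglyMeasurableAtFilter hc.continuousAt
  have := ((hd.const_mul (b ^ 2 / 2)).fun_sub (d1.const_mul b)).fun_add
    ((d2 t).fun_sub ((d2 (t - b)).comp_sub_const t b))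
  refine this.congr_deriv ?_
  rw [hx.integral_sub_eq]
  ring

lemma IsCausal.continuousOn_memMultiplier {x : ℝ → ℝ} (hx : IsCausal x) (b : ℝ) :
    ContinuousOn (memMultiplier b x) (Ici 0) := by
  have hc : Continuous fun q => ∫ r in 0..q, x r :=
    intervalIntegral.continuous_primitive (fun a b => hx.intervalIntegrable a b) 0
  have hc2 : Continuous fun p => ∫ q in 0..p, ∫ r in 0..q, x r :=
    intervalIntegral.continuous_primitive (fun a b => hc.intervalIntegrable a b) 0
  rw [show memMultiplier b x = _ from funext fun r => hx.memMultiplier_eq b r]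
  have h1 := hx.cont
  have h2 : Continuous fun p => ∫ q in 0..p - b, ∫ r in 0..q, x r :=
    hc2.comp (continuous_sub_right b)
  exact ((h1.const_mul _).sub (hc.continuousOn.const_mul _)).add
    (hc2.continuousOn.sub h2.continuousOn)

lemma IsCausal.sq_memMultiplier_le {μ x : ℝ → ℝ} (hμ : IsMemoryKernel μ) (hx : IsCausal x)
    {b : ℝ} (hb : 0 < b) (hμb : 0 < μ b) (t : ℝ) :
    memMultiplier b x t ^ 2 ≤ b ^ 3 / μ b * memSq μ x t := by
  have hnn : 0 ≤ b / μ b * memSq μ x t :=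
    mul_nonneg (by positivity) (hμ.memSq_nonneg x t)
  have h := intervalIntegral.norm_integral_le_of_norm_le_const
    (f := fun c => ∫ s in 0..c, (x t - x (t - s))) (a := 0) (b := b)
    (C := √(b / μ b * memSq μ x t)) fun c hc => by
      rw [uIoc_of_le hb.le] at hc
      exact Real.abs_le_sqrt (hx.sq_integral_sub_le hμ hb hμb hc.1.le hc.2 t)
  rw [sub_zero, abs_of_pos hb] at h
  calc memMultiplier b x t ^ 2 = ‖memMultiplier b x t‖ ^ 2 := by
        rw [Real.norm_eq_abs, sq_abs]
    _ ≤ (√(b / μ b * memSq μ x t) * b) ^ 2 := pow_le_pow_left₀ (norm_nonneg _) h 2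
    _ = _ := by
        rw [mul_pow, Real.sq_sqrt hnn]
        ring

/-- The left side is the derivative of `N E - y R + (β/2) x y`, where `R` is the multiplier with `R'
= β y - S`, `S = ∫₀^b η`, `Q = ∫ μ η`, `y' = -lam (x + Q)`, and `J` is the squared norm of the
memory. The second term yields `-β y²`; the third gives back half of it and supplies `-(β/2) lam
x²`. Young's inequality spends at most half of these gains on the cross terms, whose remaining parts
are multiples of `lam J`, absorbed by `N δ lam J`. Only `y S` carries no factor `lam`, which is
where `lam1` enters. -/
lemma lyapunov_deriv_le {x y Q R S J lam lam1 β A B κ δ N e : ℝ} (hβ : 0 < β)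
    (h1 : 0 < lam1) (hlam : lam1 ≤ lam) (hR : R ^ 2 ≤ A * J) (hS : S ^ 2 ≤ B * J)
    (hQ : Q ^ 2 ≤ κ * J) (hB : 0 ≤ B) (hJ : 0 ≤ J) (hN : 0 ≤ N) (he : e ≤ -(δ * lam * J))
    (hNK : A * (2 / β + 1 / 2) + κ * (1 / 2 + β / 2) + B / β / lam1 + 1 ≤ N * δ) :
    N * e - (-lam * (x + Q) * R + y * (β * y - S)) +
      β / 2 * (y * y + x * (-lam * (x + Q))) ≤
      -(min 1 (β / 4) * (lam * x ^ 2 + y ^ 2 + lam * J)) := by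
  have hl : 0 < lam := h1.trans_le hlam
  have t1 : x * R ≤ β / 8 * x ^ 2 + R ^ 2 * (2 / β) := by
    have : β / 8 * x ^ 2 + R ^ 2 * (2 / β) - x * R = β / 8 * (x - 4 * (R / β)) ^ 2 := by
      field_simp
      ring
    have h2 : 0 ≤ β / 8 * (x - 4 * (R / β)) ^ 2 := by positivity
    linarith
  have t2 : Q * R ≤ 1 / 2 * Q ^ 2 + R ^ 2 * (1 / 2) := by nlinarith [sq_nonneg (Q - R)]
  have t3 : y * S ≤ β / 4 * y ^ 2 + S ^ 2 / β := by
    have : β / 4 * y ^ 2 + S ^ 2 / β - y * S = β / 4 * (y - 2 * (S / β)) ^ 2 := by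
      field_simp
      ring
    have h2 : 0 ≤ β / 4 * (y - 2 * (S / β)) ^ 2 := by positivity
    linarith
  have t4 : -(x * Q) ≤ x ^ 2 / 4 + Q ^ 2 := by nlinarith [sq_nonneg (x + 2 * Q)]
  have u2 : S ^ 2 / β ≤ lam * J * (B / β / lam1) := by
    have : S ^ 2 / β ≤ B * J / β := div_le_div_of_nonneg_right hS hβ.le
    refine this.trans ?_
    have h2 : (1 : ℝ) ≤ lam / lam1 := (one_le_div h1).2 hlam
    have h3 : 0 ≤ B * J / β := by positivity
    calc B * J / β = B * J / β * 1 := (mul_one _).symm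
      _ ≤ B * J / β * (lam / lam1) := mul_le_mul_of_nonneg_left h2 h3
      _ = _ := by ring
  have a1 : R ^ 2 * (2 / β + 1 / 2) ≤ A * J * (2 / β + 1 / 2) :=
    mul_le_mul_of_nonneg_right hR (by positivity)
  have a2 : Q ^ 2 * (1 / 2 + β / 2) ≤ κ * J * (1 / 2 + β / 2) :=
    mul_le_mul_of_nonneg_right hQ (by positivity)
  have a3 := mul_le_mul_of_nonneg_left t4 (by positivity : 0 ≤ β / 2)
  have m1 : min 1 (β / 4) ≤ 1 := min_le_left _ _
  have m2 : min 1 (β / 4) ≤ β / 4 := min_le_right _ _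
  generalize S ^ 2 / β = s2 at *
  generalize B / β / lam1 = b2 at *
  generalize 2 / β = b3 at *
  generalize min 1 (β / 4) = m at *
  have u1 : lam * (x * R + Q * R + β / 2 * -(x * Q)) ≤
      lam * (β / 4 * x ^ 2 + J * (A * (b3 + 1 / 2) + κ * (1 / 2 + β / 2))) :=
    mul_le_mul_of_nonneg_left (by linarith) hl.le
  have u3 : N * e ≤ N * -(δ * lam * J) := mul_le_mul_of_nonneg_left he hN
  have hlJ : 0 ≤ lam * J := by positivity
  have u4 := mul_le_mul_of_nonneg_left hNK hlJ
  have v1 := mul_le_mul_of_nonneg_right m1 hlJ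
  have v2 := mul_le_mul_of_nonneg_right m2 (sq_nonneg y)
  have v3 := mul_le_mul_of_nonneg_right m2 (by positivity : 0 ≤ lam * x ^ 2)
  linarith

/-- The correction terms are bounded by the energy with a constant independent of `lam ≥ lam1`, so
for large `N` the Lyapunov functional is equivalent to the energy. -/
lemma lyapunov_equiv {x y R J lam lam1 β A : ℝ} (hβ : 0 < β)
    (h1 : 0 < lam1) (hlam : lam1 ≤ lam) (hR : R ^ 2 ≤ A * J) (hA : 0 ≤ A) (hJ : 0 ≤ J) :
    |-(y * R) + β / 2 * (x * y)| ≤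
      (1 / 2 + A / 2 / lam1 + β / 4 * (1 / lam1 + 1)) * (lam * x ^ 2 + y ^ 2 + lam * J) := by
  have hl : 0 < lam := h1.trans_le hlam
  have h2 : (1 : ℝ) ≤ lam / lam1 := (one_le_div h1).2 hlam
  have t1 : |y * R| ≤ 1 / 2 * y ^ 2 + A / 2 / lam1 * (lam * J) := by
    have : A / 2 * J ≤ A / 2 / lam1 * (lam * J) := by
      calc A / 2 * J = A / 2 * J * 1 := (mul_one _).symm
        _ ≤ A / 2 * J * (lam / lam1) := mul_le_mul_of_nonneg_left h2 (by positivity)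
        _ = _ := by ring
    have s1 := sq_nonneg (y - R)
    have s2 := sq_nonneg (y + R)
    rw [sub_sq] at s1
    rw [add_sq] at s2
    rw [abs_le]
    constructor <;> linarith
  have t2 : |β / 2 * (x * y)| ≤ β / 4 * (1 / lam1 * (lam * x ^ 2)) + β / 4 * y ^ 2 := by
    have : x ^ 2 ≤ 1 / lam1 * (lam * x ^ 2) := by
      calc x ^ 2 = x ^ 2 * 1 := (mul_one _).symm
        _ ≤ x ^ 2 * (lam / lam1) := mul_le_mul_of_nonneg_left h2 (by positivity)
        _ = _ := by ring
    rw [abs_mul, abs_of_pos (by positivity : 0 < β / 2)]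
    have h3 : |x * y| ≤ 1 / 2 * x ^ 2 + 1 / 2 * y ^ 2 := by
      have s1 := sq_nonneg (x - y)
      have s2 := sq_nonneg (x + y)
      rw [sub_sq] at s1
      rw [add_sq] at s2
      rw [abs_le]
      constructor <;> linarith
    have h4 := mul_le_mul_of_nonneg_left h3 hβ.le
    have h5 := mul_le_mul_of_nonneg_left this hβ.le
    linarith
  have p1 : 0 ≤ lam * x ^ 2 := by positivity
  have p2 : 0 ≤ lam * J := by positivity
  have p3 : 0 ≤ A / 2 / lam1 := by positivity
  have p4 : 0 ≤ 1 / lam1 := by positivity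
  refine (abs_add_le _ _).trans ?_
  rw [abs_neg]
  have q1 := mul_nonneg p3 p1
  have q2 := mul_nonneg p3 (sq_nonneg y)
  have q3 := mul_nonneg (mul_nonneg hβ.le p4) (sq_nonneg y)
  have q4 := mul_nonneg (mul_nonneg hβ.le p4) p2
  have q5 := mul_nonneg hβ.le p1
  have q6 := mul_nonneg hβ.le p2
  generalize A / 2 / lam1 = a at *
  generalize 1 / lam1 = l1 at *
  linarith

/-- Exponential decay of the energy of a mode, uniform in the eigenvalue. -/
theorem IsMemoryKernel.exists_decay {μ : ℝ → ℝ} (hμ : IsMemoryKernel μ) {lam1 : ℝ}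
    (h1 : 0 < lam1) : ∃ C γ : ℝ, 0 < C ∧ 0 < γ ∧ ∀ lam, lam1 ≤ lam → ∀ x y : ℝ → ℝ,
      IsModeSol μ lam x y → ∀ t, 0 ≤ t →
        modeEnergy μ lam x y t ≤ C * Real.exp (-(γ * t)) * modeEnergy μ lam x y 0 := by
  obtain ⟨b, hb, hμb⟩ := hμ.exists_pos
  obtain ⟨δ, hδ, hd⟩ := hμ.decay
  have hκ := hμ.mass_pos'
  set β := b ^ 2 / 2 with hβd
  have hβ : 0 < β := by positivity
  set A := b ^ 3 / μ b with hA
  set B := b / μ b with hB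
  have hA0 : 0 ≤ A := by positivity
  have hB0 : 0 ≤ B := by positivity
  set K := A * (2 / β + 1 / 2) + mass μ * (1 / 2 + β / 2) + B / β / lam1 with hK
  have hK0 : 0 ≤ K := by positivity
  set K2 := 1 / 2 + A / 2 / lam1 + β / 4 * (1 / lam1 + 1) with hK2
  have hK20 : 0 ≤ K2 := by positivity
  -- `K2 + 1` keeps the functional above the energy; `(K + 1) / δ` lets the dissipation absorb the
  -- errors `K` with `1` to spare.
  set N := K2 + 1 + (K + 1) / δ with hN
  have hN0 : 0 < N := by positivity
  have hNδ : K + 1 ≤ N * δ := by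
    have : N * δ = (K2 + 1) * δ + (K + 1) := by
      rw [hN]
      field_simp
    rw [this]
    have : 0 ≤ (K2 + 1) * δ := by positivity
    linarith
  have hNK2 : K2 + 1 ≤ N := by
    have : 0 ≤ (K + 1) / δ := by positivity
    linarith
  set α := min 1 (β / 4) with hα
  have hα0 : 0 < α := lt_min one_pos (by positivity)
  -- The functional is at most `2 N E`, hence `-α E` is at most `-γ` times the functional.
  set γ := α / (2 * N) with hγ
  have hγ0 : 0 < γ := by positivity
  refine ⟨2 * N, γ, by positivity, hγ0, fun lam hlam x y h t ht => ?_⟩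
  have hl : 0 < lam := h1.trans_le hlam
  have hx := h.causal_x
  have hy := h.causal_y
  set E := modeEnergy μ lam x y with hE
  set Ly : ℝ → ℝ := fun t => N * E t + (-(y t * memMultiplier b x t) + β / 2 * (x t * y t))
    with hLy
  have hE0 : ∀ r, 0 ≤ E r := fun r => by
    have := hμ.memSq_nonneg x r
    simp only [hE, modeEnergy]
    positivity
  have heq : ∀ r, |-(y r * memMultiplier b x r) + β / 2 * (x r * y r)| ≤ K2 * E r := fun r =>
    lyapunov_equiv hβ h1 hlam (hx.sq_memMultiplier_le hμ hb hμb r) hA0 (hμ.memSq_nonneg x r)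
  have lower : ∀ r, E r ≤ Ly r := fun r => by
    have := (abs_le.1 (heq r)).1
    have h6 := mul_le_mul_of_nonneg_right hNK2 (hE0 r)
    have h7 := hE0 r
    simp only [hLy]
    linarith
  have upper : ∀ r, Ly r ≤ 2 * N * E r := fun r => by
    have := (abs_le.1 (heq r)).2
    have h6 := mul_le_mul_of_nonneg_right hNK2 (hE0 r)
    have h7 := hE0 r
    simp only [hLy]
    linarith
  have hder : ∀ r, 0 < r → ∃ l, HasDerivAt Ly l r ∧ l ≤ -(γ * Ly r) := by
    intro r hr
    obtain ⟨e, he, he'⟩ := h.hasDerivAt_energy hμ hd hl hr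
    have d1 := h.deriv_x r hr
    have d2 := h.deriv_y r hr
    have d3 := hx.hasDerivAt_memMultiplier b hr d1
    have hq : -(lam * (1 + mass μ)) * x r + lam * memConv μ x r =
      -lam * (x r + (mass μ * x r - memConv μ x r)) := by ring
    rw [hq] at d2
    rw [← hβd] at d3
    have key := lyapunov_deriv_le (x := x r) (y := y r) (N := N) hβ h1 hlam
      (hx.sq_memMultiplier_le hμ hb hμb r) (hx.sq_integral_sub_le hμ hb hμb hb.le le_rfl r)
      (hx.sq_mass_sub_memConv_le hμ r) hB0 (hμ.memSq_nonneg x r) hN0.le he' hNδ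
    refine ⟨_, (he.const_mul N).fun_add ((d2.fun_mul d3).fun_neg.fun_add
      ((d1.fun_mul d2).const_mul (β / 2))), ?_⟩
    have : γ * Ly r ≤ α * E r := by
      have := mul_le_mul_of_nonneg_left (upper r) hγ0.le
      refine this.trans_eq ?_
      rw [hγ]
      field_simp
    have h3 : α * E r = α * (lam * x r ^ 2 + y r ^ 2 + lam * memSq μ x r) := rfl
    rw [← hα, ← h3] at key
    linarith
  have hcont : ContinuousOn Ly (Ici 0) := by
    have c1 := h.continuousOn_energy hμ
    have c2 := hx.continuousOn_memMultiplier b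
    have c3 := hx.cont
    have c4 := hy.cont
    exact (c1.const_mul N).add ((c4.mul c2).neg.add ((c3.mul c4).const_mul (β / 2)))
  have hanti : AntitoneOn (fun r => Real.exp (γ * r) * Ly r) (Ici 0) := by
    have hD : ∀ r, 0 < r → ∃ l, HasDerivAt (fun r => Real.exp (γ * r) * Ly r) l r ∧ l ≤ 0 := by
      intro r hr
      obtain ⟨l, hl1, hl2⟩ := hder r hr
      refine ⟨_, ((hasDerivAt_id r).const_mul γ).exp.fun_mul hl1, ?_⟩
      have := (Real.exp_pos (γ * r)).le
      simp only [id, mul_one]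
      have := mul_le_mul_of_nonneg_left hl2 this
      linarith
    refine antitoneOn_of_deriv_nonpos (convex_Ici 0) ?_ ?_ ?_
    · exact (Real.continuous_exp.comp (continuous_const_mul γ)).continuousOn.mul hcont
    · rw [interior_Ici]
      intro r hr
      obtain ⟨l, hl1, -⟩ := hD r hr
      exact hl1.differentiableAt.differentiableWithinAt
    · rw [interior_Ici]
      intro r hr
      obtain ⟨l, hl1, hl2⟩ := hD r hr
      rwa [hl1.deriv]
  have h5 := hanti self_mem_Ici ht ht
  simp only [mul_zero, Real.exp_zero, one_mul] at h5
  calc E t ≤ Ly t := lower t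
    _ = Real.exp (-(γ * t)) * (Real.exp (γ * t) * Ly t) := by
        rw [← mul_assoc, ← Real.exp_add]
        simp
    _ ≤ Real.exp (-(γ * t)) * (2 * N * E 0) :=
        mul_le_mul_of_nonneg_left (h5.trans (upper 0)) (Real.exp_pos _).le
    _ = _ := by ring

/-! ### Existence of the fundamental solution of a mode -/

/-- Each integration gains a factor `1/L` in the norm with weight `exp(-L t)`; the two integrations
that invert `d²/dt²` gain `1/L²`, which makes the fixed point map a contraction. -/
lemma abs_integral_exp_mul_le {L : ℝ} (hL : 0 < L) {g : ℝ → ℝ} {B : ℝ} (hB : 0 ≤ B) {r : ℝ}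
    (hr : 0 ≤ r) (hg : ∀ x ∈ Ioc 0 r, |g x| ≤ B * Real.exp (L * x)) :
    |∫ x in 0..r, g x| ≤ B / L * Real.exp (L * r) := by
  have h := intervalIntegral.norm_integral_le_of_norm_le (μ := volume) hr
    (Eventually.of_forall hg : ∀ᵐ x, x ∈ Ioc 0 r → ‖g x‖ ≤ B * Real.exp (L * x))
    (Continuous.intervalIntegrable (by fun_prop) _ _)
  have hint : ∫ x in 0..r, B * Real.exp (L * x) =
      B / L * Real.exp (L * r) - B / L * Real.exp (L * 0) := by
    refine intervalIntegral.integral_eq_sub_of_hasDerivAt (f := fun x => B / L * Real.exp (L * x))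
      (fun x _ => ?_) (Continuous.intervalIntegrable (by fun_prop) _ _)
    refine ((((hasDerivAt_id x).const_mul L).exp).const_mul (B / L)).congr_deriv ?_
    simp only [id, mul_one]
    field_simp
  rw [hint] at h
  refine h.trans ?_
  have : 0 ≤ B / L * Real.exp (L * 0) := by positivity
  linarith

open BoundedContinuousFunction in
/-- The memory term in weighted form. -/
lemma exists_weighted_fixedPoint {ν : ℝ → ℝ} (hν : IntegrableOn ν (Ioi 0)) (c₀ lam L : ℝ)
    (hL : 0 < L) (hLM : (|c₀| + |lam| * ∫ s in Ioi 0, |ν s|) / L ^ 2 ≤ 1 / 2) :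
    ∃ f : ℝ →ᵇ ℝ, ∀ t, f t = Real.exp (-(L * max t 0)) * (max t 0 + ∫ r in 0..max t 0,
      ∫ x in 0..r, Real.exp (L * x) * (c₀ * f x + lam * ∫ s in Ioi 0, ν s * f (x - s))) := by
  set M := |c₀| + |lam| * ∫ s in Ioi 0, |ν s| with hM
  have hM0 : 0 ≤ M := by
    have : 0 ≤ ∫ s in Ioi 0, |ν s| := integral_nonneg fun _ => abs_nonneg _
    positivity
  have hint : ∀ (f : ℝ →ᵇ ℝ) (x : ℝ), IntegrableOn (fun s => ν s * f (x - s)) (Ioi 0) :=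
    fun f x => hν.mul_bdd (c := ‖f‖)
      (f.continuous.comp (by fun_prop)).aestronglyMeasurable
      (Eventually.of_forall fun s => f.norm_coe_le_norm _)
  set G : (ℝ →ᵇ ℝ) → ℝ → ℝ := fun f x => c₀ * f x + lam * ∫ s in Ioi 0, ν s * f (x - s) with hG
  have hGc : ∀ f, Continuous (G f) := by
    intro f
    have : Continuous fun x => ∫ s in Ioi 0, ν s * f (x - s) := by
      refine continuous_of_dominated (bound := fun s => |ν s| * ‖f‖) (fun x => (hint f x).1)
        (fun x => Eventually.of_forall fun s => ?_) (hν.norm.mul_const _)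
        (Eventually.of_forall fun s => ?_)
      · rw [norm_mul]
        exact mul_le_mul_of_nonneg_left (f.norm_coe_le_norm _) (abs_nonneg _)
      · exact continuous_const.mul (f.continuous.comp (by fun_prop))
    exact (f.continuous.const_mul c₀).add (this.const_mul lam)
  have hGb : ∀ f x, |G f x| ≤ M * ‖f‖ := by
    intro f x
    have h1 : |∫ s in Ioi 0, ν s * f (x - s)| ≤ (∫ s in Ioi 0, |ν s|) * ‖f‖ := by
      rw [← integral_mul_const]
      refine norm_integral_le_of_norm_le (f := fun s => ν s * f (x - s)) (hν.norm.mul_const _)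
        (Eventually.of_forall fun s => ?_)
      rw [norm_mul]
      exact mul_le_mul_of_nonneg_left (f.norm_coe_le_norm _) (abs_nonneg _)
    refine (abs_add_le _ _).trans ?_
    rw [abs_mul, abs_mul, hM, add_mul, mul_assoc]
    exact add_le_add (mul_le_mul_of_nonneg_left (f.norm_coe_le_norm _) (abs_nonneg _))
      (mul_le_mul_of_nonneg_left h1 (abs_nonneg _))
  have hGs : ∀ f g x, G f x - G g x = G (f - g) x := by
    intro f g x
    have : ∫ s in Ioi 0, ν s * (f - g) (x - s) =
        (∫ s in Ioi 0, ν s * f (x - s)) - ∫ s in Ioi 0, ν s * g (x - s) := by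
      rw [← integral_sub (hint f x) (hint g x)]
      refine integral_congr_ae (Eventually.of_forall fun s => ?_)
      simp only [BoundedContinuousFunction.coe_sub, Pi.sub_apply]
      ring
    simp only [hG]
    rw [this, BoundedContinuousFunction.coe_sub, Pi.sub_apply]
    ring
  have hI1 : ∀ f, Continuous fun r => ∫ x in 0..r, Real.exp (L * x) * G f x := fun f =>
    intervalIntegral.continuous_primitive (fun a b => Continuous.intervalIntegrable
      ((by fun_prop : Continuous fun x => Real.exp (L * x)).mul (hGc f)) a b) 0
  -- The unknown `f` stands for `exp(-L t) w(t)`, and `D` is the mode equation integrated twice; the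
  -- data `w(0) = 0`, `w'(0) = 1` give the separate term `max t 0`. The truncation at `0` forces a
  -- zero past.
  set D : (ℝ →ᵇ ℝ) → ℝ → ℝ := fun f t => Real.exp (-(L * max t 0)) *
    ∫ r in 0..max t 0, ∫ x in 0..r, Real.exp (L * x) * G f x with hD
  have hDc : ∀ f, Continuous (D f) := fun f =>
    (by fun_prop : Continuous fun t : ℝ => Real.exp (-(L * max t 0))).mul
      ((intervalIntegral.continuous_primitive
        (fun a b => (hI1 f).intervalIntegrable a b) 0).comp
        (by fun_prop : Continuous fun t : ℝ => max t 0))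
  have hDb : ∀ f t, |D f t| ≤ M * ‖f‖ / L ^ 2 := by
    intro f t
    have hB : 0 ≤ M * ‖f‖ := by positivity
    have h2 : |∫ r in 0..max t 0, ∫ x in 0..r, Real.exp (L * x) * G f x| ≤
        M * ‖f‖ / L / L * Real.exp (L * max t 0) := by
      refine abs_integral_exp_mul_le hL (by positivity) (le_max_right _ _) fun r hr => ?_
      refine abs_integral_exp_mul_le hL hB hr.1.le fun x _ => ?_
      rw [abs_mul, abs_of_pos (Real.exp_pos _), mul_comm]
      exact mul_le_mul_of_nonneg_right (hGb f x) (Real.exp_pos _).le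
    simp only [hD]
    rw [abs_mul, abs_of_pos (Real.exp_pos _)]
    refine (mul_le_mul_of_nonneg_left h2 (Real.exp_pos _).le).trans_eq ?_
    rw [mul_comm, mul_assoc, ← Real.exp_add]
    simp only [add_neg_cancel, Real.exp_zero, mul_one]
    rw [div_div, ← sq]
  have hDs : ∀ f g t, D f t - D g t = D (f - g) t := by
    intro f g t
    simp only [hD, ← mul_sub]
    congr 1
    rw [← intervalIntegral.integral_sub ((hI1 f).intervalIntegrable _ _)
      ((hI1 g).intervalIntegrable _ _)]
    refine intervalIntegral.integral_congr fun r _ => ?_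
    rw [← intervalIntegral.integral_sub]
    · refine intervalIntegral.integral_congr fun x _ => ?_
      simp only [← mul_sub, hGs]
    · exact ((by fun_prop : Continuous fun x => Real.exp (L * x)).mul
        (hGc f)).intervalIntegrable _ _
    · exact ((by fun_prop : Continuous fun x => Real.exp (L * x)).mul
        (hGc g)).intervalIntegrable _ _
  have hφ : ∀ t : ℝ, |Real.exp (-(L * max t 0)) * max t 0| ≤ 1 / L := by
    intro t
    have h0 : (0 : ℝ) ≤ max t 0 := le_max_right _ _
    rw [abs_of_nonneg (by positivity), Real.exp_neg, inv_mul_le_iff₀ (Real.exp_pos _),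
      mul_one_div, le_div_iff₀ hL]
    have := Real.add_one_le_exp (L * max t 0)
    linarith
  let Φ : (ℝ →ᵇ ℝ) → (ℝ →ᵇ ℝ) := fun f => BoundedContinuousFunction.ofNormedAddCommGroup
    (fun t => Real.exp (-(L * max t 0)) * max t 0 + D f t)
    ((by fun_prop : Continuous fun t : ℝ => Real.exp (-(L * max t 0)) * max t 0).add (hDc f))
    (1 / L + M * ‖f‖ / L ^ 2)
    (fun t => (abs_add_le _ _).trans (add_le_add (hφ t) (hDb f t)))
  have hΦ : ContractingWith (1 / 2) Φ := by
    refine ⟨by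
      rw [← NNReal.coe_lt_coe]
      norm_num, LipschitzWith.of_dist_le_mul fun f g => ?_⟩
    rw [BoundedContinuousFunction.dist_le (by positivity)]
    intro t
    have : Φ f t - Φ g t = D (f - g) t := by
      rw [← hDs]
      change (Real.exp (-(L * max t 0)) * max t 0 + D f t) -
        (Real.exp (-(L * max t 0)) * max t 0 + D g t) = _
      ring
    rw [Real.dist_eq, this]
    refine (hDb _ _).trans ?_
    rw [dist_eq_norm, mul_div_right_comm]
    refine mul_le_mul_of_nonneg_right (hLM.trans_eq ?_) (norm_nonneg _)
    norm_num
  refine ⟨hΦ.fixedPoint Φ, fun t => ?_⟩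
  have h := congrArg (fun f : ℝ →ᵇ ℝ => f t) hΦ.fixedPoint_isFixedPt
  rw [mul_add]
  exact h.symm

/-- The fundamental solution `w` of the equation of a mode, with its two derivatives. -/
structure IsFundamental (μ : ℝ → ℝ) (lam : ℝ) (w p q : ℝ → ℝ) : Prop where
  sol_w : IsModeSol μ lam w p
  sol_p : IsModeSol μ lam p q
  w_zero : w 0 = 0
  p_zero : p 0 = 1
  q_zero : q 0 = 0
  q_eq : ∀ t, q t = -(lam * (1 + mass μ)) * w t + lam * memConv μ w t

/-- The weighted fixed point is applied with the kernel `μ(s) exp(-L s)`, which is what the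
substitution `w = exp(L t) f` makes of `μ`. Differentiating the equation for `w` gives the same
equation for `p`: because `w(0) = 0`, the convolution produces no jump term. -/
theorem IsMemoryKernel.exists_isFundamental {μ : ℝ → ℝ} (hμ : IsMemoryKernel μ) {lam : ℝ} :
    ∃ w p q, IsFundamental μ lam w p q := by
  set c₀ := -(lam * (1 + mass μ)) with hc₀
  set M := |c₀| + |lam| * mass μ with hM
  have hM0 : 0 ≤ M := by
    have := hμ.mass_pos'
    positivity
  -- Any positive `L` with `L² ≥ 2 M` gives the contraction constant `1/2`.
  set L := 1 + 2 * M with hL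
  have hL0 : 0 < L := by positivity
  have hνi : IntegrableOn (fun s => μ s * Real.exp (-(L * s))) (Ioi 0) := by
    refine hμ.summable.mul_bdd (c := 1) (by fun_prop) ?_
    filter_upwards [ae_restrict_mem measurableSet_Ioi] with s hs
    rw [Real.norm_of_nonneg (Real.exp_pos _).le, Real.exp_le_one_iff]
    have : 0 ≤ L * s := mul_nonneg hL0.le (mem_Ioi.1 hs).le
    linarith
  have hνm : ∫ s in Ioi 0, |μ s * Real.exp (-(L * s))| ≤ mass μ := by
    refine setIntegral_mono_on hνi.norm hμ.summable measurableSet_Ioi fun s hs => ?_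
    have h1 := hμ.nonneg s hs
    rw [abs_of_nonneg (by positivity)]
    refine mul_le_of_le_one_right h1 ?_
    rw [Real.exp_le_one_iff]
    have : 0 ≤ L * s := mul_nonneg hL0.le (mem_Ioi.1 hs).le
    linarith
  obtain ⟨f, hf⟩ := exists_weighted_fixedPoint hνi c₀ lam L hL0 (by
    rw [div_le_iff₀ (by positivity)]
    have := mul_le_mul_of_nonneg_left hνm (abs_nonneg lam)
    nlinarith [hM, hL])
  set w : ℝ → ℝ := fun t => Real.exp (L * t) * f t with hw
  have hw0 : ∀ t ≤ 0, w t = 0 := by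
    intro t ht
    simp only [hw]
    rw [hf t, max_eq_right ht]
    simp
  have hwc : Continuous w := (by fun_prop : Continuous fun t => Real.exp (L * t)).mul f.continuous
  have hwC : IsCausal w := ⟨fun t ht => hw0 t ht.le, hwc.continuousOn⟩
  set q : ℝ → ℝ := fun t => c₀ * w t + lam * memConv μ w t with hq
  have hqc : Continuous q :=
    (hwc.const_mul _).add ((hwC.continuous_memConv hμ.summable).const_mul _)
  have hq0 : ∀ t ≤ 0, q t = 0 := by
    intro t ht
    simp [hq, hw0 t ht, hwC.memConv_of_neg ht]
  have hqC : IsCausal q := ⟨fun t ht => hq0 t ht.le, hqc.continuousOn⟩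
  have hqeq : ∀ x, Real.exp (L * x) * (c₀ * f x + lam * ∫ s in Ioi 0,
      μ s * Real.exp (-(L * s)) * f (x - s)) = q x := by
    intro x
    have : memConv μ w x =
        Real.exp (L * x) * ∫ s in Ioi 0, μ s * Real.exp (-(L * s)) * f (x - s) := by
      unfold memConv
      rw [← integral_const_mul]
      refine integral_congr_ae (Eventually.of_forall fun s => ?_)
      have : Real.exp (L * (x - s)) = Real.exp (L * x) * Real.exp (-(L * s)) := by
        rw [← Real.exp_add]
        ring_nf
      simp only [hw, this]
      ring
    change _ = c₀ * (Real.exp (L * x) * f x) + lam * memConv μ w x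
    rw [this]
    ring
  set P : ℝ → ℝ := fun t => 1 + ∫ x in 0..t, q x with hP
  have hPd : ∀ t, HasDerivAt P (q t) t := fun t =>
    (hqc.integral_hasStrictDerivAt 0 t).hasDerivAt.const_add 1
  have hPc : Continuous P := continuous_iff_continuousAt.2 fun t => (hPd t).continuousAt
  -- `p` jumps from `0` to `1` at time `0`: this is the unit impulse.
  set p : ℝ → ℝ := (Ici 0).indicator P with hp
  have hpP : ∀ t, 0 ≤ t → p t = P t := fun t ht => by simp [hp, ht]
  have hpC : IsCausal p := ⟨fun t ht => by simp [hp, ht],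
    hPc.continuousOn.congr fun t ht => hpP t ht⟩
  have hwP : ∀ t, 0 ≤ t → w t = ∫ r in 0..t, P r := by
    intro t ht
    simp only [hw]
    rw [hf t, max_eq_left ht, ← mul_assoc, ← Real.exp_add, add_neg_cancel, Real.exp_zero, one_mul]
    simp only [hqeq, hP]
    rw [intervalIntegral.integral_add (by simp)
      ((intervalIntegral.continuous_primitive
        (fun a b => hqc.intervalIntegrable a b) 0).intervalIntegrable _ _)]
    simp
  have hdw : ∀ t, 0 < t → HasDerivAt w (p t) t := by
    intro t ht
    rw [hpP t ht.le]
    refine (hPc.integral_hasStrictDerivAt 0 t).hasDerivAt.congr_of_eventuallyEq ?_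
    filter_upwards [Ioi_mem_nhds ht] with r hr using hwP r (mem_Ioi.1 hr).le
  have hdp : ∀ t, 0 < t → HasDerivAt p (q t) t := by
    intro t ht
    refine (hPd t).congr_of_eventuallyEq ?_
    filter_upwards [Ioi_mem_nhds ht] with r hr using hpP r (mem_Ioi.1 hr).le
  refine ⟨w, p, q, ⟨hwC, hpC, hdw, hdp⟩, ⟨hpC, hqC, hdp, fun t ht => ?_⟩, hw0 0 le_rfl, ?_,
    hq0 0 le_rfl, fun t => rfl⟩
  · have := ((hdw t ht).const_mul c₀).fun_add
      ((hμ.hasDerivAt_memConv hwC hpC hdw ht).const_mul lam)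
    refine this.congr_deriv ?_
    rw [hw0 0 le_rfl]
    ring
  · rw [hpP 0 le_rfl]
    simp [hP]

/-! ### The spectral gap of the Dirichlet Laplacian -/

/-- The pairs `(φ, ∇φ)` with a test function `φ`. -/
def IsTestPair (Ω : Set E3) (p : L2 Ω × (Fin 3 → L2 Ω)) : Prop :=
  ∃ φ : E3 → ℝ, IsTest Ω φ ∧ p.1 =ᵐ[volume.restrict Ω] φ ∧
    ∀ i, p.2 i =ᵐ[volume.restrict Ω] partialDeriv i φ

lemma IsTest.differentiable {Ω : Set E3} {φ : E3 → ℝ} (h : IsTest Ω φ) : Differentiable ℝ φ :=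
  h.1.differentiable (by simp)

lemma IsTestPair.add {Ω : Set E3} {p q : L2 Ω × (Fin 3 → L2 Ω)} (hp : IsTestPair Ω p)
    (hq : IsTestPair Ω q) : IsTestPair Ω (p + q) := by
  obtain ⟨φ, h1, h2, h3⟩ := hp
  obtain ⟨ψ, k1, k2, k3⟩ := hq
  refine ⟨φ + ψ, ⟨h1.1.add k1.1, h1.2.1.add k1.2.1,
    (tsupport_add _ _).trans (union_subset h1.2.2 k1.2.2)⟩, ?_, fun i => ?_⟩
  · exact (Lp.coeFn_add _ _).trans (h2.add k2)
  · refine (Lp.coeFn_add _ _).trans ((h3 i).add (k3 i)) |>.trans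
      (Eventually.of_forall fun x => ?_)
    simp only [Pi.add_apply, partialDeriv]
    rw [fderiv_add (h1.differentiable x) (k1.differentiable x)]
    rfl

lemma IsTestPair.smul {Ω : Set E3} {p : L2 Ω × (Fin 3 → L2 Ω)} (c : ℝ) (hp : IsTestPair Ω p) :
    IsTestPair Ω (c • p) := by
  obtain ⟨φ, h1, h2, h3⟩ := hp
  refine ⟨c • φ, ⟨h1.1.const_smul c, h1.2.1.smul_left (f := fun _ => c),
    (tsupport_smul_subset_right (fun _ => c) φ).trans h1.2.2⟩, ?_, fun i => ?_⟩
  · exact (Lp.coeFn_smul _ _).trans (h2.const_smul c)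
  · refine (Lp.coeFn_smul _ _).trans ((h3 i).const_smul c) |>.trans
      (Eventually.of_forall fun x => ?_)
    simp only [Pi.smul_apply, partialDeriv]
    rw [fderiv_const_smul (h1.differentiable x)]
    rfl

lemma isTestPair_zero (Ω : Set E3) : IsTestPair Ω 0 := by
  refine ⟨0, ⟨contDiff_const, HasCompactSupport.zero, by simp⟩, Lp.coeFn_zero _ _ _, fun i => ?_⟩
  refine (Lp.coeFn_zero _ _ _).trans (Eventually.of_forall fun x => ?_)
  simp [partialDeriv]

/-- A closed condition on pairs `(u, ∇u)` holds on `H¹₀` if it holds for test functions. -/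
lemma H10_induction {Ω : Set E3} {P : L2 Ω × (Fin 3 → L2 Ω) → Prop} (hP : IsClosed {p | P p})
    (h : ∀ p, IsTestPair Ω p → P p) {p : L2 Ω × (Fin 3 → L2 Ω)} (hp : p ∈ H10 Ω) : P p := by
  have h1 : ∀ q ∈ Submodule.span ℝ {p | IsTestPair Ω p}, IsTestPair Ω q := by
    intro q hq
    induction hq using Submodule.span_induction with
    | mem x hx => exact hx
    | zero => exact isTestPair_zero Ω
    | add x y _ _ hx hy => exact hx.add hy
    | smul c x _ hx => exact hx.smul c
  have h2 : p ∈ closure ((Submodule.span ℝ {p | IsTestPair Ω p} : Submodule ℝ _) :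
      Set (L2 Ω × (Fin 3 → L2 Ω))) := hp
  exact closure_minimal (fun q hq => h q (h1 q hq)) hP h2

lemma L2_inner_eq {Ω : Set E3} (u v : L2 Ω) : inner ℝ u v = ∫ x in Ω, u x * v x := by
  rw [L2.inner_def]
  refine integral_congr_ae (Eventually.of_forall fun x => ?_)
  simp [mul_comm]

lemma L2_norm_sq_eq {Ω : Set E3} (u : L2 Ω) : ‖u‖ ^ 2 = ∫ x in Ω, u x ^ 2 := by
  rw [← real_inner_self_eq_norm_sq, L2_inner_eq]
  simp only [sq]

lemma IsTest.setIntegral_mul {Ω : Set E3} {φ : E3 → ℝ} (h : IsTest Ω φ) (f : E3 → ℝ) :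
    ∫ x in Ω, f x * φ x = ∫ x, f x * φ x := by
  refine setIntegral_eq_integral_of_forall_compl_eq_zero fun x hx => ?_
  rw [image_eq_zero_of_notMem_tsupport fun h' => hx (h.2.2 h'), mul_zero]

/-- The Poincaré inequality for test functions. -/
lemma IsTest.poincare {Ω : Set E3} {φ : E3 → ℝ} (h : IsTest Ω φ) {R : ℝ} (hm : MeasurableSet Ω)
    (hΩ : ∀ x ∈ Ω, ‖x‖ ≤ R) :
    ∫ x in Ω, φ x ^ 2 ≤ 4 * R ^ 2 * ∫ x in Ω, partialDeriv 0 φ x ^ 2 := by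
  set v : E3 := EuclideanSpace.single 0 1 with hv
  set X : E3 →L[ℝ] ℝ := EuclideanSpace.proj 0 with hX
  have hXv : X v = 1 := by simp [hX, hv]
  have hφc := h.1.continuous
  have hdc : Continuous (partialDeriv 0 φ) :=
    (h.1.continuous_fderiv (by simp)).clm_apply continuous_const
  have hds : HasCompactSupport (partialDeriv 0 φ) := h.2.1.fderiv_apply (𝕜 := ℝ) _
  have hdφ := h.differentiable
  have hd2 : ∀ x, fderiv ℝ (fun y => φ y * φ y) x v = 2 * φ x * partialDeriv 0 φ x := by
    intro x
    rw [fderiv_fun_mul (hdφ x) (hdφ x)]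
    simp only [_root_.add_apply, _root_.smul_apply, smul_eq_mul,
      partialDeriv, ← hv]
    ring
  -- The first coordinate has derivative `1`, so `∫ φ² = -2 ∫ x₀ φ ∂₀φ`. With `|x₀| ≤ R` and
  -- Cauchy–Schwarz this gives the constant `4R²`.
  have key := integral_mul_fderiv_eq_neg_fderiv_mul_of_integrable (μ := (volume : Measure E3))
    (f := fun x => X x) (g := fun y => φ y * φ y) (v := v) ?_ ?_ ?_
    (fun x _ => X.differentiableAt) (fun x _ => (hdφ x).mul (hdφ x))
  · have e1 : ∫ x in Ω, φ x ^ 2 = ∫ x, φ x * φ x := by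
      rw [← h.setIntegral_mul]
      simp only [sq]
    have e2 : ∫ x, φ x * φ x = - ∫ x in Ω, (2 * X x * partialDeriv 0 φ x) * φ x := by
      rw [h.setIntegral_mul]
      have f1 : ∀ x, X x * fderiv ℝ (fun y => φ y * φ y) x v =
          (2 * X x * partialDeriv 0 φ x) * φ x := fun x => by rw [hd2]; ring
      have f2 : ∀ x, fderiv ℝ (fun x => X x) x v * (φ x * φ x) = φ x * φ x := fun x => by
        rw [show fderiv ℝ (fun x => X x) x = X from X.fderiv, hXv, one_mul]
      simp only [f1, f2] at key
      linarith
    have hXb : ∀ x ∈ Ω, |X x| ≤ R := fun x hx =>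
      (PiLp.norm_apply_le x 0).trans (hΩ x hx)
    have m1 : MemLp (fun x => 2 * X x * partialDeriv 0 φ x) 2 (volume.restrict Ω) := by
      refine MemLp.restrict Ω (Continuous.memLp_of_hasCompactSupport (by fun_prop) ?_)
      exact hds.mul_left (f := fun x => 2 * X x)
    have hcs := sq_integral_mul_le m1 h.memLp
    have hle : ∫ x in Ω, (2 * X x * partialDeriv 0 φ x) ^ 2 ≤
        4 * R ^ 2 * ∫ x in Ω, partialDeriv 0 φ x ^ 2 := by
      rw [← integral_const_mul]
      refine setIntegral_mono_on m1.integrable_sq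
        ((h.memLp_partialDeriv 0).integrable_sq.const_mul _) hm fun x hx => ?_
      rw [mul_pow, mul_pow]
      refine mul_le_mul_of_nonneg_right ?_ (sq_nonneg _)
      have := pow_le_pow_left₀ (abs_nonneg _) (hXb x hx) 2
      rw [sq_abs] at this
      linarith
    have e3 : (∫ x in Ω, φ x ^ 2) ^ 2 ≤
        (4 * R ^ 2 * ∫ x in Ω, partialDeriv 0 φ x ^ 2) * ∫ x in Ω, φ x ^ 2 := by
      have h0 : 0 ≤ ∫ x in Ω, φ x ^ 2 := integral_nonneg fun _ => sq_nonneg _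
      have e4 : (∫ x in Ω, φ x ^ 2) ^ 2 =
          (∫ x in Ω, (2 * X x * partialDeriv 0 φ x) * φ x) ^ 2 := by
        rw [e1, e2, neg_sq]
      rw [e4]
      exact hcs.trans (mul_le_mul_of_nonneg_right hle h0)
    have h0 : 0 ≤ ∫ x in Ω, φ x ^ 2 := integral_nonneg fun _ => sq_nonneg _
    rcases h0.eq_or_lt with h0 | h0
    · rw [← h0]
      have : 0 ≤ ∫ x in Ω, partialDeriv 0 φ x ^ 2 := integral_nonneg fun _ => sq_nonneg _
      positivity
    · rw [sq] at e3
      exact le_of_mul_le_mul_right e3 h0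
  · refine Continuous.integrable_of_hasCompactSupport ?_ (h.2.1.mul_left.mul_left)
    rw [show (fun x => fderiv ℝ (fun x => X x) x v * (φ x * φ x)) = fun x => X v * (φ x * φ x) from
      funext fun x => by rw [show fderiv ℝ (fun x => X x) x = X from X.fderiv]]
    fun_prop
  · simp only [hd2]
    refine Continuous.integrable_of_hasCompactSupport (by fun_prop) ?_
    exact (hds.mul_left (f := fun x => 2 * φ x)).mul_left
  · refine Continuous.integrable_of_hasCompactSupport (by fun_prop) ?_
    exact h.2.1.mul_left.mul_left

/-- The Poincaré inequality on `H¹₀`. -/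
lemma H10_poincare {Ω : Set E3} {R : ℝ} (hm : MeasurableSet Ω) (hΩ : ∀ x ∈ Ω, ‖x‖ ≤ R)
    {p : L2 Ω × (Fin 3 → L2 Ω)} (hp : p ∈ H10 Ω) :
    ‖p.1‖ ^ 2 ≤ 4 * R ^ 2 * ‖p.2 0‖ ^ 2 := by
  refine H10_induction (P := fun p => ‖p.1‖ ^ 2 ≤ 4 * R ^ 2 * ‖p.2 0‖ ^ 2) ?_ ?_ hp
  · exact isClosed_le (by fun_prop) (by fun_prop)
  · rintro q ⟨φ, h1, h2, h3⟩
    have := h1.poincare hm hΩ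
    rw [L2_norm_sq_eq, L2_norm_sq_eq]
    have e1 : ∫ x in Ω, q.1 x ^ 2 = ∫ x in Ω, φ x ^ 2 :=
      integral_congr_ae (h2.mono fun x hx => by simp only [hx])
    have e2 : ∫ x in Ω, q.2 0 x ^ 2 = ∫ x in Ω, partialDeriv 0 φ x ^ 2 :=
      integral_congr_ae ((h3 0).mono fun x hx => by simp only [hx])
    rwa [e1, e2]

/-- The weak form of the Dirichlet Laplacian. -/
lemma IsDirichletLaplacian.weak_form {Ω : Set E3} {G : Fin 3 → L2 Ω} {H : Fin 3 → Fin 3 → L2 Ω}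
    (hH : ∀ i j, HasWeakPartial Ω j (G i) (H i j)) {p : L2 Ω × (Fin 3 → L2 Ω)}
    (hp : p ∈ H10 Ω) : ∑ i, inner ℝ (G i) (p.2 i) = inner ℝ (-∑ i, H i i) p.1 := by
  refine H10_induction
    (P := fun p => ∑ i, inner ℝ (G i) (p.2 i) = inner ℝ (-∑ i, H i i) p.1) ?_ ?_ hp
  · exact isClosed_eq (by fun_prop) (by fun_prop)
  · rintro q ⟨φ, h1, h2, h3⟩
    rw [← Finset.sum_neg_distrib, sum_inner]
    refine Finset.sum_congr rfl fun i _ => ?_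
    rw [inner_neg_left, L2_inner_eq, L2_inner_eq]
    refine Eq.trans ?_ ((hH i i φ h1).trans ?_)
    · refine integral_congr_ae ?_
      filter_upwards [h3 i] with x hx
      rw [hx]
    · congr 1
      refine integral_congr_ae ?_
      filter_upwards [h2] with x hx
      rw [hx]

/-- The eigenvalues of the Dirichlet Laplacian are bounded below by a positive constant. -/
theorem IsSmoothBoundedDomain.exists_gap {Ω : Set E3} (hΩ : IsSmoothBoundedDomain Ω) :
    ∃ lam1 : ℝ, 0 < lam1 ∧ ∀ lam : Ioi (0 : ℝ), (lam : ℝ) < lam1 → ∀ u : Eig Ω lam, u = 0 := by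
  obtain ⟨R, hR⟩ := hΩ.isBounded.exists_norm_le
  set R' := max R 1 with hR'
  have hR0 : 0 < R' := lt_of_lt_of_le one_pos (le_max_right _ _)
  refine ⟨1 / (4 * R' ^ 2), by positivity, fun lam hlam u => ?_⟩
  have hbot : preEigenspace Ω lam = ⊥ := by
    rw [eq_bot_iff]
    rintro v ⟨G, H, h1, h2, h3⟩
    have hp := H10_poincare hΩ.isOpen.measurableSet (R := R')
      (fun x hx => (hR x hx).trans (le_max_left _ _)) h1
    -- Testing the eigenvalue equation with `v` itself gives `‖∇v‖² = lam ‖v‖²`, and Poincaré gives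
    -- `‖v‖² ≤ 4R'² lam ‖v‖²`, so `v = 0` once `lam < 1/(4R'²)`.
    have hw := IsDirichletLaplacian.weak_form h2 h1
    rw [← h3] at hw
    simp only [real_inner_self_eq_norm_sq, real_inner_smul_left] at hw hp
    have h0 : ‖G 0‖ ^ 2 ≤ (lam : ℝ) * ‖v‖ ^ 2 := by
      rw [← hw]
      exact Finset.single_le_sum (f := fun i => ‖G i‖ ^ 2) (fun _ _ => sq_nonneg _)
        (Finset.mem_univ 0)
    rw [lt_div_iff₀ (by positivity)] at hlam
    have h5 : ‖v‖ ^ 2 ≤ (lam * (4 * R' ^ 2)) * ‖v‖ ^ 2 := by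
      refine hp.trans ?_
      have := mul_le_mul_of_nonneg_left h0 (by positivity : 0 ≤ 4 * R' ^ 2)
      linarith
    have h6 : ‖v‖ ^ 2 = 0 := by
      by_contra hne
      have : 0 < ‖v‖ ^ 2 := lt_of_le_of_ne (sq_nonneg _) (Ne.symm hne)
      nlinarith
    simpa using h6
  have hu : (u : L2 Ω) ∈ (preEigenspace Ω lam).topologicalClosure := u.2
  have hc : IsClosed ((⊥ : Submodule ℝ (L2 Ω)) : Set (L2 Ω)) := by simp
  rw [hbot, hc.submodule_topologicalClosure_eq] at hu
  exact Subtype.ext (by simpa using hu)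

/-! ### Diagonal operators on the scale -/

section Scale

variable {E : Ioi (0 : ℝ) → Type} [∀ lam, NormedAddCommGroup (E lam)]
  [∀ lam, InnerProductSpace ℝ (E lam)]

lemma Scale.ext {σ : ℝ} {u v : Scale E σ} (h : u.toExp = v.toExp) : u = v := Subtype.ext h

lemma Scale.toLp_apply {σ : ℝ} (u : Scale E σ) (lam : Ioi (0 : ℝ)) :
    Scale.toLp E σ u lam = ((lam : ℝ) ^ (σ / 2)) • u.toExp lam := rfl

lemma Scale.hasSum_norm_sq {σ : ℝ} (u : Scale E σ) :
    HasSum (fun lam : Ioi (0 : ℝ) => ((lam : ℝ) ^ (σ / 2) * ‖u.toExp lam‖) ^ 2) (‖u‖ ^ 2) := by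
  have hs := lp.hasSum_norm (p := 2) (by simp) (Scale.toLp E σ u)
  simp only [ENNReal.toReal_ofNat, Real.rpow_ofNat] at hs
  convert hs using 1
  on_goal 1 => funext lam
  · rw [Scale.toLp_apply, norm_smul, Real.norm_of_nonneg (Real.rpow_nonneg lam.2.le _)]
  · rfl

lemma Scale.norm_apply_le {σ : ℝ} (u : Scale E σ) (lam : Ioi (0 : ℝ)) :
    (lam : ℝ) ^ (σ / 2) * ‖u.toExp lam‖ ≤ ‖u‖ := by
  have h := lp.norm_apply_le_norm (by simp) (Scale.toLp E σ u) lam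
  rwa [Scale.toLp_apply, norm_smul, Real.norm_of_nonneg (Real.rpow_nonneg lam.2.le _)] at h

/-- The component of an expansion in the eigenspace of `lam`. -/
noncomputable def Scale.proj (σ : ℝ) (lam : Ioi (0 : ℝ)) : Scale E σ →L[ℝ] E lam :=
  LinearMap.mkContinuous
    { toFun := fun u => u.toExp lam
      map_add' := fun _ _ => rfl
      map_smul' := fun _ _ => rfl } ((lam : ℝ) ^ (σ / 2))⁻¹ fun u => by
    have h0 : 0 < (lam : ℝ) ^ (σ / 2) := Real.rpow_pos_of_pos lam.2 _
    rw [← div_eq_inv_mul, le_div_iff₀ h0, mul_comm]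
    exact u.norm_apply_le lam

@[simp] lemma Scale.proj_apply {σ : ℝ} (lam : Ioi (0 : ℝ)) (u : Scale E σ) :
    Scale.proj σ lam u = u.toExp lam := rfl

lemma Scale.norm_le_of_apply_le {σ θ : ℝ} {u : Scale E σ} {v : Scale E θ} {C : ℝ}
    (h : ∀ lam : Ioi (0 : ℝ), (lam : ℝ) ^ (θ / 2) * ‖v.toExp lam‖ ≤
      C * ((lam : ℝ) ^ (σ / 2) * ‖u.toExp lam‖)) : ‖v‖ ≤ |C| * ‖u‖ := by
  have h1 := hasSum_le (fun lam => ?_) v.hasSum_norm_sq (u.hasSum_norm_sq.mul_left (C ^ 2))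
  · rw [← mul_pow, ← sq_abs (C * ‖u‖), abs_mul, abs_norm] at h1
    exact (pow_le_pow_iff_left₀ (norm_nonneg _) (by positivity) two_ne_zero).1 h1
  · have h0 : 0 ≤ (lam : ℝ) ^ (θ / 2) := Real.rpow_nonneg lam.2.le _
    rw [← mul_pow]
    exact pow_le_pow_left₀ (by positivity) (h lam) 2

lemma Scale.mem_of_apply_le {σ θ : ℝ} (u : Scale E σ) {v : ∀ lam, E lam} {C : ℝ}
    (h : ∀ lam : Ioi (0 : ℝ), (lam : ℝ) ^ (θ / 2) * ‖v lam‖ ≤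
      C * ((lam : ℝ) ^ (σ / 2) * ‖u.toExp lam‖)) : v ∈ scaleSubmodule E θ := by
  change Memℓp (powA E θ v) 2
  refine memℓp_gen (Summable.of_nonneg_of_le (fun lam => by positivity) (fun lam => ?_)
    (u.hasSum_norm_sq.summable.mul_left (C ^ 2)))
  have h0 : 0 ≤ (lam : ℝ) ^ (θ / 2) := Real.rpow_nonneg lam.2.le _
  change ‖((lam : ℝ) ^ (θ / 2)) • v lam‖ ^ _ ≤ _
  rw [norm_smul, Real.norm_of_nonneg h0, ENNReal.toReal_ofNat, Real.rpow_ofNat, ← mul_pow]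
  exact pow_le_pow_left₀ (by positivity) (h lam) 2

lemma Scale.norm_smul_apply_le {σ θ : ℝ} {m : Ioi (0 : ℝ) → ℝ} {C : ℝ}
    (hm : ∀ lam : Ioi (0 : ℝ), |m lam| * (lam : ℝ) ^ (θ / 2) ≤ C * (lam : ℝ) ^ (σ / 2))
    (u : Scale E σ) (lam : Ioi (0 : ℝ)) :
    (lam : ℝ) ^ (θ / 2) * ‖m lam • u.toExp lam‖ ≤
      C * ((lam : ℝ) ^ (σ / 2) * ‖u.toExp lam‖) := by
  rw [norm_smul, Real.norm_eq_abs, ← mul_assoc, ← mul_assoc, mul_comm ((lam : ℝ) ^ (θ / 2))]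
  exact mul_le_mul_of_nonneg_right (hm lam) (norm_nonneg _)

/-- The diagonal operator with the multipliers `m lam`. -/
noncomputable def Scale.diag {σ θ : ℝ} (m : Ioi (0 : ℝ) → ℝ) (C : ℝ)
    (hm : ∀ lam : Ioi (0 : ℝ), |m lam| * (lam : ℝ) ^ (θ / 2) ≤ C * (lam : ℝ) ^ (σ / 2)) :
    Scale E σ →L[ℝ] Scale E θ :=
  LinearMap.mkContinuous
    { toFun := fun u => (⟨fun lam => m lam • u.toExp lam,
        Scale.mem_of_apply_le u (Scale.norm_smul_apply_le hm u)⟩ : scaleSubmodule E θ)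
      map_add' := fun u v => Scale.ext (funext fun lam => smul_add (m lam) (u.1 lam) (v.1 lam))
      map_smul' := fun c u => Scale.ext (funext fun lam => smul_comm (m lam) c (u.1 lam)) }
    |C| fun u => Scale.norm_le_of_apply_le (Scale.norm_smul_apply_le hm u)

lemma Scale.norm_diag_le {σ θ : ℝ} {m : Ioi (0 : ℝ) → ℝ} {C : ℝ}
    (hm : ∀ lam : Ioi (0 : ℝ), |m lam| * (lam : ℝ) ^ (θ / 2) ≤ C * (lam : ℝ) ^ (σ / 2)) :
    ‖Scale.diag (E := E) m C hm‖ ≤ |C| :=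
  ContinuousLinearMap.opNorm_le_bound _ (abs_nonneg _) fun u =>
    Scale.norm_le_of_apply_le (Scale.norm_smul_apply_le hm u)

/-- Diagonal operators depend strongly continuously on their multipliers. -/
lemma Scale.continuous_diag {σ θ : ℝ} {m : ℝ → Ioi (0 : ℝ) → ℝ} {C : ℝ}
    (hm : ∀ r, ∀ lam : Ioi (0 : ℝ), |m r lam| * (lam : ℝ) ^ (θ / 2) ≤ C * (lam : ℝ) ^ (σ / 2))
    (hc : ∀ lam, Continuous fun r => m r lam) (u : Scale E σ) :
    Continuous fun r => Scale.diag (E := E) (m r) C (hm r) u := by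
  rw [continuous_iff_continuousAt]
  intro r₀
  refine tendsto_iff_norm_sub_tendsto_zero.2 ?_
  have hsq : Tendsto (fun r => ‖Scale.diag (E := E) (m r) C (hm r) u -
      Scale.diag (E := E) (m r₀) C (hm r₀) u‖ ^ 2) (𝓝 r₀) (𝓝 0) := by
    have hz : (0 : ℝ) = ∑' _ : Ioi (0 : ℝ), (0 : ℝ) := by simp
    rw [hz]
    simp only [← (Scale.hasSum_norm_sq _).tsum_eq]
    refine tendsto_tsum_of_dominated_convergence
      (bound := fun lam : Ioi (0 : ℝ) => (2 * C) ^ 2 *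
        ((lam : ℝ) ^ (σ / 2) * ‖u.toExp lam‖) ^ 2)
      (u.hasSum_norm_sq.summable.mul_left _) (fun lam => ?_)
      (Eventually.of_forall fun r lam => ?_)
    · have : Tendsto (fun r => ((lam : ℝ) ^ (θ / 2) * (|m r lam - m r₀ lam| *
          ‖u.toExp lam‖)) ^ 2) (𝓝 r₀)
          (𝓝 (((lam : ℝ) ^ (θ / 2) * (|m r₀ lam - m r₀ lam| * ‖u.toExp lam‖)) ^ 2)) := by
        have := (hc lam).continuousAt (x := r₀)
        exact ContinuousAt.tendsto (by fun_prop)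
      simp only [sub_self, abs_zero, zero_mul, mul_zero, ne_eq, OfNat.ofNat_ne_zero,
        not_false_eq_true, zero_pow] at this
      refine this.congr fun r => ?_
      change _ = ((lam : ℝ) ^ (θ / 2) * ‖m r lam • u.toExp lam - m r₀ lam • u.toExp lam‖) ^ 2
      rw [← sub_smul, norm_smul, Real.norm_eq_abs]
    · change ‖((lam : ℝ) ^ (θ / 2) * ‖m r lam • u.toExp lam - m r₀ lam • u.toExp lam‖) ^ 2‖ ≤ _
      have h0 : 0 ≤ (lam : ℝ) ^ (θ / 2) := Real.rpow_nonneg lam.2.le _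
      rw [Real.norm_of_nonneg (sq_nonneg _), ← sub_smul, norm_smul, Real.norm_eq_abs, ← mul_pow]
      refine pow_le_pow_left₀ (by positivity) ?_ 2
      rw [← mul_assoc, ← mul_assoc]
      refine mul_le_mul_of_nonneg_right ?_ (norm_nonneg _)
      have h1 := hm r lam
      have h2 := hm r₀ lam
      have h3 := mul_le_mul_of_nonneg_right (abs_sub (m r lam) (m r₀ lam)) h0
      linarith
  have h := (Real.continuous_sqrt.tendsto 0).comp hsq
  simp only [Real.sqrt_zero] at h
  refine h.congr fun r => ?_
  simp [Real.sqrt_sq]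

/-- A strongly measurable function with values in the scale has only countably many nonzero
components. -/
lemma Scale.exists_countable_support {α : Type*} [MeasurableSpace α] {σ : ℝ} {f : α → Scale E σ}
    (hf : StronglyMeasurable f) :
    ∃ S : Set (Ioi (0 : ℝ)), S.Countable ∧ ∀ x, ∀ lam ∉ S, (f x).toExp lam = 0 := by
  have hsupp : ∀ u : Scale E σ, {lam : Ioi (0 : ℝ) | u.toExp lam ≠ 0}.Countable := by
    intro u
    refine u.hasSum_norm_sq.summable.countable_support.mono fun lam hlam => ?_
    have h0 : 0 < (lam : ℝ) ^ (σ / 2) := Real.rpow_pos_of_pos lam.2 _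
    have h1 : 0 < ‖u.toExp lam‖ := norm_pos_iff.2 hlam
    exact (by positivity : ((lam : ℝ) ^ (σ / 2) * ‖u.toExp lam‖) ^ 2 ≠ 0)
  -- The index set of all `lam > 0` is uncountable, so null sets cannot be united over it. A
  -- strongly measurable function is a limit of simple functions, whose countably many values each
  -- have countable support.
  refine ⟨⋃ n, ⋃ u ∈ range (hf.approx n), {lam | u.toExp lam ≠ 0}, ?_, fun x lam hlam => ?_⟩
  · exact countable_iUnion fun n => (hf.approx n).finite_range.countable.biUnion
      fun u _ => hsupp u
  · have h1 : ∀ n, (hf.approx n x).toExp lam = 0 := by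
      intro n
      by_contra hne
      exact hlam (mem_iUnion.2 ⟨n, mem_biUnion (mem_range_self x) hne⟩)
    have h2 := ((Scale.proj (E := E) σ lam).continuous.tendsto (f x)).comp (hf.tendsto_approx x)
    have h3 : (fun n => Scale.proj σ lam (hf.approx n x)) = fun _ => (0 : E lam) := funext h1
    exact tendsto_nhds_unique h2 (by
      change Tendsto (fun n => Scale.proj σ lam (hf.approx n x)) atTop _
      rw [h3]
      exact tendsto_const_nhds)

end Scale

/-! ### Volterra operators -/

section Volterra

variable {X Y : Type*} [NormedAddCommGroup X] [NormedSpace ℝ X] [NormedAddCommGroup Y]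
  [NormedSpace ℝ Y]

/-- The Volterra convolution `∫_τ^t M(t-y) h(y) dy`, zero for `t ≤ τ`. -/
noncomputable def volt (τ : ℝ) (M : ℝ → X →L[ℝ] Y) (h : ℝ → X) (t : ℝ) : Y :=
  ∫ y in Ioc τ t, M (t - y) (h y)

lemma volt_of_le {τ : ℝ} {M : ℝ → X →L[ℝ] Y} {h : ℝ → X} {t : ℝ} (ht : t ≤ τ) :
    volt τ M h t = 0 := by simp [volt, Ioc_eq_empty_of_le ht]

/-- A uniform bound upgrades strong continuity to joint continuity, which makes `y ↦ M (t - y) (h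
y)` measurable. Continuity in operator norm is not needed. -/
lemma continuous_uncurry_of_bound {M : ℝ → X →L[ℝ] Y} {C : ℝ}
    (hM : ∀ u, Continuous fun r => M r u) (hb : ∀ r, ‖M r‖ ≤ C) :
    Continuous fun p : ℝ × X => M p.1 p.2 := by
  rw [continuous_iff_continuousAt]
  rintro ⟨r₀, u₀⟩
  have h1 : Tendsto (fun p : ℝ × X => M p.1 (p.2 - u₀)) (𝓝 (r₀, u₀)) (𝓝 0) := by
    refine squeeze_zero_norm (a := fun p => C * ‖p.2 - u₀‖) (fun p => ?_) ?_
    · exact (M p.1).le_of_opNorm_le (hb _) _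
    · have : Continuous fun p : ℝ × X => C * ‖p.2 - u₀‖ := by fun_prop
      simpa using this.tendsto (r₀, u₀)
  have h2 : Tendsto (fun p : ℝ × X => M p.1 u₀) (𝓝 (r₀, u₀)) (𝓝 (M r₀ u₀)) :=
    ((hM u₀).tendsto r₀).comp continuous_fst.continuousAt
  have := h1.add h2
  simp only [← map_add, sub_add_cancel, zero_add] at this
  exact this

lemma integrableOn_volt {τ : ℝ} {M : ℝ → X →L[ℝ] Y} {C : ℝ}
    (hM : ∀ u, Continuous fun r => M r u) (hb : ∀ r, ‖M r‖ ≤ C) {h : ℝ → X} {T : ℝ}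
    (hh : IntegrableOn h (Ioc τ T)) (t : ℝ) :
    IntegrableOn (fun y => M (t - y) (h y)) (Ioc τ T) := by
  refine (hh.norm.const_mul C).mono' ?_ (Eventually.of_forall fun y =>
    (M (t - y)).le_of_opNorm_le (hb _) _)
  exact (continuous_uncurry_of_bound hM hb).comp_aestronglyMeasurable
    ((by fun_prop : Continuous fun y : ℝ => t - y).aestronglyMeasurable.prodMk hh.1)

/-- The domain of integration moves with `t`. Extended by zero to a fixed interval, the integrand is
continuous at `t₀` for every `y ≠ t₀`, and dominated convergence applies. -/
lemma continuous_volt {τ : ℝ} {M : ℝ → X →L[ℝ] Y} {C : ℝ}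
    (hM : ∀ u, Continuous fun r => M r u) (hb : ∀ r, ‖M r‖ ≤ C) {h : ℝ → X}
    (hh : ∀ T, IntegrableOn h (Ioc τ T)) : Continuous (volt τ M h) := by
  rw [continuous_iff_continuousAt]
  intro t₀
  set F : ℝ → ℝ → Y := fun t y => (Iic t).indicator (fun y => M (t - y) (h y)) y with hF
  have heq : volt τ M h =ᶠ[𝓝 t₀] fun t => ∫ y in Ioc τ (t₀ + 1), F t y := by
    filter_upwards [Iio_mem_nhds (lt_add_one t₀)] with t ht
    simp only [hF, volt]
    rw [integral_indicator measurableSet_Iic, Measure.restrict_restrict measurableSet_Iic,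
      inter_comm, Ioc_inter_Iic, min_eq_right (mem_Iio.1 ht).le]
  refine ContinuousAt.congr ?_ heq.symm
  refine continuousAt_of_dominated (bound := fun y => C * ‖h y‖) ?_ ?_
    ((hh _).norm.const_mul C) ?_
  · exact Eventually.of_forall fun t =>
      ((integrableOn_volt hM hb (hh _) t).indicator measurableSet_Iic).1
  · refine Eventually.of_forall fun t => Eventually.of_forall fun y => ?_
    exact (norm_indicator_le_norm_self _ _).trans ((M (t - y)).le_of_opNorm_le (hb _) _)
  · have : ∀ᵐ y ∂(volume.restrict (Ioc τ (t₀ + 1))), y ≠ t₀ :=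
      ae_restrict_of_ae (by simp [ae_iff, measure_singleton])
    filter_upwards [this] with y hy
    rcases lt_or_gt_of_ne hy with hlt | hlt
    · have h1 : (fun t => F t y) =ᶠ[𝓝 t₀] fun t => M (t - y) (h y) := by
        filter_upwards [Ioi_mem_nhds hlt] with t ht
        simp [hF, (mem_Ioi.1 ht).le]
      exact ContinuousAt.congr ((hM (h y)).comp (continuous_sub_right y)).continuousAt h1.symm
    · have h1 : (fun t => F t y) =ᶠ[𝓝 t₀] fun _ => 0 := by
        filter_upwards [Iio_mem_nhds hlt] with t ht
        simp [hF, mem_Iio.1 ht]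
      exact continuousAt_const.congr h1.symm

/-- Associativity of convolutions: integrating a Volterra convolution with scalar kernel `a`
against shifts. -/
lemma integral_smul_volterra {S : Set ℝ} (hS : MeasurableSet S) (hS0 : S ⊆ Ici 0)
    {f a : ℝ → ℝ} (hf : IntegrableOn f S) (ha : Measurable a) (ha0 : ∀ r, r < 0 → a r = 0)
    {τ t C : ℝ} (hC : ∀ r ≤ t - τ, |a r| ≤ C) [CompleteSpace X] {h : ℝ → X}
    (hh : IntegrableOn h (Ioc τ t)) :
    ∫ s in S, f s • ∫ y in Ioc τ (t - s), a (t - s - y) • h y =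
      ∫ y in Ioc τ t, (∫ s in S, f s * a (t - y - s)) • h y := by
  -- By causality of `a` the inner domain may be enlarged to the fixed interval `(τ,t]`, which turns
  -- the double integral into one over a product.
  have h1 : ∀ s ∈ S, f s • ∫ y in Ioc τ (t - s), a (t - s - y) • h y =
      ∫ y in Ioc τ t, (f s * a (t - s - y)) • h y := by
    intro s hs
    rw [← integral_smul]
    simp only [smul_smul]
    symm
    refine setIntegral_eq_of_subset_of_forall_sdiff_eq_zero measurableSet_Ioc
      (Ioc_subset_Ioc_right (by linarith [mem_Ici.1 (hS0 hs)])) fun y hy => ?_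
    have : t - s - y < 0 := by
      by_contra hcon
      exact hy.2 ⟨hy.1.1, by linarith⟩
    rw [ha0 _ this, mul_zero, zero_smul]
  rw [setIntegral_congr_fun hS h1]
  have hint : Integrable (Function.uncurry fun s y => (f s * a (t - s - y)) • h y)
      ((volume.restrict S).prod (volume.restrict (Ioc τ t))) := by
    have hp : Integrable (fun p : ℝ × ℝ => f p.1 • h p.2)
        ((volume.restrict S).prod (volume.restrict (Ioc τ t))) := hf.smul_prod hh
    have hm : AEStronglyMeasurable (fun p : ℝ × ℝ => a (t - p.1 - p.2))
        ((volume.restrict S).prod (volume.restrict (Ioc τ t))) :=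
      (ha.comp (by fun_prop)).aestronglyMeasurable
    refine (hp.bdd_smul C hm ?_).congr (Eventually.of_forall fun p => ?_)
    · rw [Measure.prod_restrict]
      filter_upwards [ae_restrict_mem (hS.prod measurableSet_Ioc)] with p hp
      exact hC _ (by linarith [mem_Ici.1 (hS0 hp.1), hp.2.1])
    · simp only [Function.uncurry, Pi.smul_apply']
      rw [smul_smul, mul_comm]
  rw [integral_integral_swap hint]
  refine integral_congr_ae (Eventually.of_forall fun y => ?_)
  beta_reduce
  rw [integral_smul_const]
  congr 2
  funext s
  ring_nf

end Volterra

/-! ### Volterra convolutions with causal scalar kernels -/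

lemma setIntegral_Ioc_comp_sub_left {X : Type*} [NormedAddCommGroup X] [NormedSpace ℝ X]
    {τ t : ℝ} (ht : τ ≤ t) (f : ℝ → X) :
    ∫ s in Ioc 0 (t - τ), f (t - s) = ∫ y in Ioc τ t, f y := by
  rw [← intervalIntegral.integral_of_le (sub_nonneg.2 ht), ← intervalIntegral.integral_of_le ht,
    intervalIntegral.integral_comp_sub_left]
  simp

lemma IsCausal.integrableOn_volterra {X : Type*} [NormedAddCommGroup X] [NormedSpace ℝ X]
    {a : ℝ → ℝ} (ha : IsCausal a)
    {τ t : ℝ} {h : ℝ → X} (hh : IntegrableOn h (Ioc τ t)) :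
    IntegrableOn (fun y => a (t - y) • h y) (Ioc τ t) := by
  obtain ⟨C, -, hC⟩ := ha.exists_bound (t - τ)
  refine hh.bdd_smul C
    (ha.measurable.comp (measurable_const.sub measurable_id)).aestronglyMeasurable
    ?_
  filter_upwards [ae_restrict_mem measurableSet_Ioc] with y hy
  exact hC _ (by linarith [hy.1])

lemma IsCausal.integral_eq_max {a : ℝ → ℝ} (ha : IsCausal a) {c d : ℝ} (hc : c ≤ 0) :
    ∫ r in c..d, a r = ∫ r in 0..d, a r := by
  have h0 : ∫ r in c..0, a r = 0 := by
    rw [intervalIntegral.integral_of_le hc, ← Measure.restrict_congr_set Ioo_ae_eq_Ioc,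
      setIntegral_congr_fun (g := fun _ => (0 : ℝ)) measurableSet_Ioo fun r hr => ha.zero r hr.2]
    simp
  rw [← intervalIntegral.integral_add_adjacent_intervals (ha.intervalIntegrable c 0)
    (ha.intervalIntegrable 0 d), h0, zero_add]

/-- The primitive of a causal function is causal. -/
lemma IsCausal.isCausal_primitive {a : ℝ → ℝ} (ha : IsCausal a) :
    IsCausal fun r => ∫ x in 0..r, a x := by
  refine ⟨fun r hr => ?_, (intervalIntegral.continuous_primitive
    (fun a b => ha.intervalIntegrable a b) 0).continuousOn⟩
  rw [intervalIntegral.integral_symm, ha.integral_eq_max hr.le]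
  simp

lemma IsCausal.hasDerivAt_primitive {a : ℝ → ℝ} (ha : IsCausal a) {t : ℝ} (ht : 0 < t) :
    HasDerivAt (fun r => ∫ x in 0..r, a x) (a t) t :=
  intervalIntegral.integral_hasDerivAt_right (ha.intervalIntegrable _ _)
    ha.measurable.stronglyMeasurable.stronglyMeasurableAtFilter (ha.continuousAt ht.ne')

lemma IsFundamental.p_eq {μ : ℝ → ℝ} {lam : ℝ} {w p q : ℝ → ℝ}
    (hF : IsFundamental μ lam w p q) {r : ℝ} (hr : 0 ≤ r) : p r = 1 + ∫ x in 0..r, q x := by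
  rw [hF.sol_p.causal_x.sub_eq_integral hF.sol_p.causal_y hF.sol_p.deriv_x le_rfl hr, hF.p_zero]
  ring

/-- The jump of `p` at `0` reproduces the primitive of `h` without any smoothing. This term is the
one controlled by the pointwise part of the hypothesis on `K`. -/
lemma IsFundamental.volterra_p {X : Type*} [NormedAddCommGroup X] [NormedSpace ℝ X]
    {μ : ℝ → ℝ} {lam : ℝ} {w p q : ℝ → ℝ}
    (hF : IsFundamental μ lam w p q) {τ t : ℝ} {h : ℝ → X}
    (hh : IntegrableOn h (Ioc τ t)) :
    ∫ y in Ioc τ t, p (t - y) • h y = (∫ y in Ioc τ t, h y) +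
      ∫ y in Ioc τ t, (∫ x in 0..t - y, q x) • h y := by
  rw [← integral_add hh (hF.sol_p.causal_y.isCausal_primitive.integrableOn_volterra hh)]
  refine setIntegral_congr_fun measurableSet_Ioc fun y hy => ?_
  rw [hF.p_eq (by linarith [hy.2]), add_smul, one_smul]

section ScalarVolterra

variable {X : Type*} [NormedAddCommGroup X] [NormedSpace ℝ X] [CompleteSpace X]

lemma IsCausal.setIntegral_shift {a : ℝ → ℝ} (ha : IsCausal a) {τ t y : ℝ} (hy : y ∈ Ioc τ t) :
    ∫ s in Ioc 0 (t - τ), a (t - y - s) = ∫ x in 0..t - y, a x := by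
  rw [← intervalIntegral.integral_of_le (by linarith [hy.1, hy.2]),
    intervalIntegral.integral_comp_sub_left, sub_zero, ha.integral_eq_max (by linarith [hy.1])]

/-- The integral of a convolution is the convolution with the primitive. -/
lemma IsCausal.integral_volterra {a : ℝ → ℝ} (ha : IsCausal a) {τ t : ℝ} (ht : τ ≤ t)
    {h : ℝ → X} (hh : IntegrableOn h (Ioc τ t)) :
    ∫ r in τ..t, ∫ y in Ioc τ r, a (r - y) • h y =
      ∫ y in Ioc τ t, (∫ x in 0..t - y, a x) • h y := by
  obtain ⟨C, -, hC⟩ := ha.exists_bound (t - τ)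
  have key := integral_smul_volterra (S := Ioc 0 (t - τ)) measurableSet_Ioc
    (fun s hs => hs.1.le) (f := fun _ => 1) (by simp) ha.measurable ha.zero hC hh
  simp only [one_smul, one_mul] at key
  rw [intervalIntegral.integral_of_le ht, ← setIntegral_Ioc_comp_sub_left ht, key]
  refine setIntegral_congr_fun measurableSet_Ioc fun y hy => ?_
  simp only [ha.setIntegral_shift hy]

/-- Integration by parts in a convolution. -/
lemma IsCausal.volterra_primitive {a : ℝ → ℝ} (ha : IsCausal a) {τ t : ℝ} (ht : τ ≤ t)
    {h : ℝ → X} (hh : IntegrableOn h (Ioc τ t)) :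
    ∫ y in Ioc τ t, (∫ x in 0..t - y, a x) • h y =
      ∫ y in Ioc τ t, a (t - y) • ∫ x in Ioc τ y, h x := by
  have ha' : IntegrableOn a (Ioc 0 (t - τ)) :=
    (intervalIntegrable_iff_integrableOn_Ioc_of_le (sub_nonneg.2 ht)).1
      (ha.intervalIntegrable _ _)
  -- The second kernel is the Heaviside function, whose convolution with `h` is the primitive;
  -- associativity of convolution is then the claimed integration by parts.
  have key := integral_smul_volterra (S := Ioc 0 (t - τ)) measurableSet_Ioc
    (fun s hs => hs.1.le) ha' (a := (Ici 0).indicator fun _ => 1)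
    (measurable_const.indicator measurableSet_Ici) (fun r hr => by simp [hr]) (C := 1)
    (fun r _ => by
      by_cases h0 : 0 ≤ r
      · simp [h0]
      · simp [h0]) hh
  rw [← setIntegral_Ioc_comp_sub_left ht (fun y => a (t - y) • ∫ x in Ioc τ y, h x)]
  have e1 : ∫ s in Ioc 0 (t - τ), a (t - (t - s)) • ∫ x in Ioc τ (t - s), h x =
      ∫ s in Ioc 0 (t - τ), a s • ∫ y in Ioc τ (t - s),
        ((Ici 0).indicator (fun _ => (1 : ℝ)) (t - s - y)) • h y := by
    refine setIntegral_congr_fun measurableSet_Ioc fun s _ => ?_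
    simp only [sub_sub_cancel]
    congr 1
    refine setIntegral_congr_fun measurableSet_Ioc fun y hy => ?_
    have : 0 ≤ t - s - y := by linarith [hy.2]
    simp [indicator_of_mem (mem_Ici.2 this)]
  rw [e1, key]
  refine setIntegral_congr_fun measurableSet_Ioc fun y hy => ?_
  congr 1
  have hsub : Ioc 0 (t - y) ⊆ Ioc 0 (t - τ) := Ioc_subset_Ioc_right (by linarith [hy.1])
  rw [intervalIntegral.integral_of_le (by linarith [hy.2])]
  symm
  refine (setIntegral_eq_of_subset_of_forall_sdiff_eq_zero measurableSet_Ioc hsub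
    fun s hs => ?_).trans ?_
  · have : ¬ 0 ≤ t - y - s := fun h0 => hs.2 ⟨hs.1.1, by linarith⟩
    simp [this]
  · refine setIntegral_congr_fun measurableSet_Ioc fun s hs => ?_
    have : 0 ≤ t - y - s := by linarith [hs.2]
    simp [indicator_of_mem (mem_Ici.2 this)]

/-- Convolution with the memory kernel. -/
lemma IsCausal.memConv_volterra {μ a : ℝ → ℝ} (hμ : IntegrableOn μ (Ioi 0)) (ha : IsCausal a)
    {τ t : ℝ} {h : ℝ → X} (hh : IntegrableOn h (Ioc τ t)) :
    ∫ s in Ioi 0, μ s • ∫ y in Ioc τ (t - s), a (t - s - y) • h y =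
      ∫ y in Ioc τ t, memConv μ a (t - y) • h y := by
  obtain ⟨C, -, hC⟩ := ha.exists_bound (t - τ)
  exact integral_smul_volterra measurableSet_Ioi (fun s hs => (mem_Ioi.1 hs).le) hμ
    ha.measurable ha.zero hC hh

/-- The equation of a mode for a forcing `h`: first component. -/
lemma IsFundamental.integral_p {μ : ℝ → ℝ} {lam : ℝ} {w p q : ℝ → ℝ}
    (hF : IsFundamental μ lam w p q) {τ t : ℝ} (ht : τ ≤ t) {h : ℝ → X}
    (hh : IntegrableOn h (Ioc τ t)) :
    ∫ r in τ..t, ∫ y in Ioc τ r, p (r - y) • h y = ∫ y in Ioc τ t, w (t - y) • h y := by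
  rw [hF.sol_w.causal_y.integral_volterra ht hh]
  refine setIntegral_congr_fun measurableSet_Ioc fun y hy => ?_
  rw [hF.sol_w.causal_x.sub_eq_integral hF.sol_w.causal_y hF.sol_w.deriv_x le_rfl
    (by linarith [hy.2]), hF.w_zero, sub_zero]

/-- The equation of a mode for a forcing `h`: second component. -/
lemma IsFundamental.volterra_p_eq {μ : ℝ → ℝ} (hμ : IsMemoryKernel μ) {lam : ℝ} {w p q : ℝ → ℝ}
    (hF : IsFundamental μ lam w p q) {τ t : ℝ} {h : ℝ → X}
    (hh : IntegrableOn h (Ioc τ t)) {Z : ℝ → X}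
    (hZ : ∀ r ≤ t, Z r = ∫ y in Ioc τ r, (∫ x in 0..r - y, w x) • h y) :
    (∫ y in Ioc τ t, p (t - y) • h y) - ∫ y in Ioc τ t, h y =
      -(lam • (Z t + (mass μ • Z t - ∫ s in Ioi 0, μ s • Z (t - s)))) := by
  have hw := hF.sol_w.causal_x
  set w2 : ℝ → ℝ := fun r => ∫ x in 0..r, w x with hw2
  have hw2c : IsCausal w2 := hw.isCausal_primitive
  have h1 : ∫ s in Ioi 0, μ s • Z (t - s) = ∫ y in Ioc τ t, memConv μ w2 (t - y) • h y := by
    rw [← hw2c.memConv_volterra hμ.summable hh]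
    refine setIntegral_congr_fun measurableSet_Ioi fun s hs => ?_
    rw [hZ (t - s) (by linarith [mem_Ioi.1 hs])]
  -- The equation for `q`, integrated once in time. Since `w2 0 = 0`, integration commutes with the
  -- memory convolution without a jump term.
  have h2 : ∀ r, 0 ≤ r → ∫ x in 0..r, q x =
      -(lam * (1 + mass μ)) * w2 r + lam * memConv μ w2 r := by
    intro r hr
    have hm := hw.isCausal_memConv hμ.summable
    have hm2 := hw2c.isCausal_memConv hμ.summable
    have hw20 : w2 0 = 0 := by simp [hw2]
    have e := hm2.sub_eq_integral hm (fun s hs => by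
      have := hμ.hasDerivAt_memConv hw2c hw (fun s hs => hw.hasDerivAt_primitive hs) hs
      rwa [hw20, mul_zero, zero_add] at this) le_rfl hr
    rw [hw2c.memConv_of_neg le_rfl, sub_zero] at e
    simp only [hF.q_eq]
    rw [intervalIntegral.integral_add ((hw.intervalIntegrable _ _).const_mul _)
      ((hm.intervalIntegrable _ _).const_mul _), intervalIntegral.integral_const_mul,
      intervalIntegral.integral_const_mul, e]
  rw [hF.volterra_p hh, add_sub_cancel_left, h1, hZ t le_rfl]
  have i1 := hw2c.integrableOn_volterra hh
  have i2 := (hw2c.isCausal_memConv hμ.summable).integrableOn_volterra hh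
  have e3 : ∫ y in Ioc τ t, (∫ x in 0..t - y, q x) • h y =
      ∫ y in Ioc τ t, ((-(lam * (1 + mass μ))) • (w2 (t - y) • h y) +
        lam • (memConv μ w2 (t - y) • h y)) := by
    refine setIntegral_congr_fun measurableSet_Ioc fun y hy => ?_
    rw [h2 _ (by linarith [hy.2]), add_smul, mul_smul, mul_smul]
  rw [e3, integral_add (i1.fun_smul _) (i2.fun_smul _), integral_smul, integral_smul]
  module

end ScalarVolterra

/-! ### Histories -/

instance isFiniteMeasure_memMeasure (μ : ℝ → ℝ) [h : Fact (IsMemoryKernel μ)] :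
    IsFiniteMeasure (memMeasure μ) :=
  isFiniteMeasure_withDensity_ofReal h.out.summable.2

lemma IsMemoryKernel.ae_memMeasure_iff {μ : ℝ → ℝ} (hμ : IsMemoryKernel μ) {P : ℝ → Prop} :
    (∀ᵐ s ∂(memMeasure μ), P s) ↔ ∀ᵐ s ∂(volume.restrict (Ioi 0)), 0 < μ s → P s := by
  unfold memMeasure
  rw [ae_withDensity_iff' hμ.summable.1.aemeasurable.ennreal_ofReal]
  simp

lemma IsMemoryKernel.ae_memMeasure_of_forall {μ : ℝ → ℝ} (hμ : IsMemoryKernel μ) {P : ℝ → Prop}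
    (h : ∀ s, 0 < s → P s) : ∀ᵐ s ∂(memMeasure μ), P s := by
  rw [hμ.ae_memMeasure_iff]
  filter_upwards [ae_restrict_mem measurableSet_Ioi] with s hs _ using h s hs

section History

variable {X : Type*} [NormedAddCommGroup X]

/-- A continuous curve which vanishes up to time `τ`. -/
structure IsCurveFrom (τ : ℝ) (v : ℝ → X) : Prop where
  cont : Continuous v
  zero : ∀ t, t ≤ τ → v t = 0

lemma IsCurveFrom.exists_bound {τ : ℝ} {v : ℝ → X} (hv : IsCurveFrom τ v) (T : ℝ) :
    ∃ C, 0 ≤ C ∧ ∀ r ≤ T, ‖v r‖ ≤ C := by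
  obtain ⟨C, hC⟩ := (isCompact_Icc (a := τ) (b := T)).exists_bound_of_continuousOn
    hv.cont.continuousOn
  refine ⟨max C 0, le_max_right _ _, fun r hr => ?_⟩
  rcases le_total r τ with h | h
  · simp [hv.zero r h]
  · exact (hC r ⟨h, hr⟩).trans (le_max_left _ _)

/-- Zero before `τ` and frozen after `T`, the curve only sees a compact interval. Hence the past `s
↦ v(t-s)` depends continuously on `t` in the supremum norm. -/
lemma IsCurveFrom.uniformContinuous_min {τ : ℝ} {v : ℝ → X} (hv : IsCurveFrom τ v) (T : ℝ) :
    UniformContinuous fun r => v (min r T) := by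
  have h1 : UniformContinuousOn v (Icc τ (max τ T)) :=
    isCompact_Icc.uniformContinuousOn_of_continuous hv.cont.continuousOn
  have h2 : LipschitzWith 1 fun r : ℝ => max τ (min r T) := by
    refine LipschitzWith.of_dist_le_mul fun a b => ?_
    rw [NNReal.coe_one, one_mul, Real.dist_eq, Real.dist_eq]
    refine (abs_max_sub_max_le_max _ _ _ _).trans (max_le (by simp) ?_)
    exact (abs_min_sub_min_le_max _ _ _ _).trans (max_le le_rfl (by simp))
  have h3 : (fun r => v (min r T)) = v ∘ fun r => max τ (min r T) := by
    funext r
    simp only [Function.comp]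
    rcases le_total (min r T) τ with h | h
    · rw [max_eq_left h, hv.zero _ h, hv.zero _ le_rfl]
    · rw [max_eq_right h]
  rw [h3, ← uniformContinuousOn_univ]
  refine h1.comp h2.uniformContinuous.uniformContinuousOn fun r _ => ?_
  exact ⟨le_max_left _ _, max_le_max le_rfl (min_le_right _ _)⟩

/-- The function `s ↦ v(t - max s 0)` as a bounded continuous function. -/
noncomputable def past {τ : ℝ} {v : ℝ → X} (hv : IsCurveFrom τ v) (t : ℝ) :
    BoundedContinuousFunction ℝ X :=
  BoundedContinuousFunction.ofNormedAddCommGroup (fun s => v (t - max s 0))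
    (hv.cont.comp (by fun_prop)) (hv.exists_bound t).choose
    fun s => (hv.exists_bound t).choose_spec.2 _ (by linarith [le_max_right s 0])

lemma past_apply {τ : ℝ} {v : ℝ → X} (hv : IsCurveFrom τ v) (t s : ℝ) :
    past hv t s = v (t - max s 0) := rfl

lemma continuous_past {τ : ℝ} {v : ℝ → X} (hv : IsCurveFrom τ v) : Continuous (past hv) := by
  rw [Metric.continuous_iff]
  intro t₀ ε hε
  obtain ⟨δ, hδ, hd⟩ := Metric.uniformContinuous_iff.1 (hv.uniformContinuous_min (t₀ + 1))
    (ε / 2) (by positivity)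
  refine ⟨min δ 1, lt_min hδ one_pos, fun t ht => ?_⟩
  refine lt_of_le_of_lt ((BoundedContinuousFunction.dist_le (by positivity)).2 fun s => ?_)
    (half_lt_self hε)
  have h0 : 0 ≤ max s 0 := le_max_right _ _
  have ht1 : t ≤ t₀ + 1 := by
    have := ht.trans_le (min_le_right _ _)
    rw [Real.dist_eq] at this
    linarith [(abs_lt.1 this).2]
  have := @hd (t - max s 0) (t₀ - max s 0) (by
    rw [dist_sub_right]
    exact ht.trans_le (min_le_left _ _))
  rw [min_eq_left (by linarith), min_eq_left (by linarith)] at this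
  exact this.le

/-- The history `s ↦ v(t) - v(t - max s 0)`. -/
noncomputable def history {τ : ℝ} {v : ℝ → X} (hv : IsCurveFrom τ v) (t : ℝ) :
    BoundedContinuousFunction ℝ X := BoundedContinuousFunction.const ℝ (v t) - past hv t

lemma history_apply {τ : ℝ} {v : ℝ → X} (hv : IsCurveFrom τ v) (t s : ℝ) :
    history hv t s = v t - v (t - max s 0) := rfl

lemma continuous_history {τ : ℝ} {v : ℝ → X} (hv : IsCurveFrom τ v) :
    Continuous (history hv) := by
  have h1 : Continuous fun t => BoundedContinuousFunction.const ℝ (v t) := by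
    have : Isometry (BoundedContinuousFunction.const ℝ : X → BoundedContinuousFunction ℝ X) := by
      refine Isometry.of_dist_eq fun a b => ?_
      refine le_antisymm ((BoundedContinuousFunction.dist_le dist_nonneg).2 fun _ => le_rfl) ?_
      exact BoundedContinuousFunction.dist_coe_le_dist (f := BoundedContinuousFunction.const ℝ a)
        (g := BoundedContinuousFunction.const ℝ b) (0 : ℝ)
    exact this.continuous.comp hv.cont
  exact h1.sub (continuous_past hv)

variable [NormedSpace ℝ X]

lemma IsCurveFrom.integral_eq_zero {τ : ℝ} {v : ℝ → X} (hv : IsCurveFrom τ v) {a b : ℝ}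
    (ha : a ≤ τ) (hb : b ≤ τ) : ∫ r in a..b, v r = 0 := by
  rw [intervalIntegral.integral_congr (g := fun _ => (0 : X)) fun r hr => hv.zero r ?_]
  · simp
  · exact hr.2.trans (max_le ha hb)

lemma IsCurveFrom.primitive [CompleteSpace X] {τ : ℝ} {v : ℝ → X} (hv : IsCurveFrom τ v) :
    IsCurveFrom τ fun t => ∫ r in τ..t, v r :=
  ⟨intervalIntegral.continuous_primitive (fun a b => hv.cont.intervalIntegrable a b) τ,
    fun _ ht => hv.integral_eq_zero le_rfl ht⟩

/-- The integral of a history is the history of the primitive. -/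
lemma integral_history [CompleteSpace X] {τ : ℝ} {v : ℝ → X} (hv : IsCurveFrom τ v) (t : ℝ) :
    ∫ r in τ..t, history hv r = history hv.primitive t := by
  ext s
  have h := (BoundedContinuousFunction.evalCLM ℝ s : BoundedContinuousFunction ℝ X →L[ℝ] X)
    |>.intervalIntegral_comp_comm ((continuous_history hv).intervalIntegrable (μ := volume) τ t)
  have h' : (∫ r in τ..t, history hv r) s = ∫ r in τ..t, (v r - v (r - max s 0)) := h.symm
  have c2 : Continuous fun r => v (r - max s 0) := hv.cont.comp (by fun_prop)
  rw [h', history_apply, intervalIntegral.integral_sub (hv.cont.intervalIntegrable _ _)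
    (c2.intervalIntegrable _ _), intervalIntegral.integral_comp_sub_right v,
    ← intervalIntegral.integral_add_adjacent_intervals
      (hv.cont.intervalIntegrable (τ - max s 0) τ) (hv.cont.intervalIntegrable τ _),
    hv.integral_eq_zero (by linarith [le_max_right s 0]) le_rfl, zero_add]

end History

/-- The history of a curve is in the domain of the transport operator. -/
lemma isTransport_history {Ω : Set E3} {μ : ℝ → ℝ} [hf : Fact (IsMemoryKernel μ)] {σ τ : ℝ}
    {v : ℝ → HH Ω (σ + 1)} (hv : IsCurveFrom τ v) (t : ℝ) :
    IsTransport (BoundedContinuousFunction.toLp 2 (memMeasure μ) ℝ (history hv.primitive t) :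
      MemSpace Ω μ σ) (-(BoundedContinuousFunction.toLp 2 (memMeasure μ) ℝ (past hv t))) := by
  have hμ := hf.out
  set Z : ℝ → HH Ω (σ + 1) := fun t => ∫ r in τ..t, v r with hZ
  have hη : (BoundedContinuousFunction.toLp 2 (memMeasure μ) ℝ (history hv.primitive t) :
      MemSpace Ω μ σ) =ᵐ[memMeasure μ] fun s => Z t - Z (t - s) := by
    refine (BoundedContinuousFunction.coeFn_toLp 2 (memMeasure μ) ℝ _).trans ?_
    refine hμ.ae_memMeasure_of_forall fun s hs => ?_
    rw [history_apply, max_eq_left hs.le]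
  have hξ : (-(BoundedContinuousFunction.toLp 2 (memMeasure μ) ℝ (past hv t)) :
      MemSpace Ω μ σ) =ᵐ[memMeasure μ] fun s => -v (t - s) := by
    refine (Lp.coeFn_neg _).trans ?_
    refine ((BoundedContinuousFunction.coeFn_toLp 2 (memMeasure μ) ℝ _).neg).trans ?_
    refine hμ.ae_memMeasure_of_forall fun s hs => ?_
    rw [Pi.neg_apply, past_apply, max_eq_left hs.le]
  have hZd : ∀ r, HasDerivAt Z (v r) r := fun r =>
    (hv.cont.integral_hasStrictDerivAt τ r).hasDerivAt
  have hZc : Continuous Z := hv.primitive.cont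
  refine ⟨fun φ hφ hφc hφs => ?_, fun s => Z t - Z (t - s), hη, ?_⟩
  · have e1 : ∫ s in Ioi 0, deriv φ s •
        (BoundedContinuousFunction.toLp 2 (memMeasure μ) ℝ (history hv.primitive t) :
          MemSpace Ω μ σ) s = ∫ s in Ioi 0, deriv φ s • (Z t - Z (t - s)) := by
      refine integral_congr_ae ?_
      filter_upwards [hμ.ae_memMeasure_iff.1 hη] with s hs
      -- Where `μ` vanishes the values of an element of `L²_μ` are arbitrary, but there `φ` and its
      -- derivative vanish.
      by_cases h : s ∈ tsupport φ
      · rw [hs (hφs h).2]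
      · rw [show deriv φ s = 0 from image_eq_zero_of_notMem_tsupport
          fun h' => h (tsupport_deriv_subset h'), zero_smul, zero_smul]
    have e2 : ∫ s in Ioi 0, φ s •
        (-(BoundedContinuousFunction.toLp 2 (memMeasure μ) ℝ (past hv t)) :
          MemSpace Ω μ σ) s = ∫ s in Ioi 0, φ s • (-v (t - s)) := by
      refine integral_congr_ae ?_
      filter_upwards [hμ.ae_memMeasure_iff.1 hξ] with s hs
      by_cases h : s ∈ tsupport φ
      · rw [hs (hφs h).2]
      · rw [image_eq_zero_of_notMem_tsupport h, zero_smul, zero_smul]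
    have hφd : Continuous (deriv φ) := hφ.continuous_deriv (by simp)
    have hdiff : ∀ s, HasDerivAt (fun s => φ s • (Z t - Z (t - s)))
        (φ s • v (t - s) + deriv φ s • (Z t - Z (t - s))) s := by
      intro s
      have h1 : HasDerivAt φ (deriv φ s) s := (hφ.differentiable (by simp) s).hasDerivAt
      have h2 : HasDerivAt (fun s => Z t - Z (t - s)) (v (t - s)) s := by
        have := ((hZd (t - s)).comp_const_sub t s).const_sub (Z t)
        simpa using this
      exact h1.smul h2
    have c1 : Continuous fun s => φ s • v (t - s) :=
      hφ.continuous.smul (hv.cont.comp (by fun_prop))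
    have c2 : Continuous fun s => deriv φ s • (Z t - Z (t - s)) :=
      hφd.smul (continuous_const.sub (hZc.comp (by fun_prop)))
    have c3 : Continuous fun s => φ s • (Z t - Z (t - s)) :=
      hφ.continuous.smul (continuous_const.sub (hZc.comp (by fun_prop)))
    have i1 := c1.integrable_of_hasCompactSupport (μ := volume) hφc.smul_right
    have i2 := c2.integrable_of_hasCompactSupport (μ := volume) hφc.deriv.smul_right
    have i3 := c3.integrable_of_hasCompactSupport (μ := volume) hφc.smul_right
    have key := integral_eq_zero_of_hasDerivAt_of_integrable hdiff (i1.add i2) i3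
    rw [integral_add i1 i2] at key
    rw [e1, e2, setIntegral_eq_integral_of_forall_compl_eq_zero,
      setIntegral_eq_integral_of_forall_compl_eq_zero]
    · simp only [smul_neg, integral_neg]
      exact eq_neg_of_add_eq_zero_right key
    · intro s hs
      rw [image_eq_zero_of_notMem_tsupport fun h => hs (hφs h).1, zero_smul]
    · intro s hs
      rw [show deriv φ s = 0 from image_eq_zero_of_notMem_tsupport
        fun h => hs (hφs (tsupport_deriv_subset h)).1, zero_smul]
  · have : Continuous fun s => Z t - Z (t - s) := continuous_const.sub (hZc.comp (by fun_prop))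
    have h0 := this.tendsto 0
    simp only [sub_zero, sub_self] at h0
    exact h0.mono_left nhdsWithin_le_nhds

/-! ### Existence of solutions -/

/-- The data `w(0) = 0`, `p(0) = 1` give `w` initial energy `1`, whatever the eigenvalue. -/
lemma IsFundamental.energy_w_le {μ : ℝ → ℝ} (hμ : IsMemoryKernel μ) {lam : ℝ} (hlam : 0 < lam)
    {w p q : ℝ → ℝ} (hF : IsFundamental μ lam w p q) {r : ℝ} (hr : 0 ≤ r) :
    lam * w r ^ 2 + p r ^ 2 ≤ 1 := by
  have h := hF.sol_w.energy_le hμ hlam hr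
  rw [hF.sol_w.energy_zero, hF.w_zero, hF.p_zero, modeEnergy] at h
  have := mul_nonneg hlam.le (hμ.memSq_nonneg w r)
  linarith

lemma IsFundamental.abs_p_le {μ : ℝ → ℝ} (hμ : IsMemoryKernel μ) {lam : ℝ} (hlam : 0 < lam)
    {w p q : ℝ → ℝ} (hF : IsFundamental μ lam w p q) (r : ℝ) : |p (max r 0)| ≤ 1 := by
  have h := hF.energy_w_le hμ hlam (le_max_right r 0)
  have h1 : 0 ≤ lam * w (max r 0) ^ 2 := by positivity
  rw [← sq_le_one_iff_abs_le_one]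
  linarith

/-- The energy bound makes `w` of size `lam^{-1/2}`, a gain of one step in the scale: this is why
`v` lies in `HH^{σ+1}` for forcing in `HH^σ`. -/
lemma IsFundamental.abs_w_mul_le {μ : ℝ → ℝ} (hμ : IsMemoryKernel μ) {lam : ℝ} (hlam : 0 < lam)
    {w p q : ℝ → ℝ} (hF : IsFundamental μ lam w p q) (σ r : ℝ) :
    |w r| * lam ^ ((σ + 1) / 2) ≤ 1 * lam ^ (σ / 2) := by
  rcases lt_or_ge r 0 with hr | hr
  · rw [hF.sol_w.causal_x.zero r hr, abs_zero, zero_mul, one_mul]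
    exact Real.rpow_nonneg hlam.le _
  · have h := hF.energy_w_le hμ hlam hr
    have h1 : |w r| * √lam ≤ 1 := by
      rw [← abs_of_nonneg (Real.sqrt_nonneg lam), ← abs_mul, ← sq_le_one_iff_abs_le_one, mul_pow,
        Real.sq_sqrt hlam.le]
      nlinarith [sq_nonneg (p r)]
    have h2 : lam ^ ((σ + 1) / 2) = √lam * lam ^ (σ / 2) := by
      rw [Real.sqrt_eq_rpow, ← Real.rpow_add hlam]
      ring_nf
    rw [h2, ← mul_assoc]
    exact mul_le_mul_of_nonneg_right h1 (Real.rpow_nonneg hlam.le _)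

lemma IsFundamental.continuous_w {μ : ℝ → ℝ} {lam : ℝ} {w p q : ℝ → ℝ}
    (hF : IsFundamental μ lam w p q) : Continuous w := by
  rw [continuous_iff_continuousAt]
  intro t
  rcases eq_or_ne t 0 with rfl | ht
  · have h1 : ContinuousWithinAt w (Ici 0) 0 := hF.sol_w.causal_x.cont 0 self_mem_Ici
    have h2 : ContinuousWithinAt w (Iio 0) 0 := by
      refine (continuousWithinAt_const (b := (0 : ℝ))).congr
        (fun r hr => hF.sol_w.causal_x.zero r hr) hF.w_zero
    have := h2.union h1
    rwa [Iio_union_Ici, continuousWithinAt_univ] at this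
  · exact hF.sol_w.causal_x.continuousAt ht

section Existence

variable {Ω : Set E3} {μ : ℝ → ℝ} {w p q : Ioi (0 : ℝ) → ℝ → ℝ}

/-- The operator with the multipliers `w_λ(r)`. -/
noncomputable def opW (Ω : Set E3) (hμ : IsMemoryKernel μ)
    (hF : ∀ lam : Ioi (0 : ℝ), IsFundamental μ lam (w lam) (p lam) (q lam)) (σ r : ℝ) :
    HH Ω σ →L[ℝ] HH Ω (σ + 1) :=
  Scale.diag (fun lam => w lam r) 1 fun lam => (hF lam).abs_w_mul_le hμ lam.2 σ r

/-- The operator with the multipliers `p_λ(max r 0)`. -/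
noncomputable def opP (Ω : Set E3) (hμ : IsMemoryKernel μ)
    (hF : ∀ lam : Ioi (0 : ℝ), IsFundamental μ lam (w lam) (p lam) (q lam)) (σ r : ℝ) :
    HH Ω σ →L[ℝ] HH Ω σ :=
  Scale.diag (fun lam => p lam (max r 0)) 1 fun lam =>
    mul_le_mul_of_nonneg_right ((hF lam).abs_p_le hμ lam.2 r) (Real.rpow_nonneg lam.2.le _)

variable {σ τ : ℝ} {h : ℝ → HH Ω σ}

lemma continuous_opW (hμ : IsMemoryKernel μ)
    (hF : ∀ lam : Ioi (0 : ℝ), IsFundamental μ lam (w lam) (p lam) (q lam))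
    (u : HH Ω σ) : Continuous fun r => opW Ω hμ hF σ r u :=
  Scale.continuous_diag _ (fun lam => (hF lam).continuous_w) u

lemma continuous_opP (hμ : IsMemoryKernel μ)
    (hF : ∀ lam : Ioi (0 : ℝ), IsFundamental μ lam (w lam) (p lam) (q lam))
    (u : HH Ω σ) : Continuous fun r => opP Ω hμ hF σ r u :=
  Scale.continuous_diag _ (fun lam => (hF lam).sol_p.causal_x.cont.comp_continuous
    (by fun_prop) fun _ => mem_Ici.2 (le_max_right _ _)) u

lemma norm_opW_le (hμ : IsMemoryKernel μ)
    (hF : ∀ lam : Ioi (0 : ℝ), IsFundamental μ lam (w lam) (p lam) (q lam))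
    (r : ℝ) : ‖opW Ω hμ hF σ r‖ ≤ 1 :=
  (Scale.norm_diag_le _).trans_eq abs_one

lemma norm_opP_le (hμ : IsMemoryKernel μ)
    (hF : ∀ lam : Ioi (0 : ℝ), IsFundamental μ lam (w lam) (p lam) (q lam))
    (r : ℝ) : ‖opP Ω hμ hF σ r‖ ≤ 1 :=
  (Scale.norm_diag_le _).trans_eq abs_one

lemma isCurveFrom_volt_opW (hμ : IsMemoryKernel μ)
    (hF : ∀ lam : Ioi (0 : ℝ), IsFundamental μ lam (w lam) (p lam) (q lam))
    (hh : ∀ T, IntegrableOn h (Ioc τ T)) :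
    IsCurveFrom τ (volt τ (opW Ω hμ hF σ) h) :=
  ⟨continuous_volt (continuous_opW hμ hF) (norm_opW_le hμ hF) hh, fun _ ht => volt_of_le ht⟩

lemma volt_opW_apply (hμ : IsMemoryKernel μ)
    (hF : ∀ lam : Ioi (0 : ℝ), IsFundamental μ lam (w lam) (p lam) (q lam))
    (hh : ∀ T, IntegrableOn h (Ioc τ T))
    (t : ℝ) (lam : Ioi (0 : ℝ)) :
    (volt τ (opW Ω hμ hF σ) h t).toExp lam =
      ∫ y in Ioc τ t, w lam (t - y) • (h y).toExp lam :=
  ((Scale.proj (E := Eig Ω) (σ + 1) lam).integral_comp_comm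
    (integrableOn_volt (continuous_opW hμ hF) (norm_opW_le hμ hF) (hh t) t)).symm

lemma volt_opP_apply (hμ : IsMemoryKernel μ)
    (hF : ∀ lam : Ioi (0 : ℝ), IsFundamental μ lam (w lam) (p lam) (q lam))
    (hh : ∀ T, IntegrableOn h (Ioc τ T))
    (t : ℝ) (lam : Ioi (0 : ℝ)) :
    (volt τ (opP Ω hμ hF σ) h t).toExp lam =
      ∫ y in Ioc τ t, p lam (t - y) • (h y).toExp lam := by
  refine ((Scale.proj (E := Eig Ω) σ lam).integral_comp_comm
    (integrableOn_volt (continuous_opP hμ hF) (norm_opP_le hμ hF) (hh t) t)).symm.trans ?_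
  refine setIntegral_congr_fun measurableSet_Ioc fun y hy => ?_
  change p lam (max (t - y) 0) • (h y).toExp lam = _
  rw [max_eq_left (by linarith [hy.2])]

lemma integrableOn_toExp (hh : ∀ T, IntegrableOn h (Ioc τ T))
    (t : ℝ) (lam : Ioi (0 : ℝ)) :
    IntegrableOn (fun y => (h y).toExp lam) (Ioc τ t) :=
  (Scale.proj (E := Eig Ω) σ lam).integrable_comp (hh t)

lemma toExp_intervalIntegral {θ : ℝ} {f : ℝ → HH Ω θ} {a b : ℝ}
    (hf : IntervalIntegrable f volume a b) (lam : Ioi (0 : ℝ)) :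
    (∫ r in a..b, f r).toExp lam = ∫ r in a..b, (f r).toExp lam :=
  ((Scale.proj (E := Eig Ω) θ lam).intervalIntegral_comp_comm hf).symm

/-- Existence of a solution, with explicit components. -/
theorem exists_isSolution (hμ : IsMemoryKernel μ)
    (hF : ∀ lam : Ioi (0 : ℝ), IsFundamental μ lam (w lam) (p lam) (q lam))
    (hh : ∀ T, IntegrableOn h (Ioc τ T)) :
    ∃ V : ℝ → PhaseSpace Ω μ σ, IsSolution τ h V ∧
    ∃ v : ℝ → HH Ω (σ + 1), IsCurveFrom τ v ∧
      (∀ t lam, (v t).toExp lam = ∫ y in Ioc τ t, w lam (t - y) • (h y).toExp lam) ∧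
      (∀ t, (V t).1 = v t) ∧
      (∀ t lam, (V t).2.1.toExp lam = ∫ y in Ioc τ t, p lam (t - y) • (h y).toExp lam) ∧
      ∀ t, (V t).2.2 =ᵐ[memMeasure μ] fun s => v t - v (t - s) := by
  have : Fact (IsMemoryKernel μ) := ⟨hμ⟩
  set v := volt τ (opW Ω hμ hF σ) h with hv_def
  set v' := volt τ (opP Ω hμ hF σ) h with hv'_def
  have hv : IsCurveFrom τ v := isCurveFrom_volt_opW hμ hF hh
  have hv' : Continuous v' := continuous_volt (continuous_opP hμ hF) (norm_opP_le hμ hF) hh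
  have hvm := volt_opW_apply hμ hF hh
  have hvm' := volt_opP_apply hμ hF hh
  set J : BoundedContinuousFunction ℝ (HH Ω (σ + 1)) →L[ℝ] MemSpace Ω μ σ :=
    BoundedContinuousFunction.toLp 2 (memMeasure μ) ℝ with hJ
  -- Duhamel's formula for the first two components; with zero past, `∂ₜζ = Tζ + ∂ₜv` is solved by
  -- the history `v(t) - v(t-s)`.
  set V : ℝ → PhaseSpace Ω μ σ := fun t => (v t, v' t, J (history hv t)) with hV
  have hJc : Continuous fun t => J (history hv t) := J.continuous.comp (continuous_history hv)
  have hVc : Continuous V := hv.cont.prodMk (hv'.prodMk hJc)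
  have hhist : ∀ {u : ℝ → HH Ω (σ + 1)} (hu : IsCurveFrom τ u) (t : ℝ),
      J (history hu t) =ᵐ[memMeasure μ] fun s => u t - u (t - s) := by
    intro u hu t
    refine (BoundedContinuousFunction.coeFn_toLp 2 (memMeasure μ) ℝ _).trans ?_
    refine hμ.ae_memMeasure_of_forall fun s hs => ?_
    rw [history_apply, max_eq_left hs.le]
  refine ⟨V, ⟨hVc.continuousOn, ?_, fun t ht => ?_⟩, v, hv, hvm, fun t => rfl, hvm',
    fun t => hhist hv t⟩
  · have h1 : history hv τ = 0 := by
      ext s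
      rw [history_apply, hv.zero τ le_rfl, hv.zero _ (by linarith [le_max_right s 0]), sub_zero]
      rfl
    simp only [hV, h1, map_zero, hv.zero τ le_rfl, hv'_def, volt_of_le le_rfl]
    rfl
  · have hVi : IntervalIntegrable V volume τ t := hVc.intervalIntegrable _ _
    set Z : ℝ → HH Ω (σ + 1) := fun t => ∫ r in τ..t, v r with hZ
    have hZc : IsCurveFrom τ Z := hv.primitive
    have U1 : (∫ r in τ..t, V r).1 = Z t :=
      ((ContinuousLinearMap.fst ℝ (HH Ω (σ + 1)) (HH Ω σ × MemSpace Ω μ σ)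
        ).intervalIntegral_comp_comm hVi).symm
    have U2 : (∫ r in τ..t, V r).2.1 = ∫ r in τ..t, v' r :=
      (((ContinuousLinearMap.fst ℝ (HH Ω σ) (MemSpace Ω μ σ)).comp
        (ContinuousLinearMap.snd ℝ (HH Ω (σ + 1)) (HH Ω σ × MemSpace Ω μ σ))
        ).intervalIntegral_comp_comm hVi).symm
    have U3 : (∫ r in τ..t, V r).2.2 = J (history hZc t) := by
      refine (((ContinuousLinearMap.snd ℝ (HH Ω σ) (MemSpace Ω μ σ)).comp
        (ContinuousLinearMap.snd ℝ (HH Ω (σ + 1)) (HH Ω σ × MemSpace Ω μ σ))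
        ).intervalIntegral_comp_comm hVi).symm.trans ?_
      change ∫ r in τ..t, J (history hv r) = _
      rw [J.intervalIntegral_comp_comm ((continuous_history hv).intervalIntegrable _ _),
        integral_history hv t]
    have hZm : ∀ lam, ∀ r, (Z r).toExp lam =
        ∫ y in Ioc τ r, (∫ x in 0..r - y, w lam x) • (h y).toExp lam := by
      intro lam r
      rcases le_total r τ with hr | hr
      · rw [hZc.zero r hr, Ioc_eq_empty_of_le hr]
        simp only [Measure.restrict_empty, integral_zero_measure]
        rfl
      · rw [← (hF lam).sol_w.causal_x.integral_volterra hr (integrableOn_toExp hh r lam), hZ,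
          toExp_intervalIntegral (hv.cont.intervalIntegrable _ _)]
        exact intervalIntegral.integral_congr fun x _ => hvm x lam
    refine ⟨?_, ?_, -(J (past hv t)), ?_, ?_⟩
    · rw [U2]
      funext lam
      rw [toExp_intervalIntegral (hv'.intervalIntegrable _ _)]
      change (v t - 0).toExp lam = _
      rw [sub_zero, hvm t lam, ← (hF lam).integral_p ht (integrableOn_toExp hh t lam)]
      exact intervalIntegral.integral_congr fun x _ => (hvm' x lam).symm
    · rw [U1, U3]
      funext lam
      have hμi : IntegrableOn (fun s => μ s • (Z t - Z (t - s))) (Ioi 0) := by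
        obtain ⟨C, hC0, hC⟩ := hZc.exists_bound t
        refine hμ.summable.smul_bdd (C + C) ?_ ?_
        · exact (continuous_const.sub (hZc.cont.comp (by fun_prop))).aestronglyMeasurable
        · filter_upwards [ae_restrict_mem measurableSet_Ioi] with s hs
          exact (norm_sub_le _ _).trans (add_le_add (hC t le_rfl)
            (hC _ (by linarith [mem_Ioi.1 hs])))
      have hint : ∫ s in Ioi 0, μ s • (J (history hZc t)) s =
          ∫ s in Ioi 0, μ s • (Z t - Z (t - s)) := by
        refine integral_congr_ae ?_
        filter_upwards [hμ.ae_memMeasure_iff.1 (hhist hZc t), ae_restrict_mem measurableSet_Ioi]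
          with s hs hs0
        rcases (hμ.nonneg s hs0).eq_or_lt with h0 | h0
        · rw [← h0, zero_smul, zero_smul]
        · rw [hs h0]
      rw [hint]
      have hintm : (∫ s in Ioi 0, μ s • (Z t - Z (t - s))).toExp lam =
          mass μ • (Z t).toExp lam - ∫ s in Ioi 0, μ s • (Z (t - s)).toExp lam := by
        have e := (Scale.proj (E := Eig Ω) (σ + 1) lam).integral_comp_comm hμi
        refine e.symm.trans ?_
        have i2 : IntegrableOn (fun s => μ s • (Z (t - s)).toExp lam) (Ioi 0) := by
          have : IntegrableOn (fun s => μ s • Z (t - s)) (Ioi 0) := by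
            refine (IntegrableOn.sub (hμ.summable.smul_const (Z t)) hμi).congr_fun
              (fun s _ => ?_) measurableSet_Ioi
            simp [smul_sub]
          exact (Scale.proj (E := Eig Ω) (σ + 1) lam).integrable_comp this
        rw [mass, ← integral_smul_const]
        refine Eq.trans ?_ (integral_sub (f := fun s => μ s • (Z t).toExp lam)
          (hμ.summable.smul_const _) i2)
        refine integral_congr_ae (Eventually.of_forall fun s => ?_)
        simp only [map_smul, map_sub, Scale.proj_apply, smul_sub]
      have hint2 : (∫ r in τ..t, h r).toExp lam = ∫ y in Ioc τ t, (h y).toExp lam := by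
        rw [toExp_intervalIntegral ((intervalIntegrable_iff_integrableOn_Ioc_of_le ht).2 (hh t)),
          intervalIntegral.integral_of_le ht]
      change (v' t).toExp lam - (∫ r in τ..t, h r).toExp lam =
        -((lam : ℝ) • ((Z t).toExp lam + (∫ s in Ioi 0, μ s • (Z t - Z (t - s))).toExp lam))
      -- Both sides are compared in each eigenspace, where the claim is the time-integrated mode
      -- equation for `Z`.
      rw [hvm' t lam, hint2, hintm, (hF lam).volterra_p_eq hμ (integrableOn_toExp hh t lam)
        (Z := fun r => (Z r).toExp lam) (fun r _ => hZm lam r)]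
    · rw [U3]
      exact isTransport_history hv t
    · have e1 : (V t - (0, ∫ y in τ..t, h y, 0)).2.2 = J (history hv t) := sub_zero _
      have e2 : (V t - (0, ∫ y in τ..t, h y, 0)).1 = v t := sub_zero _
      rw [e1, e2]
      filter_upwards [hhist hv t, Lp.coeFn_neg (J (past hv t)),
        BoundedContinuousFunction.coeFn_toLp 2 (memMeasure μ) ℝ (past hv t),
        hμ.ae_memMeasure_of_forall (P := fun s => 0 < s) fun s hs => hs] with s h1 h2 h3 h4
      rw [h1, h2, Pi.neg_apply, h3, past_apply, max_eq_left h4.le]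
      abel

end Existence

/-! ### The weighted transport operator -/

section MemIntegral

variable {X : Type*} [NormedAddCommGroup X] [NormedSpace ℝ X] {μ : ℝ → ℝ}

lemma IsMemoryKernel.integrable_memMeasure_iff (hμ : IsMemoryKernel μ) {g : ℝ → X} :
    Integrable g (memMeasure μ) ↔ IntegrableOn (fun s => μ s • g s) (Ioi 0) := by
  have h1 : AEMeasurable (fun s => (μ s).toNNReal) (volume.restrict (Ioi 0)) :=
    hμ.summable.1.aemeasurable.real_toNNReal
  refine (integrable_withDensity_iff_integrable_smul₀ h1).trans (integrable_congr ?_)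
  filter_upwards [ae_restrict_mem measurableSet_Ioi] with s hs
  rw [NNReal.smul_def, Real.coe_toNNReal _ (hμ.nonneg s hs)]

lemma IsMemoryKernel.integral_memMeasure (hμ : IsMemoryKernel μ) (g : ℝ → X) :
    ∫ s, g s ∂(memMeasure μ) = ∫ s in Ioi 0, μ s • g s := by
  have h1 : AEMeasurable (fun s => (μ s).toNNReal) (volume.restrict (Ioi 0)) :=
    hμ.summable.1.aemeasurable.real_toNNReal
  refine (integral_withDensity_eq_integral_smul₀ h1 g).trans (integral_congr_ae ?_)
  filter_upwards [ae_restrict_mem measurableSet_Ioi] with s hs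
  rw [NNReal.smul_def, Real.coe_toNNReal _ (hμ.nonneg s hs)]

lemma IsMemoryKernel.setIntegral_memMeasure (hμ : IsMemoryKernel μ) {S : Set ℝ}
    (hS : MeasurableSet S) (hS0 : S ⊆ Ioi 0) (g : ℝ → X) :
    ∫ s in S, g s ∂(memMeasure μ) = ∫ s in S, μ s • g s := by
  rw [← integral_indicator hS, hμ.integral_memMeasure]
  have : (fun s => μ s • S.indicator g s) = S.indicator fun s => μ s • g s := by
    funext s
    by_cases hs : s ∈ S <;> simp [hs]
  rw [this, setIntegral_indicator hS, inter_eq_right.2 hS0]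

/-- Elements of `L²_μ` can be tested against functions supported in `{μ > 0}`. -/
lemma IsMemoryKernel.integrableOn_smul_of_tsupport (hμ : IsMemoryKernel μ) {φ : ℝ → ℝ}
    (hc : Continuous φ) (hs : HasCompactSupport φ) (hsub : tsupport φ ⊆ {s | 0 < s ∧ 0 < μ s})
    {g : ℝ → X} (hg : MemLp g 2 (memMeasure μ)) :
    IntegrableOn (fun s => φ s • g s) (Ioi 0) := by
  have : Fact (IsMemoryKernel μ) := ⟨hμ⟩
  have hg1 : Integrable g (memMeasure μ) := hg.integrable one_le_two
  -- On the compact support of `φ` the continuous positive `μ` is bounded below, so `φ/μ` is bounded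
  -- and `φ g = (φ/μ) μ g`.
  obtain ⟨c, hc0, hcμ⟩ := hs.isCompact.exists_forall_le' (f := μ) (a := 0)
    (hμ.continuousOn.mono fun s h => (hsub h).1) fun s h => (hsub h).2
  obtain ⟨C, hC⟩ := hs.exists_bound_of_continuous hc
  have hb : ∀ s, ‖φ s / μ s‖ ≤ C / c := by
    intro s
    by_cases h : s ∈ tsupport φ
    · rw [norm_div, Real.norm_of_nonneg (hsub h).2.le]
      exact div_le_div₀ ((norm_nonneg _).trans (hC s)) (hC s) hc0 (hcμ s h)
    · rw [image_eq_zero_of_notMem_tsupport h, zero_div, norm_zero]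
      exact div_nonneg ((norm_nonneg _).trans (hC s)) hc0.le
  have hm : AEStronglyMeasurable (fun s => φ s / μ s) (memMeasure μ) :=
    (hc.aestronglyMeasurable.div₀ hμ.summable.1).mono_ac
      (withDensity_absolutelyContinuous _ _)
  have h := hμ.integrable_memMeasure_iff.1 (hg1.bdd_smul (C / c) hm (Eventually.of_forall hb))
  refine h.congr (Eventually.of_forall fun s => ?_)
  simp only [Pi.smul_apply', smul_smul]
  by_cases hs : s ∈ tsupport φ
  · rw [mul_div_cancel₀ _ (hsub hs).2.ne']
  · rw [image_eq_zero_of_notMem_tsupport hs, zero_div, mul_zero]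

/-- The lower bound `μ ≥ μ b` on `(0,b]` allows division by the weight; near `0` the weight only
helps. -/
lemma IsMemoryKernel.integrableOn_of_memLp (hμ : IsMemoryKernel μ) {b : ℝ} (hb : 0 < b)
    (hμb : 0 < μ b) {g : ℝ → X} (hg : MemLp g 2 (memMeasure μ)) : IntegrableOn g (Ioc 0 b) := by
  have : Fact (IsMemoryKernel μ) := ⟨hμ⟩
  have hle : ∀ s ∈ Ioc 0 b, μ b ≤ μ s := fun s hs => hμ.antitoneOn hs.1 hb hs.2
  have hi : IntegrableOn (fun s => μ s • g s) (Ioc 0 b) :=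
    (hμ.integrable_memMeasure_iff.1 (hg.integrable one_le_two)).mono_set fun s hs => hs.1
  have hm : AEStronglyMeasurable (fun s => (μ s)⁻¹) (volume.restrict (Ioc 0 b)) :=
    (hμ.summable.mono_set fun s (hs : s ∈ Ioc 0 b) => hs.1).1.inv₀
  have h := Integrable.bdd_smul (φ := fun s => (μ s)⁻¹) hi (μ b)⁻¹ hm (by
    filter_upwards [ae_restrict_mem measurableSet_Ioc] with s hs
    rw [norm_inv, Real.norm_of_nonneg (hμb.le.trans (hle s hs))]
    exact inv_anti₀ hμb (hle s hs))
  refine IntegrableOn.congr_fun h (fun s hs => ?_) measurableSet_Ioc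
  simp only [Pi.smul_apply']
  rw [inv_smul_smul₀ (hμb.trans_le (hle s hs)).ne']

lemma IsMemoryKernel.ae_of_ae_memMeasure (hμ : IsMemoryKernel μ) {b : ℝ} (hb : 0 < b)
    (hμb : 0 < μ b) {P : ℝ → Prop} (h : ∀ᵐ s ∂(memMeasure μ), P s) :
    ∀ᵐ s ∂(volume.restrict (Ioc 0 b)), P s := by
  have := ae_restrict_of_ae_restrict_of_subset (t := Ioi 0) (s := Ioc 0 b) (fun s hs => hs.1)
    (hμ.ae_memMeasure_iff.1 h)
  filter_upwards [this, ae_restrict_mem measurableSet_Ioc] with s h1 h2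
  exact h1 (hμb.trans_le (hμ.antitoneOn h2.1 hb h2.2))

end MemIntegral

/-! ### Scalar transport: du Bois-Reymond and dissipativity -/

/-- The primitive of a test function with vanishing mean is a test function. -/
lemma exists_test_primitive {b : ℝ} {χ : ℝ → ℝ} (hχ : ContDiff ℝ ∞ χ) (hc : HasCompactSupport χ)
    (hsub : tsupport χ ⊆ Ioo 0 b) (hb : 0 < b) (h0 : ∫ s, χ s = 0) :
    ∃ φ : ℝ → ℝ, ContDiff ℝ ∞ φ ∧ HasCompactSupport φ ∧ tsupport φ ⊆ Ioo 0 b ∧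
      ∀ s, deriv φ s = χ s := by
  have hd : ∀ s, HasDerivAt (fun s => ∫ r in 0..s, χ r) (χ s) s := fun s =>
    hχ.continuous.integral_hasStrictDerivAt 0 s |>.hasDerivAt
  -- The extra point keeps `K` nonempty when `χ = 0`, so that it has a least and a greatest element.
  set K := insert (b / 2) (tsupport χ) with hK
  have hKc : IsCompact K := hc.isCompact.insert _
  have hKs : K ⊆ Ioo 0 b := insert_subset ⟨by linarith, by linarith⟩ hsub
  obtain ⟨a₁, ha₁, ha₁'⟩ := hKc.exists_isLeast (insert_nonempty _ _)
  obtain ⟨b₁, hb₁, hb₁'⟩ := hKc.exists_isGreatest (insert_nonempty _ _)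
  have hz : ∀ s, s ∉ Icc a₁ b₁ → χ s = 0 := fun s hs => image_eq_zero_of_notMem_tsupport
    fun h => hs ⟨ha₁' (mem_insert_of_mem _ h), hb₁' (mem_insert_of_mem _ h)⟩
  have hsupp : tsupport (fun s => ∫ r in 0..s, χ r) ⊆ Icc a₁ b₁ := by
    refine closure_minimal (fun s hs => ?_) isClosed_Icc
    by_contra hcon
    apply hs
    change ∫ r in 0..s, χ r = 0
    rcases lt_or_ge s a₁ with h | h
    · rw [intervalIntegral.integral_congr (g := fun _ => (0 : ℝ)) fun r hr => hz r fun hr' => ?_]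
      · simp
      · exact absurd (hr.2.trans_lt (max_lt (hKs ha₁).1 h)) (not_lt.2 hr'.1)
    · have h' : b₁ < s := by
        by_contra h''
        exact hcon ⟨h, not_lt.1 h''⟩
      rw [intervalIntegral.integral_eq_integral_of_support_subset, h0]
      intro r hr
      by_contra hr'
      refine hr (hz r fun hr'' => hr' ⟨(hKs ha₁).1.trans_le hr''.1, hr''.2.trans h'.le⟩)
  refine ⟨fun s => ∫ r in 0..s, χ r, ?_, ?_, ?_, fun s => (hd s).deriv⟩
  · rw [contDiff_infty_iff_deriv]
    refine ⟨fun s => (hd s).differentiableAt, ?_⟩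
    rwa [show deriv (fun s => ∫ r in 0..s, χ r) = χ from funext fun s => (hd s).deriv]
  · exact isCompact_Icc.of_isClosed_subset (isClosed_tsupport _) hsupp
  · exact hsupp.trans (Icc_subset_Ioo (hKs ha₁).1 (hKs hb₁).2)

/-- The lemma of du Bois-Reymond. -/
lemma exists_ae_eq_const_of_integral_deriv_mul {b : ℝ} (hb : 0 < b) {F : ℝ → ℝ}
    (hF : IntegrableOn F (Ioo 0 b))
    (h : ∀ φ : ℝ → ℝ, ContDiff ℝ ∞ φ → HasCompactSupport φ → tsupport φ ⊆ Ioo 0 b →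
      ∫ s in Ioo 0 b, deriv φ s * F s = 0) :
    ∃ c, ∀ᵐ s ∂(volume.restrict (Ioo 0 b)), F s = c := by
  set ρb : ContDiffBump (b / 2) := ⟨b / 8, b / 4, by linarith, by linarith⟩ with hρb
  set ρ := ρb.normed volume with hρ
  have ρ1 : ContDiff ℝ ∞ ρ := ρb.contDiff_normed
  have ρ2 : HasCompactSupport ρ := ρb.hasCompactSupport_normed
  have ρ3 : tsupport ρ ⊆ Ioo 0 b := by
    rw [hρ, ρb.tsupport_normed_eq, Real.closedBall_eq_Icc]
    exact Icc_subset_Ioo (by simp [hρb]; linarith) (by simp [hρb]; linarith)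
  have ρ4 : ∫ s, ρ s = 1 := ρb.integral_normed
  have hint : ∀ ψ : ℝ → ℝ, Continuous ψ → HasCompactSupport ψ →
      IntegrableOn (fun s => ψ s * F s) (Ioo 0 b) := by
    intro ψ h1 h2
    obtain ⟨C, hC⟩ := h2.exists_bound_of_continuous h1
    exact hF.bdd_mul h1.aestronglyMeasurable (Eventually.of_forall hC)
  set c := ∫ s in Ioo 0 b, ρ s * F s with hc
  refine ⟨c, ?_⟩
  have key := isOpen_Ioo.ae_eq_zero_of_integral_contDiff_smul_eq_zero
    (μ := volume) (U := Ioo 0 b) (f := fun s => F s - c)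
    ((hF.sub (integrableOn_const (by simp))).locallyIntegrableOn) fun ψ h1 h2 h3 => ?_
  · rw [ae_restrict_iff' measurableSet_Ioo]
    filter_upwards [key] with s hs hs'
    exact sub_eq_zero.1 (hs hs')
  · set m := ∫ s, ψ s with hm
    have iψ := h1.continuous.integrable_of_hasCompactSupport (μ := volume) h2
    have iρ := ρ1.continuous.integrable_of_hasCompactSupport (μ := volume) ρ2
    have hsub : tsupport (fun s => ψ s - m * ρ s) ⊆ tsupport ψ ∪ tsupport ρ := by
      refine closure_minimal (fun s hs => ?_) ((isClosed_tsupport _).union (isClosed_tsupport _))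
      by_contra hcon
      rw [mem_union, not_or] at hcon
      apply hs
      simp [image_eq_zero_of_notMem_tsupport hcon.1, image_eq_zero_of_notMem_tsupport hcon.2]
    -- Subtracting `m ρ` removes the mean of `ψ`, so that the difference is the derivative of an
    -- admissible test function.
    obtain ⟨φ, φ1, φ2, φ3, φ4⟩ := exists_test_primitive (b := b)
      (χ := fun s => ψ s - m * ρ s) (h1.sub (contDiff_const.mul ρ1))
      ((h2.isCompact.union ρ2.isCompact).of_isClosed_subset (isClosed_tsupport _) hsub)
      (hsub.trans (union_subset h3 ρ3)) hb (by
        rw [integral_sub iψ (iρ.const_mul m), integral_const_mul, ρ4, mul_one, sub_self])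
    have e := h φ φ1 φ2 φ3
    simp only [φ4] at e
    have e1 : ∀ s, (ψ s - m * ρ s) * F s = ψ s * F s - m * (ρ s * F s) := fun s => by ring
    simp only [e1] at e
    rw [integral_sub (hint ψ h1.continuous h2) ((hint ρ ρ1.continuous ρ2).const_mul m),
      integral_const_mul, ← hc] at e
    have e2 : ∫ s, ψ s • (F s - c) = ∫ s in Ioo 0 b, ψ s * (F s - c) := by
      refine (setIntegral_eq_integral_of_forall_compl_eq_zero fun s hs => ?_).symm
      rw [smul_eq_mul, image_eq_zero_of_notMem_tsupport fun h' => hs (h3 h'), zero_mul]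
    have e3 : ∫ s in Ioo 0 b, ψ s = m := by
      refine setIntegral_eq_integral_of_forall_compl_eq_zero fun s hs => ?_
      exact image_eq_zero_of_notMem_tsupport fun h' => hs (h3 h')
    rw [e2]
    simp only [mul_sub]
    rw [integral_sub (hint ψ h1.continuous h2) (iψ.integrableOn.mul_const c),
      integral_mul_const, e3]
    linarith

/-- The defining properties of `-∂ₛf = g`, `f(0) = 0` for scalar functions in `L²_μ`. -/
def IsScalarTransport (μ f g : ℝ → ℝ) : Prop :=
  (∀ φ : ℝ → ℝ, ContDiff ℝ ∞ φ → HasCompactSupport φ → tsupport φ ⊆ {s | 0 < s ∧ 0 < μ s} →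
    ∫ s in Ioi 0, deriv φ s * f s = ∫ s in Ioi 0, φ s * g s) ∧
  ∃ f₀ : ℝ → ℝ, f =ᵐ[memMeasure μ] f₀ ∧ Tendsto f₀ (𝓝[>] 0) (𝓝 0)

/-- The function `f + ∫₀^s g` has zero distributional derivative on `(0,b)`, hence is constant
there. The constant is zero because `f` has a representative tending to `0` at the origin, as the
primitive does. -/
lemma IsMemoryKernel.ae_eq_neg_primitive {μ : ℝ → ℝ} (hμ : IsMemoryKernel μ) {f g : ℝ → ℝ}
    (hf : MemLp f 2 (memMeasure μ)) (hg : MemLp g 2 (memMeasure μ))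
    (h : IsScalarTransport μ f g) {b : ℝ} (hb : 0 < b) (hμb : 0 < μ b) :
    ∀ᵐ s ∂(volume.restrict (Ioo 0 b)), f s = -∫ r in 0..s, g r := by
  have if_ := hμ.integrableOn_of_memLp hb hμb hf
  have ig := hμ.integrableOn_of_memLp hb hμb hg
  have ig' : IntervalIntegrable g volume 0 b :=
    (intervalIntegrable_iff_integrableOn_Ioc_of_le hb.le).2 ig
  set G : ℝ → ℝ := fun s => ∫ r in 0..s, g r with hG
  have hGac : AbsolutelyContinuousOnInterval G 0 b :=
    ig'.absolutelyContinuousOnInterval_intervalIntegral (by simp)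
  have hGc : ContinuousOn G (Icc 0 b) := by simpa [uIcc_of_le hb.le] using hGac.continuousOn
  have iG : IntegrableOn G (Ioo 0 b) := hGc.integrableOn_Icc.mono_set Ioo_subset_Icc_self
  have hpos : Ioo 0 b ⊆ {s | 0 < s ∧ 0 < μ s} := fun s hs =>
    ⟨hs.1, hμb.trans_le (hμ.antitoneOn hs.1 hb hs.2.le)⟩
  obtain ⟨c, hc⟩ := exists_ae_eq_const_of_integral_deriv_mul hb (F := fun s => f s + G s)
    ((if_.mono_set Ioo_subset_Ioc_self).add iG) fun φ h1 h2 h3 => by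
      have hφd : Continuous (deriv φ) := h1.continuous_deriv (by simp)
      have hφac : AbsolutelyContinuousOnInterval φ 0 b := by
        have h' : AbsolutelyContinuousOnInterval (fun s => ∫ r in 0..s, deriv φ r) 0 b :=
          (hφd.intervalIntegrable 0 b).absolutelyContinuousOnInterval_intervalIntegral (by simp)
        have e : (fun s => ∫ r in 0..s, deriv φ r) = φ := by
          funext s
          rw [intervalIntegral.integral_deriv_eq_sub
            (fun x _ => (h1.differentiable (by simp)).differentiableAt)
            (hφd.intervalIntegrable _ _),
            image_eq_zero_of_notMem_tsupport (x := (0 : ℝ)) fun h' => lt_irrefl _ (h3 h').1,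
            sub_zero]
        rwa [e] at h'
      have b0 : φ 0 = 0 := image_eq_zero_of_notMem_tsupport fun h' => lt_irrefl _ (h3 h').1
      have b1 : φ b = 0 := image_eq_zero_of_notMem_tsupport fun h' => lt_irrefl _ (h3 h').2
      have ibp := hφac.integral_mul_deriv_eq_deriv_mul hGac
      rw [b0, b1, zero_mul, zero_mul, sub_zero, zero_sub] at ibp
      have e1 : ∫ s in 0..b, φ s * deriv G s = ∫ s in 0..b, φ s * g s := by
        refine intervalIntegral.integral_congr_ae ?_
        filter_upwards [ig'.ae_hasDerivAt_integral] with x hx hx'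
        rw [(hx (uIoc_subset_uIcc hx') 0 (by simp)).deriv]
      have conv : ∀ u : ℝ → ℝ, ∫ s in 0..b, u s = ∫ s in Ioo 0 b, u s := fun u => by
        rw [intervalIntegral.integral_of_le hb.le, integral_Ioc_eq_integral_Ioo]
      have big : ∀ ψ u : ℝ → ℝ, tsupport ψ ⊆ Ioo 0 b →
          ∫ s in Ioi 0, ψ s * u s = ∫ s in Ioo 0 b, ψ s * u s := by
        intro ψ u hψ
        refine setIntegral_eq_of_subset_of_forall_sdiff_eq_zero measurableSet_Ioi
          (fun s hs => hs.1) fun s hs => ?_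
        rw [image_eq_zero_of_notMem_tsupport fun h' => hs.2 (hψ h'), zero_mul]
      have rel := h.1 φ h1 h2 (h3.trans hpos)
      rw [big _ _ (tsupport_deriv_subset.trans h3), big _ _ h3, ← conv (fun s => φ s * g s), ← e1,
        ibp, conv] at rel
      obtain ⟨C, hC⟩ := h2.deriv.exists_bound_of_continuous hφd
      have m1 : IntegrableOn (fun s => deriv φ s * f s) (Ioo 0 b) :=
        (if_.mono_set Ioo_subset_Ioc_self).bdd_mul hφd.aestronglyMeasurable
          (Eventually.of_forall hC)
      have m2 : IntegrableOn (fun s => deriv φ s * G s) (Ioo 0 b) :=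
        iG.bdd_mul hφd.aestronglyMeasurable (Eventually.of_forall hC)
      simp only [mul_add]
      rw [integral_add m1 m2, rel, neg_add_cancel]
  obtain ⟨f₀, hf0, hlim⟩ := h.2
  have hf0' := ae_restrict_of_ae_restrict_of_subset Ioo_subset_Ioc_self
    (hμ.ae_of_ae_memMeasure hb hμb hf0)
  have hG0 : Tendsto G (𝓝[>] 0) (𝓝 0) := by
    have := (hGc 0 (left_mem_Icc.2 hb.le)).tendsto
    rw [show G 0 = 0 by simp [hG]] at this
    refine this.mono_left ?_
    rw [← nhdsWithin_Ioo_eq_nhdsGT hb]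
    exact nhdsWithin_mono _ Ioo_subset_Icc_self
  have hc0 : c = 0 := by
    have hl := hlim.add hG0
    rw [add_zero] at hl
    by_contra hne
    have hev : ∀ᶠ s in 𝓝[>] (0 : ℝ), f₀ s + G s ≠ c := hl.eventually_ne (Ne.symm hne)
    obtain ⟨a, ha, ha'⟩ := mem_nhdsGT_iff_exists_Ioo_subset.1 hev
    have hmin : (0 : ℝ) < min a b := lt_min ha hb
    have hall : ∀ᵐ s ∂(volume.restrict (Ioo 0 (min a b))), False := by
      have i1 := ae_restrict_of_ae_restrict_of_subset (s := Ioo 0 (min a b))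
        (Ioo_subset_Ioo_right (min_le_right a b)) (hc.and hf0')
      filter_upwards [i1, ae_restrict_mem measurableSet_Ioo] with s hs hs'
      exact ha' ⟨hs'.1, hs'.2.trans_le (min_le_left _ _)⟩ (by rw [← hs.2]; exact hs.1)
    have hz := ae_iff.1 hall
    simp only [not_false_eq_true, ofPred_true, Measure.restrict_apply_univ, Real.volume_Ioo,
      sub_zero, ENNReal.ofReal_eq_zero] at hz
    exact absurd hz (not_le.2 hmin)
  filter_upwards [hc] with s hs
  rw [hc0] at hs
  linarith

/-- Dissipativity of the transport operator in `L²_μ`. -/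
lemma IsMemoryKernel.integral_mul_nonpos {μ : ℝ → ℝ} (hμ : IsMemoryKernel μ) {f g : ℝ → ℝ}
    (hf : MemLp f 2 (memMeasure μ)) (hg : MemLp g 2 (memMeasure μ))
    (h : IsScalarTransport μ f g) : ∫ s, f s * g s ∂(memMeasure μ) ≤ 0 := by
  obtain ⟨δ, hδ, hd⟩ := hμ.decay
  obtain ⟨b₀, hb₀, hμb₀⟩ := hμ.exists_pos
  have hopen : ∀ s, 0 < s → 0 < μ s → ∃ r : ℚ, s < r ∧ 0 < μ r := by
    intro s hs hμs
    have hct : ContinuousAt μ s := hμ.continuousOn.continuousAt (Ioi_mem_nhds hs)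
    have hev : ∀ᶠ r in 𝓝[>] s, 0 < μ r := (hct.eventually_const_lt hμs).filter_mono
      nhdsWithin_le_nhds
    obtain ⟨a, ha, ha'⟩ := mem_nhdsGT_iff_exists_Ioo_subset.1 hev
    obtain ⟨r, hr1, hr2⟩ := exists_rat_btwn (mem_Ioi.1 ha)
    exact ⟨r, hr1, ha' ⟨hr1, hr2⟩⟩
  let ι := {r : ℚ // (0 : ℝ) < r ∧ 0 < μ r}
  obtain ⟨r₀, hr₀, hμr₀⟩ := hopen b₀ hb₀ hμb₀
  have : Nonempty ι := ⟨⟨r₀, hb₀.trans hr₀, hμr₀⟩⟩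
  -- The set where `μ > 0` is open and, by monotonicity, an interval starting at `0`; it is
  -- exhausted by the intervals `(0,r]` with `r` rational and `μ r > 0`, also when `μ` vanishes
  -- beyond a finite point. Rational endpoints keep the filter countably generated.
  have hcov : AECover (memMeasure μ) (atTop : Filter ι) fun r => Ioc (0 : ℝ) (r.1 : ℝ) := by
    refine ⟨?_, fun r => measurableSet_Ioc⟩
    rw [hμ.ae_memMeasure_iff]
    filter_upwards [ae_restrict_mem measurableSet_Ioi] with s hs hμs
    obtain ⟨r, hr, hμr⟩ := hopen s hs hμs
    filter_upwards [eventually_ge_atTop (⟨r, (mem_Ioi.1 hs).trans hr, hμr⟩ : ι)] with r' hr'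
    refine ⟨hs, hr.le.trans ?_⟩
    exact_mod_cast (show r ≤ r'.1 from hr')
  refine le_of_tendsto' (hcov.integral_tendsto_of_countably_generated (hf.integrable_mul hg))
    fun r => ?_
  obtain ⟨r, hr, hμr⟩ := r
  change ∫ s in Ioc 0 (r : ℝ), f s * g s ∂(memMeasure μ) ≤ 0
  rw [hμ.setIntegral_memMeasure measurableSet_Ioc (fun s hs => hs.1)]
  have ig := hμ.integrableOn_of_memLp hr hμr hg
  have ig2 : IntegrableOn (fun s => μ s * g s ^ 2) (Ioc 0 (r : ℝ)) :=
    (hμ.integrable_memMeasure_iff.1 hg.integrable_sq).mono_set fun s hs => hs.1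
  have key := hμ.two_mul_integral_ge hd hr
    ((intervalIntegrable_iff_integrableOn_Ioc_of_le hr.le).2 ig) ig2
  have hnn : 0 ≤ ∫ s in 0..(r : ℝ), μ s * (∫ x in 0..s, g x) ^ 2 := by
    rw [intervalIntegral.integral_of_le hr.le]
    exact setIntegral_nonneg measurableSet_Ioc
      fun s hs => mul_nonneg (hμ.nonneg s hs.1) (sq_nonneg _)
  have heq : ∫ s in Ioc 0 (r : ℝ), μ s • (f s * g s) =
      -∫ s in 0..(r : ℝ), μ s * ((∫ x in 0..s, g x) * g s) := by
    rw [intervalIntegral.integral_of_le hr.le, integral_Ioc_eq_integral_Ioo,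
      integral_Ioc_eq_integral_Ioo, ← integral_neg]
    refine integral_congr_ae ?_
    filter_upwards [hμ.ae_eq_neg_primitive hf hg h hr hμr] with s hs
    rw [hs, smul_eq_mul]
    ring
  rw [heq]
  have := mul_nonneg hμr.le (sq_nonneg (∫ x in 0..(r : ℝ), g x))
  have := mul_nonneg hδ.le hnn
  linarith

/-! ### Uniqueness of solutions -/

lemma IsScalarTransport.sub {μ : ℝ → ℝ} (hμ : IsMemoryKernel μ) {f g f' g' : ℝ → ℝ}
    (hf : MemLp f 2 (memMeasure μ)) (hg : MemLp g 2 (memMeasure μ))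
    (hf' : MemLp f' 2 (memMeasure μ)) (hg' : MemLp g' 2 (memMeasure μ))
    (h : IsScalarTransport μ f g) (h' : IsScalarTransport μ f' g') :
    IsScalarTransport μ (fun s => f s - f' s) (fun s => g s - g' s) := by
  refine ⟨fun φ h1 h2 h3 => ?_, ?_⟩
  · have d1 : Continuous (deriv φ) := h1.continuous_deriv (by simp)
    have d3 := tsupport_deriv_subset.trans h3
    simp only [mul_sub]
    refine (integral_sub (hμ.integrableOn_smul_of_tsupport d1 h2.deriv d3 hf)
      (hμ.integrableOn_smul_of_tsupport d1 h2.deriv d3 hf')).trans ?_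
    refine Eq.trans ?_ (integral_sub (hμ.integrableOn_smul_of_tsupport h1.continuous h2 h3 hg)
      (hμ.integrableOn_smul_of_tsupport h1.continuous h2 h3 hg')).symm
    exact congrArg₂ _ (h.1 φ h1 h2 h3) (h'.1 φ h1 h2 h3)
  · obtain ⟨f₀, e, l⟩ := h.2
    obtain ⟨f₀', e', l'⟩ := h'.2
    refine ⟨fun s => f₀ s - f₀' s, e.sub e', ?_⟩
    simpa using l.sub l'

/-- In the derivative of `lam a² + b² + lam ‖η‖²` the terms in `a b` cancel, and `-2 lam b m` from
the second equation compensates the term `2 lam ⟨η, η'⟩ ≤ 2 lam b m`. The energy starts at zero and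
cannot grow. -/
lemma eq_zero_of_energy {H : Type*} [NormedAddCommGroup H] [InnerProductSpace ℝ H]
    {a a' b b' m : ℝ → ℝ} {η η' : ℝ → H} {lam τ : ℝ} (hlam : 0 < lam)
    (ha : ∀ t, HasDerivAt a (a' t) t) (hb : ∀ t, HasDerivAt b (b' t) t)
    (hη : ∀ t, HasDerivAt η (η' t) t) (ha0 : a τ = 0) (hb0 : b τ = 0) (hη0 : η τ = 0)
    (e1 : ∀ t, τ ≤ t → a' t = b t) (e2 : ∀ t, τ ≤ t → b' t = -(lam * (a t + m t)))
    (e3 : ∀ t, τ ≤ t → inner ℝ (η t) (η' t) ≤ b t * m t) (t : ℝ) (ht : τ ≤ t) :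
    a t = 0 ∧ b t = 0 ∧ η t = 0 := by
  set Φ : ℝ → ℝ := fun t => lam * a t ^ 2 + b t ^ 2 + lam * ‖η t‖ ^ 2 with hΦ
  have hder : ∀ t, HasDerivAt Φ (lam * (2 * a t * a' t) + 2 * b t * b' t +
      lam * (2 * inner ℝ (η t) (η' t))) t := by
    intro t
    have d1 : HasDerivAt (fun t => a t ^ 2) (2 * a t * a' t) t := by simpa using (ha t).fun_pow 2
    have d2 : HasDerivAt (fun t => b t ^ 2) (2 * b t * b' t) t := by simpa using (hb t).fun_pow 2
    exact ((d1.const_mul lam).add d2).add ((hη t).norm_sq.const_mul lam)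
  have hanti : AntitoneOn Φ (Ici τ) := by
    refine antitoneOn_of_deriv_nonpos (convex_Ici τ)
      (fun t _ => (hder t).continuousAt.continuousWithinAt)
      (fun t _ => (hder t).differentiableAt.differentiableWithinAt) fun t ht => ?_
    rw [interior_Ici] at ht
    have ht' := (mem_Ioi.1 ht).le
    rw [(hder t).deriv, e1 t ht', e2 t ht']
    nlinarith [mul_le_mul_of_nonneg_left (e3 t ht') hlam.le]
  have h0 : Φ t ≤ Φ τ := hanti (mem_Ici.2 le_rfl) (mem_Ici.2 ht) ht
  have h1 : Φ τ = 0 := by simp [hΦ, ha0, hb0, hη0]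
  rw [h1] at h0
  have p1 : 0 ≤ lam * a t ^ 2 := by positivity
  have p2 : 0 ≤ b t ^ 2 := sq_nonneg _
  have p3 : 0 ≤ lam * ‖η t‖ ^ 2 := by positivity
  simp only [hΦ] at h0
  have z1 : lam * a t ^ 2 = 0 := by linarith
  have z2 : b t ^ 2 = 0 := by linarith
  have z3 : lam * ‖η t‖ ^ 2 = 0 := by linarith
  exact ⟨by simpa [hlam.ne'] using z1, by simpa using z2, by simpa [hlam.ne'] using z3⟩

section Uniqueness

variable {Ω : Set E3} {μ : ℝ → ℝ} {σ : ℝ}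

lemma IsTransport.isScalarTransport (hμ : IsMemoryKernel μ) {η ξ : MemSpace Ω μ σ}
    (h : IsTransport η ξ) (L : HH Ω (σ + 1) →L[ℝ] ℝ) :
    IsScalarTransport μ (fun s => L (η s)) fun s => L (ξ s) := by
  refine ⟨fun φ h1 h2 h3 => ?_, ?_⟩
  · have d1 : Continuous (deriv φ) := h1.continuous_deriv (by simp)
    have d3 := tsupport_deriv_subset.trans h3
    have e1 := L.integral_comp_comm
      (hμ.integrableOn_smul_of_tsupport d1 h2.deriv d3 (Lp.memLp η))
    have e2 := L.integral_comp_comm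
      (hμ.integrableOn_smul_of_tsupport h1.continuous h2 h3 (Lp.memLp ξ))
    simp only [map_smul, smul_eq_mul] at e1 e2
    rw [e1, e2, h.1 φ h1 h2 h3]
  · obtain ⟨η₀, e, l⟩ := h.2
    refine ⟨fun s => L (η₀ s), e.fun_comp L, ?_⟩
    have := (L.continuous.tendsto 0).comp l
    rwa [map_zero] at this

/-- The relation `W = 𝔸U` for differences, projected to one dimension. -/
lemma IsGenerator.sub_apply (hμ : IsMemoryKernel μ) {U W U' W' : PhaseSpace Ω μ σ}
    (h : IsGenerator U W) (h' : IsGenerator U' W') (lam : Ioi (0 : ℝ))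
    (c : StrongDual ℝ (Eig Ω lam)) :
    c ((W' - W).1.toExp lam) = c ((U' - U).2.1.toExp lam) ∧
    c ((W' - W).2.1.toExp lam) = -((lam : ℝ) * (c ((U' - U).1.toExp lam) +
      ∫ s, c (((U' - U).2.2 s).toExp lam) ∂(memMeasure μ))) ∧
    ∫ s, c (((U' - U).2.2 s).toExp lam) * c (((W' - W).2.2 s).toExp lam) ∂(memMeasure μ) ≤
      c ((U' - U).2.1.toExp lam) * ∫ s, c (((U' - U).2.2 s).toExp lam) ∂(memMeasure μ) := by
  have : Fact (IsMemoryKernel μ) := ⟨hμ⟩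
  obtain ⟨h1, h2, ξ, h3, h4⟩ := h
  obtain ⟨h1', h2', ξ', h3', h4'⟩ := h'
  set L : HH Ω (σ + 1) →L[ℝ] ℝ := c.comp (Scale.proj (E := Eig Ω) (σ + 1) lam) with hL
  have hLa : ∀ u : HH Ω (σ + 1), L u = c (u.toExp lam) := fun u => rfl
  have hLm : ∀ η : MemSpace Ω μ σ, MemLp (fun s => L (η s)) 2 (memMeasure μ) :=
    fun η => L.comp_memLp η
  have hLi : ∀ η : MemSpace Ω μ σ, Integrable (fun s => L (η s)) (memMeasure μ) :=
    fun η => (hLm η).integrable one_le_two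
  have hη : (fun s => c (((U' - U).2.2 s).toExp lam)) =ᵐ[memMeasure μ]
      fun s => L (U'.2.2 s) - L (U.2.2 s) := by
    filter_upwards [Lp.coeFn_sub U'.2.2 U.2.2] with s hs
    rw [← map_sub, ← Pi.sub_apply, ← hs]
    rfl
  have hmean : ∀ {U W : PhaseSpace Ω μ σ},
      W.2.1.toExp = -opA Ω (U.1 + ∫ s in Ioi 0, μ s • U.2.2 s).toExp →
      c (W.2.1.toExp lam) = -((lam : ℝ) * (L U.1 + ∫ s, L (U.2.2 s) ∂(memMeasure μ))) := by
    intro U W hUW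
    have e : L (∫ s in Ioi 0, μ s • U.2.2 s) = ∫ s, L (U.2.2 s) ∂(memMeasure μ) := by
      rw [← hμ.integral_memMeasure]
      exact (L.integral_comp_comm ((Lp.memLp U.2.2).integrable one_le_two)).symm
    rw [hUW, ← e, ← map_add]
    change c (-((lam : ℝ) • (U.1 + ∫ s in Ioi 0, μ s • U.2.2 s).toExp lam)) = _
    rw [map_neg, map_smul, smul_eq_mul, hLa]
  have hb : L (W'.1 - W.1) = c ((U' - U).2.1.toExp lam) := by
    change c (W'.1.toExp lam - W.1.toExp lam) = c (U'.2.1.toExp lam - U.2.1.toExp lam)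
    rw [h1, h1']
  refine ⟨hb, ?_, ?_⟩
  · rw [integral_congr_ae hη, integral_sub (hLi _) (hLi _)]
    change c (W'.2.1.toExp lam - W.2.1.toExp lam) =
      -((lam : ℝ) * (c (U'.1.toExp lam - U.1.toExp lam) + _))
    rw [map_sub, map_sub, hmean h2, hmean h2', hLa, hLa]
    ring
  · set x := c ((U' - U).2.1.toExp lam) with hx
    have key : ∫ s, (L (U'.2.2 s) - L (U.2.2 s)) * (L (ξ' s) - L (ξ s)) ∂(memMeasure μ) ≤ 0 :=
      hμ.integral_mul_nonpos ((hLm _).sub (hLm _)) ((hLm _).sub (hLm _))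
      ((h3'.isScalarTransport hμ L).sub hμ (hLm _) (hLm _) (hLm _) (hLm _)
        (h3.isScalarTransport hμ L))
    have hW : (fun s => c (((W' - W).2.2 s).toExp lam)) =ᵐ[memMeasure μ]
        fun s => (L (ξ' s) - L (ξ s)) + x := by
      filter_upwards [Lp.coeFn_sub W'.2.2 W.2.2, h4, h4'] with s hs hs4 hs4'
      have : c (((W' - W).2.2 s).toExp lam) = L (W'.2.2 s - W.2.2 s) := by
        rw [← Pi.sub_apply, ← hs]
        rfl
      rw [this, hs4, hs4', ← hb, map_sub, map_sub, map_add, map_add]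
      ring
    have hprod : (fun s => c (((U' - U).2.2 s).toExp lam) * c (((W' - W).2.2 s).toExp lam))
        =ᵐ[memMeasure μ] fun s => (L (U'.2.2 s) - L (U.2.2 s)) * (L (ξ' s) - L (ξ s)) +
          x * (L (U'.2.2 s) - L (U.2.2 s)) := by
      filter_upwards [hη, hW] with s e1 e2
      rw [e1, e2]
      ring
    have i1 : Integrable (fun s => (L (U'.2.2 s) - L (U.2.2 s)) * (L (ξ' s) - L (ξ s)))
        (memMeasure μ) := ((hLm _).sub (hLm _)).integrable_mul ((hLm _).sub (hLm _))
    have i2 : Integrable (fun s => x * (L (U'.2.2 s) - L (U.2.2 s))) (memMeasure μ) :=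
      ((hLi _).sub (hLi _)).const_mul x
    rw [integral_congr_ae hprod, integral_congr_ae hη, integral_add i1 i2, integral_const_mul]
    exact add_le_of_nonpos_left key

/-- The exceptional null set depends on `lam` and `c`. Within one eigenspace the range of a strongly
measurable function is separable, so countably many functionals suffice; across eigenspaces only
countably many components are nonzero. -/
lemma lp_eq_zero_of_forall_dual (η : MemSpace Ω μ σ)
    (h : ∀ (lam : Ioi (0 : ℝ)) (c : StrongDual ℝ (Eig Ω lam)),
      ∀ᵐ s ∂(memMeasure μ), c ((η s).toExp lam) = 0) : η = 0 := by
  have hm := Lp.stronglyMeasurable η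
  obtain ⟨S, hS, hS0⟩ := Scale.exists_countable_support hm
  have hlam : ∀ lam : Ioi (0 : ℝ), ∀ᵐ s ∂(memMeasure μ), (η s).toExp lam = 0 := by
    intro lam
    have hsep := ((Scale.proj (E := Eig Ω) (σ + 1) lam).continuous.comp_stronglyMeasurable
      hm).isSeparable_range
    exact ae_eq_zero_of_forall_dual_of_isSeparable ℝ hsep (fun c => h lam c)
      (Eventually.of_forall fun s => mem_range_self s)
  refine (Lp.eq_zero_iff_ae_eq_zero).2 ?_
  filter_upwards [(ae_ball_iff hS).2 fun lam _ => hlam lam] with s hs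
  refine Scale.ext (funext fun lam => ?_)
  by_cases hl : lam ∈ S
  · exact hs lam hl
  · exact hS0 s lam hl

/-- Uniqueness of solutions. -/
theorem IsSolution.eqOn (hμ : IsMemoryKernel μ) {τ : ℝ} {h : ℝ → HH Ω σ}
    {V V' : ℝ → PhaseSpace Ω μ σ} (hV : IsSolution τ h V) (hV' : IsSolution τ h V') :
    EqOn V' V (Ici τ) := by
  -- Freezing the time at `τ` extends the difference continuously to the whole line, so that its
  -- primitive is differentiable everywhere.
  set D : ℝ → PhaseSpace Ω μ σ := fun t => V' (max t τ) - V (max t τ) with hD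
  have hmax : Continuous fun t : ℝ => max t τ := by fun_prop
  have hDc : Continuous D :=
    (hV'.continuousOn.comp_continuous hmax fun t => mem_Ici.2 (le_max_right _ _)).sub
      (hV.continuousOn.comp_continuous hmax fun t => mem_Ici.2 (le_max_right _ _))
  -- The difference of mild solutions need not lie in the domain of `𝔸`, but its integral does: the
  -- forcing cancels and `I' = D = 𝔸 I`, so energy arguments apply to `I`.
  set I : ℝ → PhaseSpace Ω μ σ := fun t => ∫ r in τ..t, D r with hI
  have hId : ∀ t, HasDerivAt I (D t) t := fun t =>
    (hDc.integral_hasStrictDerivAt τ t).hasDerivAt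
  have hint : ∀ {V : ℝ → PhaseSpace Ω μ σ} (_ : ContinuousOn V (Ici τ)) {t : ℝ} (_ : τ ≤ t),
      IntervalIntegrable V volume τ t := by
    intro V hc t ht
    refine (hc.mono ?_).intervalIntegrable
    rw [uIcc_of_le ht]
    exact Icc_subset_Ici_self
  have hIe : ∀ t, τ ≤ t → I t = (∫ r in τ..t, V' r) - ∫ r in τ..t, V r := by
    intro t ht
    rw [← intervalIntegral.integral_sub (hint hV'.continuousOn ht) (hint hV.continuousOn ht)]
    refine intervalIntegral.integral_congr fun r hr => ?_
    rw [uIcc_of_le ht] at hr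
    simp only [hD, max_eq_left hr.1]
  have hgen := fun t (ht : τ ≤ t) =>
    IsGenerator.sub_apply hμ (hV.equation t ht) (hV'.equation t ht)
  have hDe : ∀ t, τ ≤ t → D t = (V' t - (0, ∫ y in τ..t, h y, 0)) -
      (V t - (0, ∫ y in τ..t, h y, 0)) := by
    intro t ht
    simp only [hD, max_eq_left ht, sub_sub_sub_cancel_right]
  have hzero : ∀ (lam : Ioi (0 : ℝ)) (c : StrongDual ℝ (Eig Ω lam)) (t : ℝ), τ ≤ t →
      c ((I t).1.toExp lam) = 0 ∧ c ((I t).2.1.toExp lam) = 0 ∧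
        ∀ᵐ s ∂(memMeasure μ), c (((I t).2.2 s).toExp lam) = 0 := by
    intro lam c
    set L : HH Ω (σ + 1) →L[ℝ] ℝ := c.comp (Scale.proj (E := Eig Ω) (σ + 1) lam) with hL
    set L₀ : HH Ω σ →L[ℝ] ℝ := c.comp (Scale.proj (E := Eig Ω) σ lam) with hL₀
    set A₁ : PhaseSpace Ω μ σ →L[ℝ] ℝ :=
      L.comp (ContinuousLinearMap.fst ℝ (HH Ω (σ + 1)) (HH Ω σ × MemSpace Ω μ σ)) with hA₁
    set A₂ : PhaseSpace Ω μ σ →L[ℝ] ℝ :=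
      L₀.comp ((ContinuousLinearMap.fst ℝ (HH Ω σ) (MemSpace Ω μ σ)).comp
        (ContinuousLinearMap.snd ℝ (HH Ω (σ + 1)) (HH Ω σ × MemSpace Ω μ σ))) with hA₂
    set A₃ : PhaseSpace Ω μ σ →L[ℝ] Lp ℝ 2 (memMeasure μ) :=
      (L.compLpL 2 (memMeasure μ)).comp ((ContinuousLinearMap.snd ℝ (HH Ω σ) (MemSpace Ω μ σ)).comp
        (ContinuousLinearMap.snd ℝ (HH Ω (σ + 1)) (HH Ω σ × MemSpace Ω μ σ))) with hA₃
    have hA₃e : ∀ U : PhaseSpace Ω μ σ, A₃ U =ᵐ[memMeasure μ] fun s => c ((U.2.2 s).toExp lam) :=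
      fun U => L.coeFn_compLp U.2.2
    have hder : ∀ {Y : Type} [NormedAddCommGroup Y] [NormedSpace ℝ Y]
        (A : PhaseSpace Ω μ σ →L[ℝ] Y) (t : ℝ), HasDerivAt (fun t => A (I t)) (A (D t)) t :=
      fun A t => A.hasFDerivAt.comp_hasDerivAt t (hId t)
    have hIτ : I τ = 0 := intervalIntegral.integral_same
    have key := eq_zero_of_energy (τ := τ)
      (m := fun t => ∫ s, c (((I t).2.2 s).toExp lam) ∂(memMeasure μ)) (mem_Ioi.1 lam.2)
      (hder A₁) (hder A₂) (hder A₃) (by rw [hIτ, map_zero]) (by rw [hIτ, map_zero]) (by rw [hIτ, map_zero])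
      (fun t ht => ?_) (fun t ht => ?_) (fun t ht => ?_)
    · intro t ht
      obtain ⟨z1, z2, z3⟩ := key t ht
      refine ⟨z1, z2, ?_⟩
      filter_upwards [hA₃e (I t), Lp.coeFn_zero ℝ 2 (memMeasure μ)] with s s1 s2
      rw [← s1, z3, s2, Pi.zero_apply]
    · have g := (hgen t ht lam c).1
      rw [← hIe t ht, ← hDe t ht] at g
      exact g
    · have g := (hgen t ht lam c).2.1
      rw [← hIe t ht, ← hDe t ht] at g
      exact g
    · have g := (hgen t ht lam c).2.2
      rw [← hIe t ht, ← hDe t ht] at g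
      refine le_trans (le_of_eq ?_) g
      rw [L2.inner_def]
      refine integral_congr_ae ?_
      filter_upwards [hA₃e (I t), hA₃e (D t)] with s s1 s2
      rw [s1, s2, real_inner_comm]
      rfl
  have hdual : ∀ (lam : Ioi (0 : ℝ)) (x : Eig Ω lam),
      (∀ c : StrongDual ℝ (Eig Ω lam), c x = 0) → x = 0 := fun lam x hx =>
    SeparatingDual.eq_zero_of_forall_dual_eq_zero (R := ℝ) hx
  have hI0 : ∀ t, τ ≤ t → I t = 0 := by
    intro t ht
    refine Prod.ext ?_ (Prod.ext ?_ ?_)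
    · exact Scale.ext (funext fun lam => hdual lam _ fun c => (hzero lam c t ht).1)
    · exact Scale.ext (funext fun lam => hdual lam _ fun c => (hzero lam c t ht).2.1)
    · exact lp_eq_zero_of_forall_dual _ fun lam c => (hzero lam c t ht).2.2
  intro t ht
  rcases (mem_Ici.1 ht).eq_or_lt with rfl | hlt
  · rw [hV.initial, hV'.initial]
  · have hev : I =ᶠ[𝓝 t] fun _ => 0 := by
      filter_upwards [Ioi_mem_nhds hlt] with r hr using hI0 r (mem_Ioi.1 hr).le
    have := (hId t).unique ((hasDerivAt_const t (0 : PhaseSpace Ω μ σ)).congr_of_eventuallyEq hev)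
    simp only [hD, max_eq_left hlt.le] at this
    exact sub_eq_zero.1 this

end Uniqueness

/-! ### Weighted estimates of Volterra convolutions -/

/-- Exponentially weighted integrals are controlled by integrals over windows of length `d`. -/
lemma lintegral_exp_mul_le {f : ℝ → ℝ≥0∞} {τ c d : ℝ} {A : ℝ≥0∞} (hc : 0 < c) (hd : 0 < d)
    (hA : ∀ a, τ ≤ a → ∫⁻ y in Icc a (a + d), f y ≤ A) (t : ℝ) :
    ∫⁻ y in Ioc τ t, ENNReal.ofReal (Real.exp (-(c * (t - y)))) * f y ≤
      ENNReal.ofReal (1 + 1 / (c * d)) * A := by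
  -- Windows of length `d` counted backwards from `t`: on the `n`-th the weight is at most `r^n`.
  -- The geometric sum `1/(1-r)` is at most `1 + 1/(cd)` because `1 + cd ≤ exp(cd)`.
  set S : ℕ → Set ℝ := fun n => Ioc τ t ∩ Icc (t - (n + 1) * d) (t - n * d) with hS
  set r : ℝ := Real.exp (-(c * d)) with hr
  have hcd : 0 < c * d := mul_pos hc hd
  have hr1 : r < 1 := by
    rw [hr, Real.exp_lt_one_iff]
    linarith
  have hcover : Ioc τ t ⊆ ⋃ n, S n := by
    intro y hy
    have h0 : 0 ≤ (t - y) / d := div_nonneg (by linarith [hy.2]) hd.le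
    have h1 := Nat.floor_le h0
    have h2 := Nat.lt_floor_add_one ((t - y) / d)
    rw [le_div_iff₀ hd] at h1
    rw [div_lt_iff₀ hd] at h2
    exact mem_iUnion.2 ⟨⌊(t - y) / d⌋₊, hy, by linarith, by linarith⟩
  have hpiece : ∀ n : ℕ, ∫⁻ y in S n, ENNReal.ofReal (Real.exp (-(c * (t - y)))) * f y ≤
      ENNReal.ofReal r ^ n * A := by
    intro n
    have hm : MeasurableSet (S n) := measurableSet_Ioc.inter measurableSet_Icc
    have hw : ∀ y ∈ S n, ENNReal.ofReal (Real.exp (-(c * (t - y)))) * f y ≤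
        ENNReal.ofReal r ^ n * f y := by
      intro y hy
      refine mul_le_mul_left ?_ _
      rw [← ENNReal.ofReal_pow (Real.exp_pos _).le, ← Real.exp_nat_mul]
      refine ENNReal.ofReal_le_ofReal (Real.exp_le_exp.2 ?_)
      have := mul_le_mul_of_nonneg_left hy.2.2 hc.le
      nlinarith
    refine (setLIntegral_mono' hm hw).trans ?_
    rw [lintegral_const_mul' _ _ (by finiteness)]
    refine mul_le_mul_right ?_ _
    refine (lintegral_mono_set fun y hy => ?_).trans (hA (max τ (t - (n + 1) * d))
      (le_max_left _ _))
    refine ⟨max_le hy.1.1.le hy.2.1, ?_⟩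
    have := le_max_right τ (t - (n + 1) * d)
    have h2 := hy.2.2
    nlinarith
  calc _ ≤ ∫⁻ y in ⋃ n, S n, ENNReal.ofReal (Real.exp (-(c * (t - y)))) * f y :=
        lintegral_mono_set hcover
    _ ≤ ∑' n, ∫⁻ y in S n, ENNReal.ofReal (Real.exp (-(c * (t - y)))) * f y :=
        lintegral_iUnion_le _ _
    _ ≤ ∑' n : ℕ, ENNReal.ofReal r ^ n * A := ENNReal.tsum_le_tsum hpiece
    _ = (1 - ENNReal.ofReal r)⁻¹ * A := by rw [ENNReal.tsum_mul_right, ENNReal.tsum_geometric]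
    _ ≤ _ := by
        refine mul_le_mul_left ?_ _
        rw [← ENNReal.ofReal_one, ← ENNReal.ofReal_sub _ (Real.exp_pos _).le,
          ← ENNReal.ofReal_inv_of_pos (by linarith)]
        refine ENNReal.ofReal_le_ofReal ?_
        have h1 : r * (1 + c * d) ≤ 1 := by
          have := Real.add_one_le_exp (c * d)
          calc r * (1 + c * d) ≤ r * Real.exp (c * d) :=
                mul_le_mul_of_nonneg_left (by linarith) (Real.exp_pos _).le
            _ = 1 := by rw [hr, ← Real.exp_add, neg_add_cancel, Real.exp_zero]
        rw [inv_le_iff_one_le_mul₀ (by linarith)]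
        have h2 : (1 + 1 / (c * d)) * (1 - r) - 1 = (1 - r * (1 + c * d)) / (c * d) := by
          field_simp
          ring
        have h3 : 0 ≤ (1 - r * (1 + c * d)) / (c * d) := div_nonneg (by linarith) hcd.le
        linarith

lemma lintegral_exp_le {τ c : ℝ} (hc : 0 < c) (t : ℝ) :
    ∫⁻ y in Ioc τ t, ENNReal.ofReal (Real.exp (-(c * (t - y)))) ≤ ENNReal.ofReal (1 + 1 / c) := by
  have h := lintegral_exp_mul_le (f := fun _ => 1) (τ := τ) (A := 1) hc one_pos
    (fun a _ => by simp) t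
  simpa using h

/-- The Cauchy–Schwarz inequality for the lower integral. -/
lemma sq_lintegral_mul_le {α : Type*} [MeasurableSpace α] {ν : Measure α} {f g : α → ℝ≥0∞}
    (hf : AEMeasurable f ν) (hg : AEMeasurable g ν) :
    (∫⁻ x, f x * g x ∂ν) ^ 2 ≤ (∫⁻ x, f x ^ 2 ∂ν) * ∫⁻ x, g x ^ 2 ∂ν := by
  have h := ENNReal.lintegral_mul_le_Lp_mul_Lq ν Real.HolderConjugate.two_two hf hg
  refine (pow_le_pow_left' h 2).trans_eq ?_
  rw [mul_pow, ← ENNReal.rpow_natCast, ← ENNReal.rpow_natCast, ← ENNReal.rpow_mul,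
    ← ENNReal.rpow_mul]
  simp

/-- Weighted Cauchy–Schwarz inequality for a vector valued integral. -/
lemma enorm_integral_smul_sq_le {X : Type*} [NormedAddCommGroup X] [NormedSpace ℝ X]
    {ν : Measure ℝ} {a g : ℝ → ℝ} (ha : Measurable a) (hg : Measurable g) {H : ℝ → X}
    (hH : AEStronglyMeasurable H ν) :
    ‖∫ y, a y • H y ∂ν‖ₑ ^ 2 ≤ (∫⁻ y, ENNReal.ofReal (a y ^ 2 * Real.exp (g y)) ∂ν) *
      ∫⁻ y, ENNReal.ofReal (Real.exp (-g y)) * ‖H y‖ₑ ^ 2 ∂ν := by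
  set f₁ : ℝ → ℝ≥0∞ := fun y => ENNReal.ofReal (|a y| * Real.exp (g y / 2)) with hf₁
  set f₂ : ℝ → ℝ≥0∞ := fun y => ENNReal.ofReal (Real.exp (-g y / 2)) * ‖H y‖ₑ with hf₂
  have e1 : ∀ y, ‖a y • H y‖ₑ = f₁ y * f₂ y := by
    intro y
    simp only [hf₁, hf₂]
    rw [enorm_smul, ← mul_assoc, ← ENNReal.ofReal_mul (by positivity), mul_assoc, ← Real.exp_add,
      show g y / 2 + -g y / 2 = 0 by ring, Real.exp_zero, mul_one, ← Real.norm_eq_abs, ofReal_norm]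
  have e2 : ∀ y, f₁ y ^ 2 = ENNReal.ofReal (a y ^ 2 * Real.exp (g y)) := by
    intro y
    simp only [hf₁]
    rw [← ENNReal.ofReal_pow (by positivity), mul_pow, sq_abs, ← Real.exp_nat_mul]
    congr 3
    push_cast
    ring
  have e3 : ∀ y, f₂ y ^ 2 = ENNReal.ofReal (Real.exp (-g y)) * ‖H y‖ₑ ^ 2 := by
    intro y
    simp only [hf₂]
    rw [mul_pow, ← ENNReal.ofReal_pow (Real.exp_pos _).le, ← Real.exp_nat_mul]
    congr 3
    push_cast
    ring
  have m1 : Measurable f₁ := by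
    have : Measurable fun y => |a y| := ha.norm
    exact (this.mul (hg.div_const 2).exp).ennreal_ofReal
  have m2 : AEMeasurable f₂ ν :=
    ((hg.neg.div_const 2).exp.ennreal_ofReal).aemeasurable.mul hH.enorm
  have h := sq_lintegral_mul_le m1.aemeasurable m2
  simp only [e2, e3] at h
  refine (pow_le_pow_left' (enorm_integral_le_lintegral_enorm _) 2).trans ?_
  simpa only [e1] using h

/-- Estimate of a convolution with an exponentially decaying kernel. -/
lemma IsCausal.enorm_volterra_sq_le {X : Type*} [NormedAddCommGroup X] [NormedSpace ℝ X]
    {a : ℝ → ℝ} (ha : IsCausal a) {B γ : ℝ} (hB : 0 ≤ B) (hγ : 0 < γ)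
    (hd : ∀ r, 0 ≤ r → a r ^ 2 ≤ B * Real.exp (-(γ * r))) {τ t : ℝ} {H : ℝ → X}
    (hH : AEStronglyMeasurable H (volume.restrict (Ioc τ t))) :
    ‖∫ y in Ioc τ t, a (t - y) • H y‖ₑ ^ 2 ≤ ENNReal.ofReal (B * (1 + 1 / (γ / 2))) *
      ∫⁻ y in Ioc τ t, ENNReal.ofReal (Real.exp (-(γ / 2 * (t - y)))) * ‖H y‖ₑ ^ 2 := by
  -- The weight takes half of the decay rate: one half makes the first factor converge, the other
  -- half stays as a weight on `H`.
  refine (enorm_integral_smul_sq_le (a := fun y => a (t - y)) (g := fun y => γ / 2 * (t - y))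
    (ha.measurable.comp (by fun_prop)) (by fun_prop) hH).trans (mul_le_mul_left ?_ _)
  calc _ ≤ ∫⁻ y in Ioc τ t, ENNReal.ofReal B * ENNReal.ofReal (Real.exp (-(γ / 2 * (t - y)))) := by
        refine setLIntegral_mono' measurableSet_Ioc fun y hy => ?_
        rw [← ENNReal.ofReal_mul hB]
        refine ENNReal.ofReal_le_ofReal ?_
        refine (mul_le_mul_of_nonneg_right (hd (t - y) (by linarith [hy.2]))
          (Real.exp_pos _).le).trans_eq ?_
        rw [mul_assoc, ← Real.exp_add]
        ring_nf
    _ = ENNReal.ofReal B * ∫⁻ y in Ioc τ t, ENNReal.ofReal (Real.exp (-(γ / 2 * (t - y)))) :=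
        lintegral_const_mul' _ _ ENNReal.ofReal_ne_top
    _ ≤ _ := by
        rw [ENNReal.ofReal_mul hB]
        exact mul_le_mul_right (lintegral_exp_le (by linarith) t) _

lemma IsCausal.lintegral_memSq {μ x : ℝ → ℝ} (hμ : IsMemoryKernel μ) (hx : IsCausal x) (t : ℝ) :
    ∫⁻ s, ENNReal.ofReal ((x t - x (t - s)) ^ 2) ∂(memMeasure μ) =
      ENNReal.ofReal (memSq μ x t) := by
  rw [memSq, ← ofReal_integral_eq_lintegral_ofReal, hμ.integral_memMeasure]
  · rfl
  · exact hμ.integrable_memMeasure_iff.2 (hx.integrableOn_memSq hμ.summable t)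
  · exact Eventually.of_forall fun s => sq_nonneg _

/-- Estimate of the history of a convolution. -/
lemma IsCausal.lintegral_history_sq_le {X : Type*} [NormedAddCommGroup X] [NormedSpace ℝ X]
    {μ a : ℝ → ℝ} (hμ : IsMemoryKernel μ) (ha : IsCausal a) {B γ : ℝ} (hB : 0 ≤ B) (hγ : 0 < γ)
    (hd : ∀ r, 0 ≤ r → memSq μ a r ≤ B * Real.exp (-(γ * r))) {τ t : ℝ} {H : ℝ → X}
    (hH : IntegrableOn H (Ioc τ t)) :
    ∫⁻ s, ‖(∫ y in Ioc τ t, a (t - y) • H y) - ∫ y in Ioc τ (t - s), a (t - s - y) • H y‖ₑ ^ 2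
        ∂(memMeasure μ) ≤ ENNReal.ofReal (B * (1 + 1 / (γ / 2))) *
      ∫⁻ y in Ioc τ t, ENNReal.ofReal (Real.exp (-(γ / 2 * (t - y)))) * ‖H y‖ₑ ^ 2 := by
  have : Fact (IsMemoryKernel μ) := ⟨hμ⟩
  have hm := ha.measurable
  set N := ∫⁻ y in Ioc τ t, ENNReal.ofReal (Real.exp (-(γ / 2 * (t - y)))) * ‖H y‖ₑ ^ 2 with hN
  have h1 : ∀ s, 0 < s →
      ‖(∫ y in Ioc τ t, a (t - y) • H y) - ∫ y in Ioc τ (t - s), a (t - s - y) • H y‖ₑ ^ 2 ≤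
        (∫⁻ y in Ioc τ t, ENNReal.ofReal ((a (t - y) - a (t - y - s)) ^ 2 *
          Real.exp (γ / 2 * (t - y)))) * N := by
    intro s hs
    have hi : IntegrableOn (fun y => a (t - y - s) • H y) (Ioc τ t) := by
      obtain ⟨C, -, hC⟩ := ha.exists_bound (t - τ)
      refine hH.bdd_smul C (hm.comp (by fun_prop)).aestronglyMeasurable ?_
      filter_upwards [ae_restrict_mem measurableSet_Ioc] with y hy
      exact hC _ (by linarith [hy.1])
    -- Causality of `a` puts both convolutions over the same interval, so that the history becomes
    -- one convolution with an increment of `a`.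
    have e1 : ∫ y in Ioc τ (t - s), a (t - s - y) • H y =
        ∫ y in Ioc τ t, a (t - y - s) • H y := by
      simp only [sub_right_comm t s]
      refine (setIntegral_eq_of_subset_of_forall_sdiff_eq_zero measurableSet_Ioc
        (Ioc_subset_Ioc_right (by linarith)) fun y hy => ?_).symm
      rw [ha.zero, zero_smul]
      by_contra hcon
      exact hy.2 ⟨hy.1.1, by linarith⟩
    rw [e1, ← integral_sub (ha.integrableOn_volterra hH) hi]
    simp only [← sub_smul]
    exact enorm_integral_smul_sq_le (a := fun y => a (t - y) - a (t - y - s))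
      (g := fun y => γ / 2 * (t - y)) ((hm.comp (by fun_prop)).sub (hm.comp (by fun_prop)))
      (by fun_prop) hH.1
  have hmm : Measurable fun z : ℝ × ℝ => ENNReal.ofReal ((a (t - z.2) - a (t - z.2 - z.1)) ^ 2 *
      Real.exp (γ / 2 * (t - z.2))) := by
    have m1 : Measurable fun z : ℝ × ℝ => a (t - z.2) := hm.comp (by fun_prop)
    have m2 : Measurable fun z : ℝ × ℝ => a (t - z.2 - z.1) := hm.comp (by fun_prop)
    exact (((m1.sub m2).pow_const 2).mul (by fun_prop)).ennreal_ofReal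
  calc _ ≤ ∫⁻ s, (∫⁻ y in Ioc τ t, ENNReal.ofReal ((a (t - y) - a (t - y - s)) ^ 2 *
          Real.exp (γ / 2 * (t - y)))) * N ∂(memMeasure μ) :=
        lintegral_mono_ae (hμ.ae_memMeasure_of_forall h1)
    _ = (∫⁻ s, (∫⁻ y in Ioc τ t, ENNReal.ofReal ((a (t - y) - a (t - y - s)) ^ 2 *
          Real.exp (γ / 2 * (t - y)))) ∂(memMeasure μ)) * N :=
        lintegral_mul_const _ hmm.lintegral_prod_right'
    _ ≤ _ := by
        refine mul_le_mul_left ?_ _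
        -- After the exchange, the integral in `s` is the squared memory norm of the kernel `a` at
        -- time `t - y`, which decays by hypothesis.
        rw [lintegral_lintegral_swap hmm.aemeasurable]
        calc _ = ∫⁻ y in Ioc τ t, ENNReal.ofReal (memSq μ a (t - y)) *
              ENNReal.ofReal (Real.exp (γ / 2 * (t - y))) := by
              refine lintegral_congr fun y => ?_
              simp only [ENNReal.ofReal_mul (sq_nonneg _)]
              rw [lintegral_mul_const' _ _ ENNReal.ofReal_ne_top, ha.lintegral_memSq hμ]
          _ ≤ ∫⁻ y in Ioc τ t,
              ENNReal.ofReal B * ENNReal.ofReal (Real.exp (-(γ / 2 * (t - y)))) := by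
              refine setLIntegral_mono' measurableSet_Ioc fun y hy => ?_
              rw [← ENNReal.ofReal_mul (hμ.memSq_nonneg _ _), ← ENNReal.ofReal_mul hB]
              refine ENNReal.ofReal_le_ofReal ?_
              refine (mul_le_mul_of_nonneg_right (hd (t - y) (by linarith [hy.2]))
                (Real.exp_pos _).le).trans_eq ?_
              rw [mul_assoc, ← Real.exp_add]
              ring_nf
          _ = ENNReal.ofReal B * ∫⁻ y in Ioc τ t, ENNReal.ofReal (Real.exp (-(γ / 2 * (t - y)))) :=
              lintegral_const_mul' _ _ ENNReal.ofReal_ne_top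
          _ ≤ _ := by
              rw [ENNReal.ofReal_mul hB]
              exact mul_le_mul_right (lintegral_exp_le (by linarith) t) _

/-- The three components of the estimate in one eigenspace. -/
lemma IsFundamental.estimate {X : Type*} [NormedAddCommGroup X] [NormedSpace ℝ X]
    [CompleteSpace X] {μ : ℝ → ℝ} (hμ : IsMemoryKernel μ) {lam : ℝ} (hlam : 0 < lam)
    {w p q : ℝ → ℝ} (hF : IsFundamental μ lam w p q) {B γ : ℝ} (hB : 0 ≤ B) (hγ : 0 < γ)
    (hd : ∀ r, 0 ≤ r → modeEnergy μ lam p q r ≤ lam * (B * Real.exp (-(γ * r))))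
    {τ : ℝ} {h : ℝ → X} (hh : ∀ T, IntegrableOn h (Ioc τ T)) {t : ℝ} (ht : τ ≤ t) {b N : ℝ≥0∞}
    (hb : b = ENNReal.ofReal (B * (1 + 1 / (γ / 2))))
    (hN : N = ∫⁻ y in Ioc τ t, ENNReal.ofReal (Real.exp (-(γ / 2 * (t - y)))) *
      ‖∫ x in Ioc τ y, h x‖ₑ ^ 2) :
    ‖∫ y in Ioc τ t, w (t - y) • h y‖ₑ ^ 2 ≤ b * N ∧
    ‖∫ y in Ioc τ t, p (t - y) • h y‖ₑ ^ 2 ≤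
      2 * ‖∫ y in Ioc τ t, h y‖ₑ ^ 2 + 2 * (ENNReal.ofReal lam * (b * N)) ∧
    ∫⁻ s, ‖(∫ y in Ioc τ t, w (t - y) • h y) - ∫ y in Ioc τ (t - s), w (t - s - y) • h y‖ₑ ^ 2
      ∂(memMeasure μ) ≤ b * N := by
  have hH : IntegrableOn (fun y => ∫ x in Ioc τ y, h x) (Ioc τ t) := by
    have hc : ContinuousOn (fun y => ∫ x in Ioc τ y, h x) (Icc τ t) :=
      intervalIntegral.continuousOn_primitive
        ((integrableOn_Icc_iff_integrableOn_Ioc).2 (hh t))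
    exact hc.integrableOn_Icc.mono_set Ioc_subset_Icc_self
  have hmem : ∀ r, 0 ≤ lam * memSq μ p r := fun r => mul_nonneg hlam.le (hμ.memSq_nonneg p r)
  have hp : ∀ r, 0 ≤ r → p r ^ 2 ≤ B * Real.exp (-(γ * r)) := by
    intro r hr
    have h1 := hd r hr
    rw [modeEnergy] at h1
    refine le_of_mul_le_mul_left ?_ hlam
    linarith [hmem r, sq_nonneg (q r)]
  have hq : ∀ r, 0 ≤ r → q r ^ 2 ≤ lam * B * Real.exp (-(γ * r)) := by
    intro r hr
    have h1 := hd r hr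
    rw [modeEnergy] at h1
    have : 0 ≤ lam * p r ^ 2 := by positivity
    linarith [hmem r]
  have hs : ∀ r, 0 ≤ r → memSq μ p r ≤ B * Real.exp (-(γ * r)) := by
    intro r hr
    have h1 := hd r hr
    rw [modeEnergy] at h1
    refine le_of_mul_le_mul_left ?_ hlam
    have : 0 ≤ lam * p r ^ 2 := by positivity
    linarith [sq_nonneg (q r)]
  -- The derivative is moved from the primitive of `h` to the kernel, `w * h = p * H`; it is the
  -- decay of `p`, not of `w`, that is used.
  have hw : ∀ T, ∫ y in Ioc τ T, w (T - y) • h y =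
      ∫ y in Ioc τ T, p (T - y) • ∫ x in Ioc τ y, h x := by
    intro T
    rcases le_total τ T with hT | hT
    · rw [← hF.sol_p.causal_x.volterra_primitive hT (hh T)]
      refine setIntegral_congr_fun measurableSet_Ioc fun y hy => ?_
      rw [hF.sol_w.causal_x.sub_eq_integral hF.sol_w.causal_y hF.sol_w.deriv_x le_rfl
        (by linarith [hy.2]), hF.w_zero, sub_zero]
    · simp [Ioc_eq_empty_of_le hT]
  have hv := hF.sol_p.causal_y.volterra_primitive ht (hh t)
  subst hb hN
  refine ⟨?_, ?_, ?_⟩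
  · rw [hw]
    exact hF.sol_p.causal_x.enorm_volterra_sq_le hB hγ hp hH.1
  · have h2 := hF.sol_p.causal_y.enorm_volterra_sq_le (by positivity) hγ hq hH.1
    rw [mul_assoc lam, ENNReal.ofReal_mul hlam.le, mul_assoc (ENNReal.ofReal lam)] at h2
    rw [hF.volterra_p (hh t), hv, ← mul_add]
    refine (pow_le_pow_left' (enorm_add_le _ _) 2).trans ?_
    have h3 := ENNReal.rpow_add_le_mul_rpow_add_rpow ‖∫ y in Ioc τ t, h y‖ₑ
      ‖∫ y in Ioc τ t, q (t - y) • ∫ x in Ioc τ y, h x‖ₑ one_le_two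
    norm_num at h3
    exact h3.trans (by gcongr)
  · simp only [hw]
    exact hF.sol_p.causal_x.lintegral_history_sq_le hμ hB hγ hs hH

/-! ### The estimate in the phase space -/

section Estimate

variable {Ω : Set E3} {μ : ℝ → ℝ}

lemma eNormHH_sq (θ : ℝ) (u : Expansion Ω) : eNormHH Ω θ u ^ 2 =
    ∑' lam : Ioi (0 : ℝ), ENNReal.ofReal ((lam : ℝ) ^ θ) * ‖u lam‖ₑ ^ 2 := by
  unfold eNormHH scaleENorm
  rw [← ENNReal.rpow_natCast, ← ENNReal.rpow_mul]
  simp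

lemma eNormHH_smul_sq (θ : ℝ) {ρ c : ℝ} (u : HH Ω ρ) :
    eNormHH Ω θ (c • u).toExp ^ 2 = ENNReal.ofReal (c ^ 2) * eNormHH Ω θ u.toExp ^ 2 := by
  rw [eNormHH_sq, eNormHH_sq, ← ENNReal.tsum_mul_left]
  refine tsum_congr fun lam => ?_
  change ENNReal.ofReal ((lam : ℝ) ^ θ) * ‖c • u.toExp lam‖ₑ ^ 2 = _
  rw [enorm_smul, mul_pow, ← ofReal_norm c, ← ENNReal.ofReal_pow (norm_nonneg _), Real.norm_eq_abs,
    sq_abs]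
  ring

lemma enorm_sq_eq_zero {X : Type*} [NormedAddCommGroup X] {x : X} (h : x = 0) :
    ‖x‖ₑ ^ 2 = 0 := by simp [h]

/-- Integration of the norm mode by mode. -/
lemma lintegral_eNormHH_sq {α : Type*} [MeasurableSpace α] {ν : Measure α} {ρ : ℝ} (θ : ℝ)
    {f : α → HH Ω ρ} (hf : AEStronglyMeasurable f ν) {g : α → ℝ≥0∞} (hg : Measurable g) :
    ∫⁻ s, g s * eNormHH Ω θ (f s).toExp ^ 2 ∂ν = ∑' lam : Ioi (0 : ℝ),
      ENNReal.ofReal ((lam : ℝ) ^ θ) * ∫⁻ s, g s * ‖(f s).toExp lam‖ₑ ^ 2 ∂ν := by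
  have key : ∀ f : α → HH Ω ρ, StronglyMeasurable f →
      ∫⁻ s, g s * eNormHH Ω θ (f s).toExp ^ 2 ∂ν = ∑' lam : Ioi (0 : ℝ),
        ENNReal.ofReal ((lam : ℝ) ^ θ) * ∫⁻ s, g s * ‖(f s).toExp lam‖ₑ ^ 2 ∂ν := by
    intro f hf
    obtain ⟨S, hS, hS0⟩ := Scale.exists_countable_support hf
    have : Countable S := hS
    have hm : ∀ lam, Measurable fun s => ‖(f s).toExp lam‖ₑ ^ 2 := fun lam =>
      (((Scale.proj (E := Eig Ω) ρ lam).continuous.comp_stronglyMeasurable hf).enorm).pow_const 2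
    have e1 : ∀ s, g s * eNormHH Ω θ (f s).toExp ^ 2 = ∑' lam : S,
        ENNReal.ofReal (((lam : Ioi (0 : ℝ)) : ℝ) ^ θ) *
          (g s * ‖(f s).toExp (lam : Ioi (0 : ℝ))‖ₑ ^ 2) := by
      intro s
      rw [eNormHH_sq, ← ENNReal.tsum_mul_left,
        ← tsum_subtype_eq_of_support_subset (s := S) fun lam hlam => ?_]
      · exact tsum_congr fun lam => by ring
      · by_contra h
        exact hlam (by simp only [enorm_sq_eq_zero (hS0 s lam h), mul_zero])
    simp only [e1]
    refine (lintegral_tsum fun lam : S => Measurable.aemeasurable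
      ((hg.mul (hm lam)).const_mul (ENNReal.ofReal (((lam : Ioi (0 : ℝ)) : ℝ) ^ θ)))).trans ?_
    refine Eq.trans ?_ (tsum_subtype_eq_of_support_subset (s := S) fun lam hlam => ?_)
    · exact tsum_congr fun lam => lintegral_const_mul' _ _ ENNReal.ofReal_ne_top
    · by_contra h
      refine hlam ?_
      simp only [enorm_sq_eq_zero (hS0 _ lam h), mul_zero, lintegral_zero]
  have e := hf.ae_eq_mk
  rw [lintegral_congr_ae (g := fun s => g s * eNormHH Ω θ (hf.mk f s).toExp ^ 2)
    (by filter_upwards [e] with s hs; rw [hs]), key _ hf.stronglyMeasurable_mk]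
  refine tsum_congr fun lam => ?_
  rw [lintegral_congr_ae]
  filter_upwards [e] with s hs
  rw [hs]

/-- Existence of a solution together with the bound of its norm by the primitive of the
forcing. -/
theorem exists_isSolution_phaseENorm_le (hΩ : IsSmoothBoundedDomain Ω) (hμ : IsMemoryKernel μ)
    (σ : ℝ) : ∃ B c : ℝ, 0 < B ∧ 0 < c ∧ ∀ (τ : ℝ) (h : ℝ → HH Ω σ),
      (∀ T, IntegrableOn h (Ioc τ T)) → ∃ V : ℝ → PhaseSpace Ω μ σ, IsSolution τ h V ∧
        ∀ t, τ ≤ t → phaseENorm (σ - 1) (V t) ^ 2 ≤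
          2 * eNormHH Ω (σ - 1) (∫ y in Ioc τ t, h y).toExp ^ 2 +
            ENNReal.ofReal B * ∫⁻ y in Ioc τ t, ENNReal.ofReal (Real.exp (-(c * (t - y)))) *
              eNormHH Ω σ (∫ x in Ioc τ y, h x).toExp ^ 2 := by
  obtain ⟨lam1, hlam1, hgap⟩ := hΩ.exists_gap
  obtain ⟨C, γ, hC, hγ, hdec⟩ := hμ.exists_decay hlam1
  choose w p q hF using fun lam : Ioi (0 : ℝ) => hμ.exists_isFundamental (lam := lam)
  have hκ : 0 < mass μ := hμ.mass_pos'
  -- By `energy_zero` with `p(0) = 1`, `q(0) = 0`, the initial energy of `p` is `lam (1 + mass μ)`.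
  set B₀ := C * (1 + mass μ) with hB₀
  have hB₀p : 0 < B₀ := by positivity
  set b₁ := B₀ * (1 + 1 / (γ / 2)) with hb₁
  have hb₁p : 0 < b₁ := by positivity
  -- The factor `4` is `1 + 2 + 1`, from the three components of the phase space norm.
  refine ⟨4 * b₁, γ / 2, by positivity, by positivity, fun τ h hh => ?_⟩
  obtain ⟨V, hV, v, hv, hvm, hV1, hV2, hV3⟩ := exists_isSolution hμ hF hh
  refine ⟨V, hV, fun t ht => ?_⟩
  set H : ℝ → HH Ω σ := fun y => ∫ x in Ioc τ y, h x with hH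
  have hHm : ∀ y lam, (H y).toExp lam = ∫ x in Ioc τ y, (h x).toExp lam := fun y lam =>
    ((Scale.proj (E := Eig Ω) σ lam).integral_comp_comm (hh y)).symm
  set b := ENNReal.ofReal b₁ with hb
  set N : Ioi (0 : ℝ) → ℝ≥0∞ := fun lam => ∫⁻ y in Ioc τ t,
    ENNReal.ofReal (Real.exp (-(γ / 2 * (t - y)))) * ‖(H y).toExp lam‖ₑ ^ 2 with hN
  have hmode : ∀ lam : Ioi (0 : ℝ), ‖(v t).toExp lam‖ₑ ^ 2 ≤ b * N lam ∧
      ‖(V t).2.1.toExp lam‖ₑ ^ 2 ≤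
        2 * ‖(H t).toExp lam‖ₑ ^ 2 + 2 * (ENNReal.ofReal lam * (b * N lam)) ∧
      ∫⁻ s, 1 * ‖(v t - v (t - s)).toExp lam‖ₑ ^ 2 ∂(memMeasure μ) ≤ b * N lam := by
    intro lam
    -- Below the spectral gap the eigenspaces are trivial, so the uniform decay is needed only for
    -- `lam ≥ lam1`.
    rcases lt_or_ge (lam : ℝ) lam1 with hlt | hge
    · have z := hgap lam hlt
      refine ⟨?_, ?_, ?_⟩
      · rw [enorm_sq_eq_zero (z _)]
        exact zero_le
      · rw [enorm_sq_eq_zero (z _)]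
        exact zero_le
      · have : ∀ s, ‖(v t - v (t - s)).toExp lam‖ₑ ^ 2 = 0 := fun s => enorm_sq_eq_zero (z _)
        simp only [this, mul_zero, lintegral_zero]
        exact zero_le
    · have hd : ∀ r, 0 ≤ r → modeEnergy μ lam (p lam) (q lam) r ≤
          lam * (B₀ * Real.exp (-(γ * r))) := by
        intro r hr
        have := hdec lam hge _ _ (hF lam).sol_p r hr
        rw [(hF lam).sol_p.energy_zero, (hF lam).p_zero, (hF lam).q_zero] at this
        refine this.trans_eq ?_
        rw [hB₀]
        ring
      have hest := (hF lam).estimate hμ (mem_Ioi.1 lam.2) hB₀p.le hγ hd (fun T =>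
        (Scale.proj (E := Eig Ω) σ lam).integrable_comp (hh T)) ht (b := b) (N := N lam) rfl (by
          simp only [hN, hHm]
          rfl)
      obtain ⟨h1, h2, h3⟩ := hest
      refine ⟨?_, ?_, ?_⟩
      · rw [hvm]
        exact h1
      · rw [hV2, hHm]
        exact h2
      · simp only [one_mul]
        refine le_trans (le_of_eq (lintegral_congr fun s => ?_)) h3
        change ‖(v t).toExp lam - (v (t - s)).toExp lam‖ₑ ^ 2 = _
        rw [hvm, hvm]
        rfl
  set T := ∑' lam : Ioi (0 : ℝ), ENNReal.ofReal ((lam : ℝ) ^ σ) * N lam with hT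
  have hHc : AEStronglyMeasurable H (volume.restrict (Ioc τ t)) := by
    have hc : ContinuousOn H (Icc τ t) := intervalIntegral.continuousOn_primitive
      ((integrableOn_Icc_iff_integrableOn_Ioc).2 (hh t))
    exact (hc.mono Ioc_subset_Icc_self).aestronglyMeasurable measurableSet_Ioc
  have hTe : ∫⁻ y in Ioc τ t, ENNReal.ofReal (Real.exp (-(γ / 2 * (t - y)))) *
      eNormHH Ω σ (H y).toExp ^ 2 = T :=
    lintegral_eNormHH_sq σ hHc (by fun_prop)
  have hbT : ∑' lam : Ioi (0 : ℝ), ENNReal.ofReal ((lam : ℝ) ^ σ) * (b * N lam) = b * T := by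
    rw [hT, ← ENNReal.tsum_mul_left]
    exact tsum_congr fun lam => by ring
  have a1 : eNormHH Ω σ (V t).1.toExp ^ 2 ≤ b * T := by
    rw [hV1, eNormHH_sq, ← hbT]
    exact ENNReal.tsum_le_tsum fun lam => mul_le_mul_right (hmode lam).1 _
  have a2 : eNormHH Ω (σ - 1) (V t).2.1.toExp ^ 2 ≤
      2 * eNormHH Ω (σ - 1) (H t).toExp ^ 2 + 2 * (b * T) := by
    rw [eNormHH_sq, eNormHH_sq, ← hbT, ← ENNReal.tsum_mul_left, ← ENNReal.tsum_mul_left,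
      ← ENNReal.tsum_add]
    refine ENNReal.tsum_le_tsum fun lam => ?_
    refine (mul_le_mul_right (hmode lam).2.1 _).trans_eq ?_
    -- The factor `lam` lost in the second component turns the weight `lam^{σ-1}` into `lam^σ`, the
    -- same as in the other two components.
    have : ENNReal.ofReal ((lam : ℝ) ^ σ) =
        ENNReal.ofReal ((lam : ℝ) ^ (σ - 1)) * ENNReal.ofReal lam := by
      rw [← ENNReal.ofReal_mul (Real.rpow_nonneg lam.2.le _),
        ← Real.rpow_add_one (mem_Ioi.1 lam.2).ne', sub_add_cancel]
    rw [this]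
    ring
  have a3 : ∫⁻ s, eNormHH Ω σ ((V t).2.2 s).toExp ^ 2 ∂(memMeasure μ) ≤ b * T := by
    have hc : Continuous fun s => v t - v (t - s) :=
      continuous_const.sub (hv.cont.comp (by fun_prop))
    rw [lintegral_congr_ae (g := fun s => 1 * eNormHH Ω σ (v t - v (t - s)).toExp ^ 2)
      (by filter_upwards [hV3 t] with s hs; rw [hs, one_mul]),
      lintegral_eNormHH_sq σ hc.aestronglyMeasurable measurable_const, ← hbT]
    exact ENNReal.tsum_le_tsum fun lam => mul_le_mul_right (hmode lam).2.2 _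
  have hsq : phaseENorm (σ - 1) (V t) ^ 2 = eNormHH Ω σ (V t).1.toExp ^ 2 +
      eNormHH Ω (σ - 1) (V t).2.1.toExp ^ 2 +
      ∫⁻ s, eNormHH Ω σ ((V t).2.2 s).toExp ^ 2 ∂(memMeasure μ) := by
    unfold phaseENorm
    rw [← ENNReal.rpow_natCast, ← ENNReal.rpow_mul, sub_add_cancel]
    simp
  rw [hsq, hTe, ENNReal.ofReal_mul (by norm_num), ENNReal.ofReal_ofNat]
  refine (add_le_add (add_le_add a1 a2) a3).trans_eq ?_
  ring

end Estimate

/-! ### Rapidly oscillating forcing -/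

section Oscillation

variable {Ω : Set E3} {σ : ℝ} {k : ℝ → HH Ω σ}

lemma IsL2loc.integrableOn_comp_div (hk : IsL2loc k) {ε : ℝ} (hε : 0 < ε) (τ T : ℝ) :
    IntegrableOn (fun t => k (t / ε)) (Ioc τ T) := by
  rcases le_total τ T with h | h
  · rw [← intervalIntegrable_iff_integrableOn_Ioc_of_le h]
    have hi : IntervalIntegrable k volume (τ / ε) (T / ε) := by
      rw [intervalIntegrable_iff_integrableOn_Icc_of_le (div_le_div_of_nonneg_right h hε.le)]
      exact (hk _ _).integrable one_le_two
    have := hi.comp_mul_right (c := ε⁻¹)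
    simpa [div_eq_mul_inv, hε.ne'] using this
  · simp [Ioc_eq_empty_of_le h]

/-- The change of variables brings out the factor `ε`, the only source of smallness in the final
bound. -/
lemma setIntegral_comp_div_eq {ε : ℝ} (hε : 0 < ε) {τ y : ℝ} (h : τ ≤ y) :
    ∫ x in Ioc τ y, k (x / ε) = ε • primitive k (y / ε) (τ / ε) := by
  rw [← intervalIntegral.integral_of_le h, intervalIntegral.integral_comp_div _ hε.ne']
  rfl

lemma lintegral_Icc_comp_div (f : ℝ → ℝ≥0∞) {ε : ℝ} (hε : 0 < ε) (a : ℝ) :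
    ∫⁻ y in Icc a (a + ε), f (y / ε) =
      ENNReal.ofReal ε * ∫⁻ x in Icc (a / ε) (a / ε + 1), f x := by
  have himg : (fun x => ε * x) '' Icc (a / ε) (a / ε + 1) = Icc a (a + ε) := by
    rw [image_mul_left_Icc' hε]
    congr 1 <;> field_simp
  rw [← himg, lintegral_image_eq_lintegral_abs_deriv_mul (f' := fun _ => ε) measurableSet_Icc
    (fun x _ => by simpa using ((hasDerivAt_id x).const_mul ε).hasDerivWithinAt)
    (fun x _ y _ hxy => mul_left_cancel₀ hε.ne' hxy),
    ← lintegral_const_mul' _ _ ENNReal.ofReal_ne_top]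
  refine lintegral_congr fun x => ?_
  rw [abs_of_pos hε, mul_div_cancel_left₀ _ hε.ne']

end Oscillation

end Viscoelastic

/-! ### The estimate for rapidly oscillating forcing -/

theorem proposition7p1 (Ω : Set E3) (hΩ : IsSmoothBoundedDomain Ω)
    (μ : ℝ → ℝ) (hμ : IsMemoryKernel μ) (σ : ℝ) (ε₀ : ℝ) (hε₀ : 0 < ε₀) :
    ∃ c : ℝ, 0 < c ∧
      ∀ (k : ℝ → HH Ω σ) (ℓ : ℝ), IsL2loc k → 0 ≤ ℓ →
        (∀ τ t : ℝ, τ ≤ t →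
          eNormHH Ω (σ - 1) (primitive k t τ).toExp ^ 2 +
            ∫⁻ y in Icc t (t + 1), eNormHH Ω σ (primitive k y τ).toExp ^ 2
              ≤ ENNReal.ofReal (ℓ ^ 2)) →
        ∀ ε : ℝ, 0 < ε → ε ≤ ε₀ → ∀ τ : ℝ,
          ∃ V : ℝ → PhaseSpace Ω μ σ,
            IsSolution τ (fun t => k (t / ε)) V ∧
            (∀ V' : ℝ → PhaseSpace Ω μ σ,
              IsSolution τ (fun t => k (t / ε)) V' → EqOn V' V (Ici τ)) ∧
            ∀ t, τ ≤ t → phaseENorm (σ - 1) (V t) ≤ ENNReal.ofReal (c * ℓ * ε) := by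
  obtain ⟨B, c, hB, hc, hmain⟩ := exists_isSolution_phaseENorm_le hΩ hμ σ
  -- `M` is the constant obtained for the squared norm; since `M ≥ 1`, `M ≤ M²`, and it also serves
  -- for the norm itself.
  set M := 2 + B * (ε₀ + 1 / c) with hM
  have hM2 : 2 ≤ M := by
    have : 0 ≤ B * (ε₀ + 1 / c) := by positivity
    linarith
  refine ⟨M, by linarith, fun k ℓ hk hℓ hK ε hε hεε₀ τ => ?_⟩
  obtain ⟨V, hV, hbound⟩ := hmain τ (fun t => k (t / ε)) (hk.integrableOn_comp_div hε τ)
  refine ⟨V, hV, fun V' hV' => hV.eqOn hμ hV', fun t ht => ?_⟩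
  have hdiv : ∀ {y}, τ ≤ y → τ / ε ≤ y / ε := fun h => div_le_div_of_nonneg_right h hε.le
  rw [← ENNReal.pow_le_pow_left_iff two_ne_zero]
  refine (hbound t ht).trans ?_
  have h1 : eNormHH Ω (σ - 1) (∫ y in Ioc τ t, k (y / ε)).toExp ^ 2 ≤
      ENNReal.ofReal (ε ^ 2) * ENNReal.ofReal (ℓ ^ 2) := by
    rw [setIntegral_comp_div_eq hε ht, eNormHH_smul_sq]
    exact mul_le_mul_right (le_self_add.trans (hK _ _ (hdiv ht))) _
  have h2 : ∫⁻ y in Ioc τ t, ENNReal.ofReal (Real.exp (-(c * (t - y)))) *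
      eNormHH Ω σ (∫ x in Ioc τ y, k (x / ε)).toExp ^ 2 ≤
      ENNReal.ofReal (ε ^ 2) * (ENNReal.ofReal (1 + 1 / (c * ε)) *
        (ENNReal.ofReal ε * ENNReal.ofReal (ℓ ^ 2))) := by
    -- Windows of length `ε` in `y` are unit windows in `y/ε`, where the hypothesis on `K` applies.
    -- The factor `ε` of the change of variables compensates the `1/(cε)` of the sum over windows,
    -- leaving `ε + 1/c`.
    have hwin := lintegral_exp_mul_le (τ := τ) (d := ε) hc hε
      (f := fun y => eNormHH Ω σ (primitive k (y / ε) (τ / ε)).toExp ^ 2) (fun a ha => by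
        rw [lintegral_Icc_comp_div (fun x => eNormHH Ω σ (primitive k x (τ / ε)).toExp ^ 2) hε]
        exact mul_le_mul_right (le_add_self.trans (hK _ _ (hdiv ha))) _) t
    refine le_trans (le_of_eq ?_) (mul_le_mul_right hwin (ENNReal.ofReal (ε ^ 2)))
    rw [← lintegral_const_mul' _ _ ENNReal.ofReal_ne_top]
    refine setLIntegral_congr_fun measurableSet_Ioc fun y hy => ?_
    beta_reduce
    rw [setIntegral_comp_div_eq hε hy.1.le, eNormHH_smul_sq]
    ring
  calc _ ≤ 2 * (ENNReal.ofReal (ε ^ 2) * ENNReal.ofReal (ℓ ^ 2)) + ENNReal.ofReal B *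
        (ENNReal.ofReal (ε ^ 2) * (ENNReal.ofReal (1 + 1 / (c * ε)) *
          (ENNReal.ofReal ε * ENNReal.ofReal (ℓ ^ 2)))) := by gcongr
    _ = ENNReal.ofReal (2 * (ε ^ 2 * ℓ ^ 2) +
        B * (ε ^ 2 * ((1 + 1 / (c * ε)) * (ε * ℓ ^ 2)))) := by
        have hg : 0 ≤ 1 + 1 / (c * ε) := by positivity
        generalize 1 + 1 / (c * ε) = g at hg
        rw [ENNReal.ofReal_add (by positivity) (by positivity), ENNReal.ofReal_mul (by positivity),
          ENNReal.ofReal_mul (by positivity), ENNReal.ofReal_mul (by positivity),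
          ENNReal.ofReal_mul (by positivity), ENNReal.ofReal_mul (by positivity),
          ENNReal.ofReal_mul (by positivity), ENNReal.ofReal_ofNat]
    _ ≤ ENNReal.ofReal (M * ℓ * ε) ^ 2 := by
        rw [← ENNReal.ofReal_pow (by positivity)]
        refine ENNReal.ofReal_le_ofReal ?_
        have e1 : (1 + 1 / (c * ε)) * (ε * ℓ ^ 2) = (ε + 1 / c) * ℓ ^ 2 := by
          field_simp
        have e2 : 2 * (ε ^ 2 * ℓ ^ 2) + B * (ε ^ 2 * ((ε + 1 / c) * ℓ ^ 2)) =
            (2 + B * (ε + 1 / c)) * (ε ^ 2 * ℓ ^ 2) := by ring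
        have e3 : (M * ℓ * ε) ^ 2 = M ^ 2 * (ε ^ 2 * ℓ ^ 2) := by ring
        rw [e1, e2, e3]
        refine mul_le_mul_of_nonneg_right ?_ (by positivity)
        have : 2 + B * (ε + 1 / c) ≤ M := by
          rw [hM]
          gcongr
        nlinarith
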